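/- Let $B\subset\mathbb{R}^2$ be the open unit disk, with polar coordinates $(R,\theta)$ and polar frame $e_R=(\cos\theta,\sin\theta)$, $e_\theta=(-\sin\theta,\cos\theta)$. Let $\nu>0$ and let $M=(M_{ijkl})\in L^\infty(B,\mathbb{R}^{16})$ be symmetric, $M_{ijkl}=M_{klij}$, with $M(x)\xi\cdot\xi\ge\nu|\xi|^2$ for a.e. $x\in B$ and all $\xi\in\mathbb{R}^{2\times2}$. Put $f(x,\xi)=M(x)\xi\cdot\xi$ and $E(u)=\int_B f(x,\nabla u)\,dx$ for $u\in W^{1,2}(B,\mathbb{R}^2)$. Let $g$ be the trace on $\partial B$ of some $u_0\in W^{1,2}(B,\mathbb{R}^2)$ with $\det\nabla u_0=1$ a.e. in $B$, and let $$\mathcal{A}^g=\{u\in W^{1,2}(B,\mathbb{R}^2):\ \det\nabla u=1\ \text{a.e. in } B,\ u|_{\partial B}=g\},$$ where $u|_{\partial B}=g$ means $u-u_0\in W^{1,2}_0(B,\mathbb{R}^2)$. Let $u\in\mathcal{A}^g$ be a stationary point of $E$ with pressure $\lambda$, that is, $\lambda\in W^{1,1}(B)$ and $$\operatorname{div}\big(\nabla_\xi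 f(x,\nabla u)+2\lambda(x)\,\mathrm{cof}\,\nabla u\big)=0\quad\text{in }\mathcal{D}'(B),\qquad \mathrm{cof}\,A=\begin{pmatrix}a_{22}&-a_{21}\\-a_{12}&a_{11}\end{pmatrix},$$ the divergence being taken row by row. Assume that $\lambda$ depends on $R$ alone or on $\theta$ alone, and that $$\|R\nabla\lambda\|_{L^\infty(B,\mathbb{R}^2)}\le\nu,$$ where $\|G\|_{L^\infty(B,\mathbb{R}^2)}=\max\{\|G\cdot e_R\|_{L^\infty(B)},\|G\cdot e_\theta\|_{L^\infty(B)}\}$. Then: 1. $u$ is a global minimizer of $E$ in $\mathcal{A}^g$, i.e. $E(u)\le E(v)$ for every $v\in\mathcal{A}^g$. 2. If moreover $|R\nabla\lambda(x)|<\nu$ for (almost) every $x$ in some measurable set $U\subset B$ of positive Lebesgue measure, then $u$ is the unique global minimizer of $E$ in $\mathcal{A}^g$: every global minimizer of $E$ in $\mathcal{A}^g$ equals $u$ a.e. in $B$. -/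

import Mathlib

open MeasureTheory Filter Topology
open scoped ENNReal ContDiff

noncomputable section

namespace Incompressible

/-- The Euclidean plane. -/
abbrev Plane := EuclideanSpace ℝ (Fin 2)

/-- The open unit disk `B`. -/
def disk : Set Plane := Metric.ball 0 1

/-- Lebesgue measure on the unit disk. -/
def diskMeasure : Measure Plane := volume.restrict disk

/-- The classical partial derivative `∂ⱼ φ`. -/
def partialDeriv (j : Fin 2) (φ : Plane → ℝ) (x : Plane) : ℝ :=
  fderiv ℝ φ x (EuclideanSpace.single j 1)

/-- Test functions: the class `C_c^∞(B)`. -/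
structure IsTestFunction (φ : Plane → ℝ) : Prop where
  smooth : ContDiff ℝ ∞ φ
  compact : HasCompactSupport φ
  support : tsupport φ ⊆ disk

/-- `g` is a weak gradient of the scalar function `w` in `B`. -/
structure HasWeakGradient (w : Plane → ℝ) (g : Plane → Plane) : Prop where
  locallyIntegrable : LocallyIntegrableOn w disk
  locallyIntegrable_grad : LocallyIntegrableOn g disk
  integral_eq : ∀ φ : Plane → ℝ, IsTestFunction φ → ∀ j : Fin 2,
    ∫ x, w x * partialDeriv j φ x ∂diskMeasure = - ∫ x, g x j * φ x ∂diskMeasure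

open Classical in
/-- The weak gradient `∇w` in `B` (unique up to null sets); the value is `0` if there is none. -/
def weakGradient (w : Plane → ℝ) : Plane → Plane :=
  if h : ∃ g, HasWeakGradient w g then h.choose else 0

/-- The Sobolev space `W^{1,q}(B)` of scalar functions. -/
def MemSobolev (q : ℝ≥0∞) (w : Plane → ℝ) : Prop :=
  MemLp w q diskMeasure ∧ ∃ g : Plane → Plane, HasWeakGradient w g ∧ MemLp g q diskMeasure

/-- The space `W_0^{1,2}(B)`: the closure of `C_c^∞(B)` in `W^{1,2}(B)`. -/
def MemSobolevZero (w : Plane → ℝ) : Prop :=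
  MemSobolev 2 w ∧ ∃ φ : ℕ → Plane → ℝ, (∀ n, IsTestFunction (φ n)) ∧
    Tendsto (fun n => eLpNorm (fun x => w x - φ n x) 2 diskMeasure) atTop (𝓝 0) ∧
    ∀ j : Fin 2, Tendsto
      (fun n => eLpNorm (fun x => weakGradient w x j - partialDeriv j (φ n) x) 2 diskMeasure)
      atTop (𝓝 0)

/-- The weak gradient of a planar map, `(∇u)ᵢⱼ = ∂ⱼ uᵢ`. -/
def weakJacobian (u : Plane → Plane) (x : Plane) : Matrix (Fin 2) (Fin 2) ℝ :=
  Matrix.of fun i j => weakGradient (fun y => u y i) x j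

/-- The space `W^{1,2}(B, ℝ²)`. -/
def MemSobolevMap (u : Plane → Plane) : Prop := ∀ i : Fin 2, MemSobolev 2 (fun x => u x i)

/-- Maps in `W^{1,2}(B, ℝ²)` with `det ∇u = 1` almost everywhere. -/
def IsIncompressible (u : Plane → Plane) : Prop :=
  MemSobolevMap u ∧ ∀ᵐ x ∂diskMeasure, (weakJacobian u x).det = 1

/-- The admissible class `𝒜^g`, where `g` is the trace of `u₀` on `∂B`: the incompressible
`W^{1,2}` maps which agree with `u₀` on `∂B` in the sense of traces. -/
def admissible (u₀ : Plane → Plane) : Set (Plane → Plane) :=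
  {u | IsIncompressible u ∧ ∀ i : Fin 2, MemSobolevZero (fun x => u x i - u₀ x i)}

/-- Fourth order tensors `(Mᵢⱼₖₗ)`. -/
abbrev Tensor4 := Fin 2 → Fin 2 → Fin 2 → Fin 2 → ℝ

/-- The integrand `f(x, ξ) = M(x) ξ · ξ`. -/
def integrand (M : Plane → Tensor4) (x : Plane) (ξ : Matrix (Fin 2) (Fin 2) ℝ) : ℝ :=
  ∑ i, ∑ j, ∑ k, ∑ l, M x i j k l * ξ k l * ξ i j

/-- `M ∈ L^∞(B, ℝ¹⁶)`, `M` is symmetric, and `M(x) ξ · ξ ≥ ν |ξ|²`. -/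
structure IsEllipticTensor (M : Plane → Tensor4) (ν : ℝ) : Prop where
  bounded : ∀ i j k l : Fin 2, MemLp (fun x => M x i j k l) ∞ diskMeasure
  symmetric : ∀ᵐ x ∂diskMeasure, ∀ i j k l : Fin 2, M x i j k l = M x k l i j
  coercive : ∀ᵐ x ∂diskMeasure, ∀ ξ : Matrix (Fin 2) (Fin 2) ℝ,
    ν * ∑ i, ∑ j, ξ i j ^ 2 ≤ integrand M x ξ

/-- The energy `E(u) = ∫_B f(x, ∇u) dx`. -/
def energy (f : Plane → Matrix (Fin 2) (Fin 2) ℝ → ℝ) (u : Plane → Plane) : ℝ :=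
  ∫ x, f x (weakJacobian u x) ∂diskMeasure

/-- The gradient `∇_ξ f(x, ξ)` with respect to the matrix variable. -/
def gradXi (f : Plane → Matrix (Fin 2) (Fin 2) ℝ → ℝ) (x : Plane)
    (ξ : Matrix (Fin 2) (Fin 2) ℝ) : Matrix (Fin 2) (Fin 2) ℝ :=
  Matrix.of fun i j => deriv (fun t : ℝ => f x (ξ + t • Matrix.single i j 1)) 0

/-- The cofactor matrix. -/
def cof (A : Matrix (Fin 2) (Fin 2) ℝ) : Matrix (Fin 2) (Fin 2) ℝ :=
  !![A 1 1, -A 1 0; -A 0 1, A 0 0]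

/-- `div A = 0` in `𝒟'(B)`, the divergence being taken along rows, `(div A)ᵢ = ∑ⱼ ∂ⱼ Aᵢⱼ`. -/
def DivergenceFree (A : Plane → Matrix (Fin 2) (Fin 2) ℝ) : Prop :=
  ∀ i : Fin 2, ∀ φ : Plane → ℝ, IsTestFunction φ →
    ∫ x, ∑ j, A x i j * partialDeriv j φ x ∂diskMeasure = 0

/-- `lam ∈ W^{1,1}(B)` is a pressure for `u`:
`div (∇_ξ f(x, ∇u) + 2 lam cof ∇u) = 0` in `𝒟'(B)`. A map that has a pressure is a stationary
point of the energy. -/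
def IsPressure (f : Plane → Matrix (Fin 2) (Fin 2) ℝ → ℝ) (u : Plane → Plane)
    (lam : Plane → ℝ) : Prop :=
  MemSobolev 1 lam ∧ DivergenceFree fun x =>
    gradXi f x (weakJacobian u x) + (2 * lam x) • cof (weakJacobian u x)

/-- The polar angle `θ` of a point of the plane. -/
def polarAngle (x : Plane) : ℝ := Complex.arg ⟨x 0, x 1⟩

/-- The radial unit vector `e_R`. -/
def eR (x : Plane) : Plane := !₂[Real.cos (polarAngle x), Real.sin (polarAngle x)]

/-- The angular unit vector `e_θ`. -/
def eTheta (x : Plane) : Plane := !₂[-Real.sin (polarAngle x), Real.cos (polarAngle x)]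

/-- The norm `‖G‖_{L^∞(B, ℝ²)}`: the maximum of the `L^∞` norms of the two components of the
vector field `G` in the polar frame `(e_R, e_θ)`. -/
def polarSupNorm (G : Plane → Plane) : ℝ≥0∞ :=
  max (eLpNorm (fun x => inner ℝ (G x) (eR x)) ∞ diskMeasure)
    (eLpNorm (fun x => inner ℝ (G x) (eTheta x)) ∞ diskMeasure)

/-- `lam` depends on `R = |x|` alone. -/
def DependsOnRadius (lam : Plane → ℝ) : Prop :=
  ∃ l : ℝ → ℝ, ∀ᵐ x ∂diskMeasure, lam x = l ‖x‖

/-- `lam` depends on the polar angle alone. -/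
def DependsOnAngle (lam : Plane → ℝ) : Prop :=
  ∃ l : ℝ → ℝ, ∀ᵐ x ∂diskMeasure, lam x = l (polarAngle x)

/-- `u` is a global minimizer of the functional `E` in the class `A`. -/
def IsGlobalMinimizer (E : (Plane → Plane) → ℝ) (A : Set (Plane → Plane))
    (u : Plane → Plane) : Prop :=
  u ∈ A ∧ ∀ v ∈ A, E u ≤ E v

end Incompressible

end

/-! Put η = v − u. Expanding the quadratic energy gives E(v) ≥ E(u) + L + ν∫|∇η|², where L is the
first variation at u in the direction η. The pressure equation turns L into −2∫λ cof∇u·∇η, and det∇u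
= det∇v = 1 forces cof∇u·∇η = −det∇η; formally, then, L = 2∫λ det∇η. Minimality reduces to 2|∫λ
det∇η| ≤ ν∫|∇η|².

To prove this, write the Jacobian of a pair (w, φ) as a divergence and move one derivative onto λ.
Since λ depends on one polar variable, only one of x·∇λ and x^⊥·∇λ survives
(`HasGradOn.ae_inner_perp_eq_zero`, `HasGradOn.ae_inner_self_eq_zero`). What remains is an integral
of c w ∂φ with |c||x|² ≤ ν and ∂ an angular or a radial derivative. The functions w and φ can be
replaced by their deviations from circular means, which Wirtinger's inequality bounds by angular
derivatives. This gives `JacBound` (`jacBound_of_radial`, `jacBound_of_angular`). Its right-hand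
side contains only the circular mean of the radial derivative of φ, so it lies below ν times the
Dirichlet energy by the amount ν `nonradialEnergy`.

That surplus yields uniqueness. By a Poincaré inequality it controls the distance of φ to its
circular mean, hence the weak angular derivative. If E(v) ≤ E(u), both components of η have zero
angular derivative, their gradients are parallel to x, so det∇η = 0, and the expansion leaves
ν∫|∇η|² ≤ 0 (`ae_eq_of_energy_le`).

The analytic difficulty is that λ is only in W^{1,1} and det∇η only in L¹, so λ det∇η need not be
integrable a priori. The pressure is replaced by bounded truncations, for which `JacBound` holds
with the same ν, and η by test functions. For fixed test functions the truncation is removed using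
W^{1,1} ⊂ L²_loc. The error of replacing η by a test function is bounded uniformly in the truncation
level, by a Cauchy–Schwarz form of `JacBound` in which the first function has arbitrary boundary
values (`le_first_variation`). -/

noncomputable section

namespace Incompressible

/-! ### Rotations of the plane and averages over circles. -/

/-- Rotation by a right angle, `x ↦ x^⊥`. -/
def perp : Plane →L[ℝ] Plane :=
  LinearMap.toContinuousLinearMap
    { toFun := fun x => !₂[-x 1, x 0]
      map_add' := fun x y => by ext i; fin_cases i <;> simp; ring
      map_smul' := fun c x => by ext i; fin_cases i <;> simp }

@[simp] lemma perp_zero_apply (x : Plane) : perp x 0 = -x 1 := rfl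
@[simp] lemma perp_one_apply (x : Plane) : perp x 1 = x 0 := rfl

lemma perp_perp (x : Plane) : perp (perp x) = -x := by
  ext i; fin_cases i <;> simp

lemma norm_sq_eq (x : Plane) : ‖x‖ ^ 2 = x 0 ^ 2 + x 1 ^ 2 := by
  simp [EuclideanSpace.norm_sq_eq, Fin.sum_univ_two]

/-- Rotation of the plane by the angle `t`. -/
def rot (t : ℝ) : Plane ≃ₗᵢ[ℝ] Plane where
  toFun x := Real.cos t • x + Real.sin t • perp x
  map_add' x y := by simp only [map_add, smul_add]; abel
  map_smul' c x := by simp only [map_smul, RingHom.id_apply, smul_add, smul_comm c]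
  invFun x := Real.cos t • x - Real.sin t • perp x
  left_inv x := by
    ext i; fin_cases i <;> simp <;> linear_combination (x _) * Real.sin_sq_add_cos_sq t
  right_inv x := by
    ext i; fin_cases i <;> simp <;> linear_combination (x _) * Real.sin_sq_add_cos_sq t
  norm_map' x := by
    rw [← sq_eq_sq₀ (norm_nonneg _) (norm_nonneg _), norm_sq_eq, norm_sq_eq]
    simp
    linear_combination (x 0 ^ 2 + x 1 ^ 2) * Real.sin_sq_add_cos_sq t

lemma rot_apply (t : ℝ) (x : Plane) : rot t x = Real.cos t • x + Real.sin t • perp x := rfl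

lemma rot_rot (s t : ℝ) (x : Plane) : rot s (rot t x) = rot (s + t) x := by
  simp only [rot_apply, map_add, map_smul, perp_perp, Real.cos_add, Real.sin_add]
  module

lemma rot_zero (x : Plane) : rot 0 x = x := by simp [rot_apply]

lemma rot_two_pi (x : Plane) : rot (2 * Real.pi) x = x := by simp [rot_apply]

lemma rot_add_two_pi (t : ℝ) (x : Plane) : rot (t + 2 * Real.pi) x = rot t x := by
  simp [rot_apply]

lemma rot_perp (t : ℝ) (x : Plane) : rot t (perp x) = perp (rot t x) := by
  simp [rot_apply, perp_perp]

lemma hasDerivAt_rot (t : ℝ) (x : Plane) :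
    HasDerivAt (fun t => rot t x) (perp (rot t x)) t := by
  have h := ((Real.hasDerivAt_cos t).smul_const x).add ((Real.hasDerivAt_sin t).smul_const (perp x))
  have e : perp (rot t x) = -Real.sin t • x + Real.cos t • perp x := by
    simp only [rot_apply, map_add, map_smul, perp_perp]; module
  rw [e]; exact h

@[fun_prop]
lemma continuous_rot : Continuous fun p : Plane × ℝ => rot p.2 p.1 := by
  simp only [rot_apply]; fun_prop

lemma continuous_rot_left (x : Plane) : Continuous fun t => rot t x := by
  simp only [rot_apply]; fun_prop

/-- Lebesgue measure on the disk of radius `r`. -/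
def ballMeasure (r : ℝ) : Measure Plane := volume.restrict (Metric.ball 0 r)

lemma ballMeasure_one : ballMeasure 1 = diskMeasure := rfl

instance (r : ℝ) : IsFiniteMeasure (ballMeasure r) :=
  ⟨by rw [ballMeasure, Measure.restrict_apply_univ]; exact measure_ball_lt_top⟩

lemma measurePreserving_rot (r t : ℝ) :
    MeasurePreserving (rot t) (ballMeasure r) (ballMeasure r) := by
  have h := (rot t).measurePreserving.restrict_preimage
    (s := Metric.ball (0 : Plane) r) Metric.isOpen_ball.measurableSet
  rwa [(rot t).preimage_ball, map_zero] at h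

lemma integral_comp_rot (r t : ℝ) (f : Plane → ℝ) :
    ∫ x, f (rot t x) ∂ballMeasure r = ∫ x, f x ∂ballMeasure r :=
  (measurePreserving_rot r t).integral_comp (rot t).toHomeomorph.measurableEmbedding f

/-- The uniform probability measure on the angles. -/
def angleMeasure : Measure ℝ :=
  ENNReal.ofReal (2 * Real.pi)⁻¹ • volume.restrict (Set.Ioc 0 (2 * Real.pi))

instance : IsProbabilityMeasure angleMeasure := ⟨by
  have : (0:ℝ) < 2 * Real.pi := by positivity
  simp only [angleMeasure, Measure.smul_apply, Measure.restrict_apply_univ, Real.volume_Ioc,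
    sub_zero, smul_eq_mul]
  rw [← ENNReal.ofReal_mul (by positivity), inv_mul_cancel₀ this.ne', ENNReal.ofReal_one]⟩

lemma integral_angleMeasure (f : ℝ → ℝ) :
    ∫ t, f t ∂angleMeasure = (2 * Real.pi)⁻¹ * ∫ t in (0:ℝ)..(2 * Real.pi), f t := by
  rw [angleMeasure, integral_smul_measure, intervalIntegral.integral_of_le (by positivity),
    ENNReal.toReal_ofReal (by positivity), smul_eq_mul]

lemma integrable_angle {f : ℝ → ℝ} (hf : Continuous f) : Integrable f angleMeasure := by
  refine Integrable.smul_measure ?_ ENNReal.ofReal_ne_top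
  exact (hf.integrableOn_Icc (a := 0) (b := 2 * Real.pi)).mono_set Set.Ioc_subset_Icc_self

lemma integral_angle_add {f : ℝ → ℝ} (hf : ∀ t, f (t + 2 * Real.pi) = f t) (s : ℝ) :
    ∫ t, f (t + s) ∂angleMeasure = ∫ t, f t ∂angleMeasure := by
  rw [integral_angleMeasure, integral_angleMeasure, intervalIntegral.integral_comp_add_right]
  have := Function.Periodic.intervalIntegral_add_eq (f := f) (T := 2 * Real.pi) hf s 0
  rw [zero_add] at this
  rw [zero_add, add_comm (2 * Real.pi) s, this]

lemma integral_angle_deriv {f f' : ℝ → ℝ} (hf : ∀ t, HasDerivAt f (f' t) t)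
    (hc : Continuous f') (hp : f (2 * Real.pi) = f 0) : ∫ t, f' t ∂angleMeasure = 0 := by
  rw [integral_angleMeasure, intervalIntegral.integral_eq_sub_of_hasDerivAt (fun t _ => hf t)
    (hc.intervalIntegrable _ _), hp, sub_self, mul_zero]

/-- The average of `f` over the circle through `x` centred at the origin. -/
def circAvg (f : Plane → ℝ) (x : Plane) : ℝ := ∫ t, f (rot t x) ∂angleMeasure

lemma circAvg_rot (f : Plane → ℝ) (s : ℝ) (x : Plane) : circAvg f (rot s x) = circAvg f x := by
  simp only [circAvg, rot_rot]
  exact integral_angle_add (f := fun t => f (rot t x)) (fun t => by rw [rot_add_two_pi]) s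

lemma continuous_circAvg {f : Plane → ℝ} (hf : Continuous f) : Continuous (circAvg f) := by
  have : circAvg f = fun x => (2 * Real.pi)⁻¹ * ∫ t in (0:ℝ)..(2 * Real.pi), f (rot t x) := by
    ext x; rw [circAvg, integral_angleMeasure]
  rw [this]
  refine continuous_const.mul ?_
  apply intervalIntegral.continuous_parametric_intervalIntegral_of_continuous' 
  exact hf.comp continuous_rot

lemma sq_integral_angle_le {f : ℝ → ℝ} (hf : Continuous f) :
    (∫ t, f t ∂angleMeasure) ^ 2 ≤ ∫ t, f t ^ 2 ∂angleMeasure := by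
  set m := ∫ t, f t ∂angleMeasure with hm
  have h0 : 0 ≤ ∫ t, (f t - m) ^ 2 ∂angleMeasure := integral_nonneg fun t => sq_nonneg _
  have e : ∫ t, (f t - m) ^ 2 ∂angleMeasure = ∫ t, f t ^ 2 ∂angleMeasure - m ^ 2 := by
    have : ∀ t, (f t - m) ^ 2 = f t ^ 2 - (2 * m) * f t + m ^ 2 := fun t => by ring
    simp only [this]
    rw [integral_add, integral_sub, integral_const_mul, ← hm]
    · simp; ring
    all_goals apply integrable_angle; fun_prop
  linarith

/-! ### Parseval's identity and Wirtinger's inequality. -/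

lemma hasSum_sq_fourierCoeffOn_real {f : ℝ → ℝ} (hf : Continuous f) :
    HasSum (fun n => ‖fourierCoeffOn Real.two_pi_pos (fun t => (f t : ℂ)) n‖ ^ 2)
      (∫ t, f t ^ 2 ∂angleMeasure) := by
  have hc : Continuous fun t => (f t : ℂ) := by fun_prop
  have h2 : MemLp (fun t => (f t : ℂ)) 2 (volume.restrict (Set.Ioc 0 (2 * Real.pi))) := by
    refine (memLp_two_iff_integrable_sq_norm hc.aestronglyMeasurable).2 ?_
    have : Continuous fun t => ‖(f t : ℂ)‖ ^ 2 := by fun_prop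
    exact (this.integrableOn_Icc (a := 0) (b := 2 * Real.pi)).mono_set Set.Ioc_subset_Icc_self
  convert hasSum_sq_fourierCoeffOn Real.two_pi_pos h2 using 1
  rw [integral_angleMeasure]
  simp

/-- Wirtinger's inequality on the circle. -/
theorem wirtinger {f f' : ℝ → ℝ} (hf : ∀ t, HasDerivAt f (f' t) t) (hc : Continuous f')
    (hp : f (2 * Real.pi) = f 0) :
    ∫ t, (f t - ∫ s, f s ∂angleMeasure) ^ 2 ∂angleMeasure ≤ ∫ t, f' t ^ 2 ∂angleMeasure := by
  set m := ∫ s, f s ∂angleMeasure with hm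
  have hfc : Continuous f := continuous_iff_continuousAt.2 fun t => (hf t).continuousAt
  have h1 := hasSum_sq_fourierCoeffOn_real (f := fun t => f t - m) (by fun_prop)
  have h2 := hasSum_sq_fourierCoeffOn_real hc
  refine hasSum_le (fun n => ?_) h1 h2
  -- Comparison mode by mode: the zeroth coefficient vanishes because the mean was subtracted, and
  -- for n ≠ 0 integration by parts divides the coefficient of the derivative by a number of modulus
  -- |n| ≥ 1.
  by_cases hn : n = 0
  · subst hn
    have : fourierCoeffOn Real.two_pi_pos (fun t => ((f t - m : ℝ) : ℂ)) 0 = 0 := by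
      rw [fourierCoeffOn_eq_integral]
      simp only [neg_zero, fourier_zero, one_smul]
      rw [intervalIntegral.integral_ofReal]
      have e : ∫ t, (f t - m) ∂angleMeasure = 0 := by
        rw [integral_sub (integrable_angle hfc) (integrable_const _)]; simp [← hm]
      rw [integral_angleMeasure] at e
      have : (2 * Real.pi)⁻¹ ≠ 0 := by positivity
      simp [(mul_eq_zero.1 e).resolve_left this]
    rw [this]; simp
  · have hd : ∀ t, HasDerivAt (fun t => ((f t - m : ℝ) : ℂ)) (f' t : ℂ) t := fun t =>
      ((hf t).sub_const m).ofReal_comp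
    rw [fourierCoeffOn_of_hasDerivAt Real.two_pi_pos hn (fun t _ => hd t)
      ((by fun_prop : Continuous fun t => (f' t : ℂ)).intervalIntegrable _ _), hp]
    simp only [sub_self, mul_zero, zero_sub, norm_mul, norm_neg, norm_div, norm_one]
    have hn1 : (1:ℝ) ≤ ‖(n:ℂ)‖ := by
      rw [Complex.norm_intCast]; exact_mod_cast Int.one_le_abs hn
    gcongr
    have hpi := Real.pi_pos
    simp only [Complex.norm_ofNat, Complex.norm_real, Complex.norm_I, mul_one, Real.norm_eq_abs,
      abs_of_pos hpi, Complex.ofReal_zero, sub_zero, Complex.ofReal_mul, Complex.ofReal_ofNat,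
      norm_mul]
    rw [← mul_assoc]
    refine mul_le_of_le_one_left (norm_nonneg _) ?_
    rw [one_div, inv_mul_le_iff₀ (by positivity)]
    nlinarith

/-! ### Radial and angular derivatives and the Jacobian. -/

/-- The derivative `x · ∇f`. -/
def radDeriv (f : Plane → ℝ) (x : Plane) : ℝ := fderiv ℝ f x x

/-- The derivative `x^⊥ · ∇f`. -/
def angDeriv (f : Plane → ℝ) (x : Plane) : ℝ := fderiv ℝ f x (perp x)

/-- The Jacobian determinant of the pair `(w, φ)`. -/
def jac (w φ : Plane → ℝ) (x : Plane) : ℝ :=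
  partialDeriv 0 w x * partialDeriv 1 φ x - partialDeriv 1 w x * partialDeriv 0 φ x

lemma eq_sum_single (x : Plane) :
    x = x 0 • EuclideanSpace.single 0 (1:ℝ) + x 1 • EuclideanSpace.single 1 (1:ℝ) := by
  ext i; fin_cases i <;> simp

lemma fderiv_apply_eq (f : Plane → ℝ) (x v : Plane) :
    fderiv ℝ f x v = v 0 * partialDeriv 0 f x + v 1 * partialDeriv 1 f x := by
  conv_lhs => rw [eq_sum_single v]
  simp [partialDeriv]

lemma radDeriv_eq (f : Plane → ℝ) (x : Plane) :
    radDeriv f x = x 0 * partialDeriv 0 f x + x 1 * partialDeriv 1 f x := fderiv_apply_eq f x x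

lemma angDeriv_eq (f : Plane → ℝ) (x : Plane) :
    angDeriv f x = -x 1 * partialDeriv 0 f x + x 0 * partialDeriv 1 f x := by
  rw [angDeriv, fderiv_apply_eq]; simp

/-- The vectors x and x^⊥ span a parallelogram of area |x|², which is the factor picked up by the
Jacobian in this unnormalised frame. Keeping the factor on the left avoids dividing at the origin.
-/
lemma norm_sq_mul_jac (w φ : Plane → ℝ) (x : Plane) :
    ‖x‖ ^ 2 * jac w φ x = radDeriv w x * angDeriv φ x - angDeriv w x * radDeriv φ x := by
  rw [norm_sq_eq, radDeriv_eq, radDeriv_eq, angDeriv_eq, angDeriv_eq, jac]; ring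

lemma radDeriv_sq_add_angDeriv_sq (f : Plane → ℝ) (x : Plane) :
    radDeriv f x ^ 2 + angDeriv f x ^ 2 =
      ‖x‖ ^ 2 * (partialDeriv 0 f x ^ 2 + partialDeriv 1 f x ^ 2) := by
  rw [norm_sq_eq, radDeriv_eq, angDeriv_eq]; ring

lemma fderiv_comp_rot (f : Plane → ℝ) (t : ℝ) (x v : Plane) :
    fderiv ℝ (fun y => f (rot t y)) x v = fderiv ℝ f (rot t x) (rot t v) := by
  have := (rot t).toContinuousLinearEquiv.comp_right_fderiv (f := f) (x := x)
  exact congrArg (fun L => L v) this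

lemma radDeriv_comp_rot (f : Plane → ℝ) (t : ℝ) (x : Plane) :
    radDeriv (fun y => f (rot t y)) x = radDeriv f (rot t x) := fderiv_comp_rot f t x x

lemma angDeriv_comp_rot (f : Plane → ℝ) (t : ℝ) (x : Plane) :
    angDeriv (fun y => f (rot t y)) x = angDeriv f (rot t x) := by
  rw [angDeriv, fderiv_comp_rot, rot_perp]; rfl

lemma jac_comp_rot (w φ : Plane → ℝ) (t : ℝ) (x : Plane) :
    jac (fun y => w (rot t y)) (fun y => φ (rot t y)) x = jac w φ (rot t x) := by
  simp only [jac, partialDeriv, fderiv_comp_rot]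
  simp only [fderiv_apply_eq _ (rot t x), rot_apply t (EuclideanSpace.single _ _)]
  simp [partialDeriv]
  linear_combination (fderiv ℝ w (rot t x) (EuclideanSpace.single 0 1) *
    fderiv ℝ φ (rot t x) (EuclideanSpace.single 1 1) -
    fderiv ℝ w (rot t x) (EuclideanSpace.single 1 1) *
    fderiv ℝ φ (rot t x) (EuclideanSpace.single 0 1)) * Real.sin_sq_add_cos_sq t

lemma hasDerivAt_comp_rot {f : Plane → ℝ} (hf : ContDiff ℝ ∞ f) (x : Plane) (t : ℝ) :
    HasDerivAt (fun t => f (rot t x)) (angDeriv f (rot t x)) t :=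
  ((hf.differentiable (by simp)) (rot t x)).hasFDerivAt.comp_hasDerivAt t (hasDerivAt_rot t x)

lemma contDiff_partialDeriv {f : Plane → ℝ} (hf : ContDiff ℝ ∞ f) (j : Fin 2) :
    ContDiff ℝ ∞ (partialDeriv j f) :=
  (hf.fderiv_right (m := ∞) (by simp)).clm_apply contDiff_const

lemma contDiff_radDeriv {f : Plane → ℝ} (hf : ContDiff ℝ ∞ f) : ContDiff ℝ ∞ (radDeriv f) :=
  (hf.fderiv_right (m := ∞) (by simp)).clm_apply contDiff_id

lemma contDiff_angDeriv {f : Plane → ℝ} (hf : ContDiff ℝ ∞ f) : ContDiff ℝ ∞ (angDeriv f) :=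
  (hf.fderiv_right (m := ∞) (by simp)).clm_apply perp.contDiff

lemma contDiff_comp_rot {f : Plane → ℝ} (hf : ContDiff ℝ ∞ f) (t : ℝ) :
    ContDiff ℝ ∞ (fun y => f (rot t y)) := hf.comp (rot t).contDiff

lemma partialDeriv_mul {f g : Plane → ℝ} (hf : ContDiff ℝ ∞ f) (hg : ContDiff ℝ ∞ g) (j : Fin 2)
    (x : Plane) : partialDeriv j (fun y => f y * g y) x =
      f x * partialDeriv j g x + partialDeriv j f x * g x := by
  rw [partialDeriv, fderiv_fun_mul (hf.differentiable (by simp) x) (hg.differentiable (by simp) x)]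
  simp [partialDeriv]; ring

lemma partialDeriv_sub {f g : Plane → ℝ} (hf : ContDiff ℝ ∞ f) (hg : ContDiff ℝ ∞ g) (j : Fin 2)
    (x : Plane) : partialDeriv j (fun y => f y - g y) x =
      partialDeriv j f x - partialDeriv j g x := by
  rw [partialDeriv, fderiv_fun_sub (hf.differentiable (by simp) x) (hg.differentiable (by simp) x)]
  simp [partialDeriv]

lemma partialDeriv_comm {f : Plane → ℝ} (hf : ContDiff ℝ ∞ f) (x : Plane) :
    partialDeriv 0 (partialDeriv 1 f) x = partialDeriv 1 (partialDeriv 0 f) x := by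
  have hs : IsSymmSndFDerivAt ℝ f x := hf.contDiffAt.isSymmSndFDerivAt
    (by simpa using (by exact_mod_cast le_top : ((2 : ℕ∞) : WithTop ℕ∞) ≤ ((⊤ : ℕ∞) : WithTop ℕ∞)))
  have hd : DifferentiableAt ℝ (fderiv ℝ f) x :=
    (hf.fderiv_right (m := ∞) (by simp)).differentiable (by simp) x
  have key : ∀ v w : Plane, fderiv ℝ (fun y => fderiv ℝ f y v) x w = fderiv ℝ (fderiv ℝ f) x w v := by
    intro v w
    rw [fderiv_clm_apply hd (differentiableAt_const v)]
    simp
  show fderiv ℝ (fun y => fderiv ℝ f y _) x _ = fderiv ℝ (fun y => fderiv ℝ f y _) x _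
  rw [key, key]
  exact hs _ _

/-! ### Test functions and integrability on disks. -/

/-- Smooth functions with compact support in the open disk of radius `r`. -/
structure IsTest (r : ℝ) (φ : Plane → ℝ) : Prop where
  smooth : ContDiff ℝ ∞ φ
  compact : HasCompactSupport φ
  support : tsupport φ ⊆ Metric.ball 0 r

lemma isTest_one {φ : Plane → ℝ} : IsTest 1 φ ↔ IsTestFunction φ :=
  ⟨fun h => ⟨h.1, h.2, h.3⟩, fun h => ⟨h.1, h.2, h.3⟩⟩

lemma IsTest.of_support {r : ℝ} {φ ψ : Plane → ℝ} (h : IsTest r φ) (hs : ContDiff ℝ ∞ ψ)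
    (hψ : tsupport ψ ⊆ tsupport φ) : IsTest r ψ :=
  ⟨hs, h.compact.of_isClosed_subset (isClosed_tsupport _) hψ, hψ.trans h.support⟩

lemma IsTest.mul_left {r : ℝ} {φ w : Plane → ℝ} (h : IsTest r φ) (hw : ContDiff ℝ ∞ w) :
    IsTest r (fun x => w x * φ x) :=
  h.of_support (hw.mul h.smooth) (tsupport_mul_subset_right (f := w) (g := φ))

lemma IsTest.mul_right {r : ℝ} {φ w : Plane → ℝ} (h : IsTest r φ) (hw : ContDiff ℝ ∞ w) :
    IsTest r (fun x => φ x * w x) :=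
  h.of_support (h.smooth.mul hw) (tsupport_mul_subset_left (f := φ) (g := w))

lemma tsupport_fderiv_apply_subset (φ : Plane → ℝ) (v : Plane → Plane) :
    tsupport (fun x => fderiv ℝ φ x (v x)) ⊆ tsupport φ := by
  refine (closure_mono fun x hx => ?_).trans (tsupport_fderiv_subset ℝ (f := φ))
  intro h0; apply hx; simp [h0]

lemma IsTest.isTest_partialDeriv {r : ℝ} {φ : Plane → ℝ} (h : IsTest r φ) (j : Fin 2) :
    IsTest r (partialDeriv j φ) :=
  h.of_support (contDiff_partialDeriv h.smooth j) (tsupport_fderiv_apply_subset φ _)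

lemma IsTest.isTest_radDeriv {r : ℝ} {φ : Plane → ℝ} (h : IsTest r φ) : IsTest r (radDeriv φ) :=
  h.of_support (contDiff_radDeriv h.smooth) (tsupport_fderiv_apply_subset φ _)

lemma IsTest.sub {r : ℝ} {φ ψ : Plane → ℝ} (h : IsTest r φ) (h' : IsTest r ψ) :
    IsTest r (fun x => φ x - ψ x) := by
  have hs : tsupport (fun x => φ x - ψ x) ⊆ tsupport φ ∪ tsupport ψ := by
    rw [tsupport, tsupport, tsupport, ← closure_union]
    exact closure_mono (Function.support_sub φ ψ)
  exact ⟨h.smooth.sub h'.smooth, (h.compact.union h'.compact).of_isClosed_subset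
    (isClosed_tsupport _) hs, hs.trans (Set.union_subset h.support h'.support)⟩

lemma IsTest.const_mul {r : ℝ} {φ : Plane → ℝ} (h : IsTest r φ) (s : ℝ) :
    IsTest r (fun x => s * φ x) := h.mul_left contDiff_const

lemma IsTest.comp_rot {r : ℝ} {φ : Plane → ℝ} (h : IsTest r φ) (t : ℝ) :
    IsTest r (fun x => φ (rot t x)) := by
  refine ⟨contDiff_comp_rot h.smooth t, h.compact.comp_homeomorph (rot t).toHomeomorph, ?_⟩
  have e : tsupport (fun x => φ (rot t x)) = (rot t) ⁻¹' tsupport φ :=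
    tsupport_comp_eq_preimage φ (rot t).toHomeomorph
  rw [e]
  intro x hx
  have := h.support hx
  simpa using this

lemma IsTest.mono {r s : ℝ} {φ : Plane → ℝ} (h : IsTest r φ) (hrs : r ≤ s) : IsTest s φ :=
  ⟨h.1, h.2, h.3.trans (Metric.ball_subset_ball hrs)⟩

lemma ae_norm_lt (r : ℝ) : ∀ᵐ x ∂ballMeasure r, ‖x‖ < r := by
  filter_upwards [ae_restrict_mem (μ := volume) (Metric.isOpen_ball (x := (0:Plane)) (ε := r)).measurableSet]
    with x hx
  simpa using hx

lemma ae_ne_zero (r : ℝ) : ∀ᵐ x ∂ballMeasure r, x ≠ 0 :=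
  ae_restrict_of_ae (Measure.ae_ne volume 0)

lemma exists_bound_on_ball {f : Plane → ℝ} (hf : Continuous f) (r : ℝ) :
    ∃ C, 0 ≤ C ∧ ∀ x, ‖x‖ ≤ r → |f x| ≤ C := by
  obtain ⟨C, hC⟩ := (isCompact_closedBall (0 : Plane) r).exists_bound_of_continuousOn hf.continuousOn
  exact ⟨max C 0, le_max_right _ _, fun x hx => (hC x (by simpa using hx)).trans (le_max_left _ _)⟩

lemma integrable_mul_continuous {g f : Plane → ℝ} {r : ℝ} (hg : Integrable g (ballMeasure r))
    (hf : Continuous f) : Integrable (fun x => g x * f x) (ballMeasure r) := by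
  obtain ⟨C, -, hC⟩ := exists_bound_on_ball hf r
  refine hg.mul_bdd (c := C) hf.aestronglyMeasurable ?_
  filter_upwards [ae_norm_lt r] with x hx using hC x hx.le

lemma integrable_ball {f : Plane → ℝ} (hf : Continuous f) (r : ℝ) :
    Integrable f (ballMeasure r) := by
  simpa using integrable_mul_continuous (integrable_const (1:ℝ)) hf

/-! ### Weighted square norms and their behaviour under circular averaging. -/

/-- Continuous functions which vanish at the origin at least linearly. -/
structure VanishLin (r : ℝ) (k : Plane → ℝ) : Prop where
  continuous : Continuous k
  bound : ∃ C, 0 ≤ C ∧ ∀ x, ‖x‖ ≤ r → |k x| ≤ C * ‖x‖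

lemma vanishLin_radDeriv {w : Plane → ℝ} (hw : ContDiff ℝ ∞ w) (r : ℝ) :
    VanishLin r (radDeriv w) := by
  refine ⟨(contDiff_radDeriv hw).continuous, ?_⟩
  obtain ⟨C, h0, hC⟩ := exists_bound_on_ball
    ((hw.fderiv_right (m := ∞) (by simp)).continuous.norm) r
  refine ⟨C, h0, fun x hx => ((fderiv ℝ w x).le_opNorm x).trans ?_⟩
  gcongr
  simpa using hC x hx

lemma norm_perp (x : Plane) : ‖perp x‖ = ‖x‖ := by
  rw [← sq_eq_sq₀ (norm_nonneg _) (norm_nonneg _), norm_sq_eq, norm_sq_eq]; simp; ring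

lemma vanishLin_angDeriv {w : Plane → ℝ} (hw : ContDiff ℝ ∞ w) (r : ℝ) :
    VanishLin r (angDeriv w) := by
  refine ⟨(contDiff_angDeriv hw).continuous, ?_⟩
  obtain ⟨C, h0, hC⟩ := exists_bound_on_ball
    ((hw.fderiv_right (m := ∞) (by simp)).continuous.norm) r
  refine ⟨C, h0, fun x hx => ((fderiv ℝ w x).le_opNorm (perp x)).trans ?_⟩
  rw [norm_perp]
  gcongr
  simpa using hC x hx

lemma VanishLin.mul {r : ℝ} {k f : Plane → ℝ} (hk : VanishLin r k) (hf : Continuous f) :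
    VanishLin r (fun x => f x * k x) := by
  obtain ⟨C, h0, hC⟩ := hk.bound
  obtain ⟨D, h1, hD⟩ := exists_bound_on_ball hf r
  refine ⟨hf.mul hk.continuous, D * C, by positivity, fun x hx => ?_⟩
  rw [abs_mul, mul_assoc]
  exact mul_le_mul (hD x hx) (hC x hx) (abs_nonneg _) h1

lemma VanishLin.sub {r : ℝ} {k l : Plane → ℝ} (hk : VanishLin r k) (hl : VanishLin r l) :
    VanishLin r (fun x => k x - l x) := by
  obtain ⟨C, h0, hC⟩ := hk.bound
  obtain ⟨D, h1, hD⟩ := hl.bound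
  refine ⟨hk.continuous.sub hl.continuous, C + D, by positivity, fun x hx => ?_⟩
  rw [add_mul]
  exact (abs_sub _ _).trans (add_le_add (hC x hx) (hD x hx))

lemma VanishLin.comp_rot {r : ℝ} {k : Plane → ℝ} (hk : VanishLin r k) (t : ℝ) :
    VanishLin r (fun x => k (rot t x)) := by
  obtain ⟨C, h0, hC⟩ := hk.bound
  refine ⟨hk.continuous.comp (rot t).continuous, C, h0, fun x hx => ?_⟩
  simpa using hC (rot t x) (by simpa using hx)

lemma abs_integral_angle_le {f : ℝ → ℝ} {C : ℝ} (h : ∀ t, |f t| ≤ C) :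
    |∫ t, f t ∂angleMeasure| ≤ C := by
  simpa using norm_integral_le_of_norm_le_const (μ := angleMeasure) (f := f) (C := C)
    (Eventually.of_forall h)

lemma VanishLin.vanishLin_circAvg {r : ℝ} {k : Plane → ℝ} (hk : VanishLin r k) :
    VanishLin r (circAvg k) := by
  obtain ⟨C, h0, hC⟩ := hk.bound
  refine ⟨continuous_circAvg hk.continuous, C, h0, fun x hx => abs_integral_angle_le fun t => ?_⟩
  simpa using hC (rot t x) (by simpa using hx)

lemma continuous_comp_rot_left {f : Plane → ℝ} (hf : Continuous f) (x : Plane) :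
    Continuous fun t => f (rot t x) := hf.comp (continuous_rot_left x)

/-- By the mean value inequality f − f(0) is of order |x|, and so is its circular average; the
constant f(0) cancels in the difference. This makes the deviation from the mean admissible in
`hardyNorm`. -/
lemma VanishLin.sub_circAvg {r : ℝ} {f : Plane → ℝ} (hf : ContDiff ℝ ∞ f) :
    VanishLin r (fun x => f x - circAvg f x) := by
  have h : VanishLin r (fun x => f x - f 0) := by
    refine ⟨hf.continuous.sub continuous_const, ?_⟩
    obtain ⟨C, h0, hC⟩ := exists_bound_on_ball
      ((hf.fderiv_right (m := ∞) (by simp)).continuous.norm) r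
    refine ⟨C, h0, fun x hx => ?_⟩
    have := (convex_closedBall (0:Plane) r).norm_image_sub_le_of_norm_fderiv_le (f := f) (𝕜 := ℝ)
      (C := C) (x := 0) (y := x) (fun y _ => hf.differentiable (by simp) y)
      (fun y hy => by simpa using hC y (by simpa using hy))
      (by simpa using (norm_nonneg x).trans hx) (by simpa using hx)
    simpa using this
  convert h.sub h.vanishLin_circAvg using 2 with x
  have : circAvg (fun x => f x - f 0) x = circAvg f x - f 0 := by
    rw [circAvg, integral_sub (integrable_angle
      (continuous_comp_rot_left hf.continuous x)) (integrable_const _)]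
    simp [circAvg]
  rw [this]; ring

/-- The weighted square norm `∫ k² / |x|²` over the disk of radius `r`. -/
def hardyNorm (r : ℝ) (k : Plane → ℝ) : ℝ := ∫ x, k x ^ 2 / ‖x‖ ^ 2 ∂ballMeasure r

lemma VanishLin.exists_bound_sq {r : ℝ} {k : Plane → ℝ} (hk : VanishLin r k) :
    ∃ C, ∀ x, ‖x‖ ≤ r → |k x ^ 2 / ‖x‖ ^ 2| ≤ C := by
  obtain ⟨C, h0, hC⟩ := hk.bound
  refine ⟨C ^ 2, fun x hx => ?_⟩
  rw [abs_of_nonneg (by positivity)]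
  refine div_le_of_le_mul₀ (by positivity) (by positivity) ?_
  rw [← mul_pow, ← sq_abs]
  exact pow_le_pow_left₀ (abs_nonneg _) (hC x hx) 2

lemma integrable_of_bound {H : Plane → ℝ} {r C : ℝ} (hm : Measurable H)
    (hC : ∀ x, ‖x‖ ≤ r → |H x| ≤ C) : Integrable H (ballMeasure r) := by
  refine (integrable_const C).mono' hm.aestronglyMeasurable ?_
  filter_upwards [ae_norm_lt r] with x hx using hC x hx.le

lemma VanishLin.measurable_sq {r : ℝ} {k : Plane → ℝ} (hk : VanishLin r k) :
    Measurable fun x => k x ^ 2 / ‖x‖ ^ 2 := by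
  have := hk.continuous.measurable
  fun_prop

lemma VanishLin.integrable_sq {r : ℝ} {k : Plane → ℝ} (hk : VanishLin r k) :
    Integrable (fun x => k x ^ 2 / ‖x‖ ^ 2) (ballMeasure r) := by
  obtain ⟨C, hC⟩ := hk.exists_bound_sq
  exact integrable_of_bound hk.measurable_sq hC

lemma integral_circAvg {H : Plane → ℝ} {r C : ℝ} (hm : Measurable H)
    (hC : ∀ x, ‖x‖ ≤ r → |H x| ≤ C) :
    Integrable (circAvg H) (ballMeasure r) ∧
      ∫ x, circAvg H x ∂ballMeasure r = ∫ x, H x ∂ballMeasure r := by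
  have hi : Integrable (Function.uncurry fun x t => H (rot t x))
      ((ballMeasure r).prod angleMeasure) := by
    refine (integrable_const C).mono' (hm.comp continuous_rot.measurable).aestronglyMeasurable ?_
    have := (Measure.quasiMeasurePreserving_fst (μ := ballMeasure r) (ν := angleMeasure)).ae
      (ae_norm_lt r)
    filter_upwards [this] with p hp
    exact hC _ (by simpa using hp.le)
  refine ⟨hi.integral_prod_left, ?_⟩
  simp only [circAvg]
  rw [integral_integral_swap hi]
  simp [integral_comp_rot]

lemma circAvg_sq_div (k : Plane → ℝ) (x : Plane) :
    circAvg (fun x => k x ^ 2 / ‖x‖ ^ 2) x = circAvg (fun x => k x ^ 2) x / ‖x‖ ^ 2 := by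
  simp [circAvg, integral_div]

/-- Fubini and rotation invariance, the weight being constant on circles. Inequalities between
weighted norms thereby reduce to inequalities on each single circle. -/
lemma VanishLin.hardyNorm_eq {r : ℝ} {k : Plane → ℝ} (hk : VanishLin r k) :
    Integrable (fun x => circAvg (fun x => k x ^ 2) x / ‖x‖ ^ 2) (ballMeasure r) ∧
    hardyNorm r k = ∫ x, circAvg (fun x => k x ^ 2) x / ‖x‖ ^ 2 ∂ballMeasure r := by
  obtain ⟨C, hC⟩ := hk.exists_bound_sq
  have := integral_circAvg hk.measurable_sq hC
  rw [funext (circAvg_sq_div k)] at this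
  exact ⟨this.1, this.2.symm⟩

lemma hardyNorm_circAvg_le {r : ℝ} {k : Plane → ℝ} (hk : VanishLin r k) :
    hardyNorm r (circAvg k) ≤ hardyNorm r k := by
  rw [hk.hardyNorm_eq.2]
  refine integral_mono hk.vanishLin_circAvg.integrable_sq hk.hardyNorm_eq.1 fun x => ?_
  dsimp only
  gcongr
  exact sq_integral_angle_le (continuous_comp_rot_left hk.continuous x)

/-- Along t ↦ `rot t x` the derivative of f is exactly `angDeriv f`, so Wirtinger's inequality on
the unit circle applies to every radius with constant one. -/
lemma wirtinger_rot {f : Plane → ℝ} (hf : ContDiff ℝ ∞ f) (x : Plane) :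
    circAvg (fun y => (f y - circAvg f y) ^ 2) x ≤ circAvg (fun y => angDeriv f y ^ 2) x := by
  have := wirtinger (fun t => hasDerivAt_comp_rot hf x t)
    (continuous_comp_rot_left (contDiff_angDeriv hf).continuous x)
    (by rw [rot_two_pi, rot_zero])
  calc _ = ∫ t, (f (rot t x) - circAvg f x) ^ 2 ∂angleMeasure := by
        simp only [circAvg, rot_rot]
        congr 1; ext t
        rw [integral_angle_add (f := fun t => f (rot t x)) (fun t => by rw [rot_add_two_pi])]
    _ ≤ _ := this

lemma hardyNorm_sub_circAvg_le {r : ℝ} {f : Plane → ℝ} (hf : ContDiff ℝ ∞ f) :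
    hardyNorm r (fun x => f x - circAvg f x) ≤ hardyNorm r (angDeriv f) := by
  have h1 := (VanishLin.sub_circAvg (r := r) hf).hardyNorm_eq
  have h2 := (vanishLin_angDeriv hf r).hardyNorm_eq
  rw [h1.2, h2.2]
  refine integral_mono h1.1 h2.1 fun x => ?_
  dsimp only
  gcongr
  exact wirtinger_rot hf x

lemma circAvg_angDeriv {f : Plane → ℝ} (hf : ContDiff ℝ ∞ f) (x : Plane) :
    circAvg (angDeriv f) x = 0 :=
  integral_angle_deriv (fun t => hasDerivAt_comp_rot hf x t)
    (continuous_comp_rot_left (contDiff_angDeriv hf).continuous x)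
    (by rw [rot_two_pi, rot_zero])

/-! ### Fubini's theorem and integration by parts against the Jacobian. -/

/-- Fubini's theorem for an integrable density and a bounded kernel. -/
lemma integral_swap_bdd {T : Type*} [MeasurableSpace T] (θ : Measure T) [IsFiniteMeasure θ]
    {r C : ℝ} {g : Plane → ℝ} (hg : Integrable g (ballMeasure r)) {K : Plane → T → ℝ}
    (hm : Measurable (Function.uncurry K)) (hC : ∀ x, ‖x‖ ≤ r → ∀ t, |K x t| ≤ C) :
    ∫ t, ∫ x, g x * K x t ∂ballMeasure r ∂θ = ∫ x, g x * ∫ t, K x t ∂θ ∂ballMeasure r := by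
  have hi : Integrable (Function.uncurry fun x t => g x * K x t) ((ballMeasure r).prod θ) := by
    refine (hg.comp_fst θ).mul_bdd (c := C) hm.aestronglyMeasurable ?_
    have := (Measure.quasiMeasurePreserving_fst (μ := ballMeasure r) (ν := θ)).ae
      (ae_norm_lt r)
    filter_upwards [this] with p hp
    exact hC _ hp.le _
  rw [← integral_integral_swap hi]
  simp only [integral_const_mul]

/-- The density c will be of size |∇λ|/|x|, so only c|x| is known to be integrable. A kernel
vanishing linearly at the origin supplies the missing factor |x|. -/
lemma integral_swap_lin {T : Type*} [MeasurableSpace T] (θ : Measure T) [IsFiniteMeasure θ]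
    {r C : ℝ} {c : Plane → ℝ} (hc : Integrable (fun x => c x * ‖x‖) (ballMeasure r))
    {K : Plane → T → ℝ} (hC0 : 0 ≤ C)
    (hm : Measurable (Function.uncurry K)) (hC : ∀ x, ‖x‖ ≤ r → ∀ t, |K x t| ≤ C * ‖x‖) :
    ∫ t, ∫ x, c x * K x t ∂ballMeasure r ∂θ = ∫ x, c x * ∫ t, K x t ∂θ ∂ballMeasure r := by
  have hm' : Measurable (Function.uncurry fun x t => K x t / ‖x‖) := by
    exact hm.div (measurable_norm.comp measurable_fst)
  have h := integral_swap_bdd θ hc hm' (C := C) fun x hx t => by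
    rw [abs_div, abs_norm]
    exact div_le_of_le_mul₀ (norm_nonneg _) hC0 (hC x hx t)
  have e : ∀ᵐ x ∂ballMeasure r, ‖x‖ ≠ 0 := by
    filter_upwards [ae_ne_zero r] with x hx using norm_ne_zero_iff.2 hx
  calc _ = ∫ t, ∫ x, c x * ‖x‖ * (K x t / ‖x‖) ∂ballMeasure r ∂θ := by
        congr 1; ext t
        refine integral_congr_ae ?_
        filter_upwards [e] with x hx
        field_simp
    _ = _ := h
    _ = _ := by
        refine integral_congr_ae ?_
        filter_upwards [e] with x hx
        rw [integral_div]; field_simp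

lemma VanishLin.integrable_mul {r : ℝ} {c k : Plane → ℝ}
    (hc : Integrable (fun x => c x * ‖x‖) (ballMeasure r)) (hk : VanishLin r k) :
    Integrable (fun x => c x * k x) (ballMeasure r) := by
  obtain ⟨C, h0, hC⟩ := hk.bound
  have : Integrable (fun x => c x * ‖x‖ * (k x / ‖x‖)) (ballMeasure r) := by
    refine hc.mul_bdd (c := C) ?_ ?_
    · exact (hk.continuous.measurable.div measurable_norm).aestronglyMeasurable
    · filter_upwards [ae_norm_lt r] with x hx
      rw [Real.norm_eq_abs, abs_div, abs_norm]
      exact div_le_of_le_mul₀ (norm_nonneg _) h0 (hC x hx.le)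
  refine this.congr ?_
  filter_upwards [ae_ne_zero r] with x hx
  have := norm_ne_zero_iff.2 hx
  field_simp

/-- `G` is the weak gradient of the `W^{1,1}` function `w` in the disk of radius `r`. -/
structure HasGradOn (r : ℝ) (w : Plane → ℝ) (G : Plane → Plane) : Prop where
  integrable : Integrable w (ballMeasure r)
  integrable_grad : Integrable G (ballMeasure r)
  integral_eq : ∀ φ : Plane → ℝ, IsTest r φ → ∀ j : Fin 2,
    ∫ x, w x * partialDeriv j φ x ∂ballMeasure r = - ∫ x, G x j * φ x ∂ballMeasure r

lemma integrable_coord {r : ℝ} {G : Plane → Plane} (hG : Integrable G (ballMeasure r)) (j : Fin 2) :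
    Integrable (fun x => G x j) (ballMeasure r) :=
  (EuclideanSpace.proj j : Plane →L[ℝ] ℝ).integrable_comp hG

/-- The Jacobian is ∂₀(w ∂₁φ) − ∂₁(w ∂₀φ), the second derivatives of φ cancelling by symmetry; the
outer derivative is moved onto λ. -/
lemma HasGradOn.integral_jac {r : ℝ} {lam : Plane → ℝ} {G : Plane → Plane}
    (h : HasGradOn r lam G) {w φ : Plane → ℝ} (hw : ContDiff ℝ ∞ w) (hφ : IsTest r φ) :
    ∫ x, lam x * jac w φ x ∂ballMeasure r =
      ∫ x, w x * (G x 1 * partialDeriv 0 φ x - G x 0 * partialDeriv 1 φ x) ∂ballMeasure r := by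
  have t0 := (hφ.isTest_partialDeriv 0).mul_left hw
  have t1 := (hφ.isTest_partialDeriv 1).mul_left hw
  have e0 := h.integral_eq _ t0 1
  have e1 := h.integral_eq _ t1 0
  have i : ∀ {f g : Plane → ℝ} (_ : Integrable g (ballMeasure r)) (_ : Continuous f),
    Integrable (fun x => g x * f x) (ballMeasure r) := fun hg hf => integrable_mul_continuous hg hf
  have i0 := i h.integrable (contDiff_partialDeriv t0.smooth 1).continuous
  have i1 := i h.integrable (contDiff_partialDeriv t1.smooth 0).continuous
  have j0 := i (integrable_coord h.integrable_grad 1) t0.smooth.continuous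
  have j1 := i (integrable_coord h.integrable_grad 0) t1.smooth.continuous
  calc _ = ∫ x, (lam x * partialDeriv 0 (fun x => w x * partialDeriv 1 φ x) x -
        lam x * partialDeriv 1 (fun x => w x * partialDeriv 0 φ x) x) ∂ballMeasure r := by
        congr 1; ext x
        rw [partialDeriv_mul hw (contDiff_partialDeriv hφ.smooth 1),
          partialDeriv_mul hw (contDiff_partialDeriv hφ.smooth 0), partialDeriv_comm hφ.smooth, jac]
        ring
    _ = _ := by
        rw [integral_sub i1 i0, e0, e1, neg_sub_neg, ← integral_sub j0 j1]
        congr 1; ext x; ring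

/-- The other divergence form of the Jacobian, which leaves φ undifferentiated. No boundary
condition on w is needed in either form, because φ has compact support. Angular multipliers need
both. -/
lemma HasGradOn.integral_jac' {r : ℝ} {lam : Plane → ℝ} {G : Plane → Plane}
    (h : HasGradOn r lam G) {w φ : Plane → ℝ} (hw : ContDiff ℝ ∞ w) (hφ : IsTest r φ) :
    ∫ x, lam x * jac w φ x ∂ballMeasure r =
      ∫ x, φ x * (G x 0 * partialDeriv 1 w x - G x 1 * partialDeriv 0 w x) ∂ballMeasure r := by
  have t0 := hφ.mul_right (contDiff_partialDeriv hw 0)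
  have t1 := hφ.mul_right (contDiff_partialDeriv hw 1)
  have e0 := h.integral_eq _ t0 1
  have e1 := h.integral_eq _ t1 0
  have i : ∀ {f g : Plane → ℝ} (_ : Integrable g (ballMeasure r)) (_ : Continuous f),
    Integrable (fun x => g x * f x) (ballMeasure r) := fun hg hf => integrable_mul_continuous hg hf
  have i0 := i h.integrable (contDiff_partialDeriv t0.smooth 1).continuous
  have i1 := i h.integrable (contDiff_partialDeriv t1.smooth 0).continuous
  have j0 := i (integrable_coord h.integrable_grad 1) t0.smooth.continuous
  have j1 := i (integrable_coord h.integrable_grad 0) t1.smooth.continuous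
  calc _ = ∫ x, (lam x * partialDeriv 1 (fun x => φ x * partialDeriv 0 w x) x -
        lam x * partialDeriv 0 (fun x => φ x * partialDeriv 1 w x) x) ∂ballMeasure r := by
        congr 1; ext x
        rw [partialDeriv_mul hφ.smooth (contDiff_partialDeriv hw 1),
          partialDeriv_mul hφ.smooth (contDiff_partialDeriv hw 0), partialDeriv_comm hw, jac]
        ring
    _ = _ := by
        rw [integral_sub i0 i1, e0, e1, neg_sub_neg, ← integral_sub j1 j0]
        congr 1; ext x; ring

/-! ### The Jacobian bound for radial and for angular multipliers. -/

/-- The energy bound shared by radial and angular multipliers. -/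
def JacBound (ν r : ℝ) (lam : Plane → ℝ) : Prop :=
  ∀ w φ : Plane → ℝ, ContDiff ℝ ∞ w → IsTest r φ →
    2 * |∫ x, lam x * jac w φ x ∂ballMeasure r| ≤ ν * (hardyNorm r (angDeriv φ) +
      hardyNorm r (angDeriv w) + hardyNorm r (radDeriv w) + hardyNorm r (circAvg (radDeriv φ)))

lemma hardyNorm_nonneg (r : ℝ) (k : Plane → ℝ) : 0 ≤ hardyNorm r k :=
  integral_nonneg fun x => by positivity

/-- Pointwise, |c| ≤ ν/|x|² and 2|kl| ≤ k² + l². -/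
lemma abs_integral_mul_mul_le {ν r : ℝ} {c k l : Plane → ℝ} (hν : 0 ≤ ν)
    (hb : ∀ᵐ x ∂ballMeasure r, |c x| * ‖x‖ ^ 2 ≤ ν) (hk : VanishLin r k) (hl : VanishLin r l) :
    2 * |∫ x, c x * (k x * l x) ∂ballMeasure r| ≤ ν * (hardyNorm r k + hardyNorm r l) := by
  have h1 : |∫ x, c x * (k x * l x) ∂ballMeasure r| ≤
      ∫ x, (ν / 2) * (k x ^ 2 / ‖x‖ ^ 2 + l x ^ 2 / ‖x‖ ^ 2) ∂ballMeasure r := by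
    rw [← Real.norm_eq_abs]
    refine norm_integral_le_of_norm_le ((hk.integrable_sq.add hl.integrable_sq).const_mul _) ?_
    filter_upwards [hb, ae_ne_zero r] with x hx hx0
    have hn : 0 < ‖x‖ ^ 2 := by positivity
    have hc : |c x| ≤ ν / ‖x‖ ^ 2 := (le_div_iff₀ hn).2 hx
    rw [Real.norm_eq_abs, abs_mul]
    calc |c x| * |k x * l x| ≤ ν / ‖x‖ ^ 2 * ((k x ^ 2 + l x ^ 2) / 2) := by
          gcongr
          rw [abs_le]; constructor <;> nlinarith [sq_nonneg (k x + l x), sq_nonneg (k x - l x)]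
      _ = _ := by ring
  rw [integral_const_mul, integral_add hk.integrable_sq hl.integrable_sq] at h1
  rw [hardyNorm, hardyNorm]; linarith

lemma integral_jac_comp_rot {r : ℝ} {lam : Plane → ℝ}
    (hrot : ∀ t, ∀ᵐ x ∂ballMeasure r, lam (rot t x) = lam x) (w φ : Plane → ℝ) (t : ℝ) :
    ∫ x, lam x * jac (fun y => w (rot t y)) (fun y => φ (rot t y)) x ∂ballMeasure r =
      ∫ x, lam x * jac w φ x ∂ballMeasure r := by
  rw [← integral_comp_rot r t fun x => lam x * jac w φ x]
  refine integral_congr_ae ?_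
  filter_upwards [hrot t] with x hx
  rw [hx, jac_comp_rot]

lemma measurable_comp_rot {f : Plane → ℝ} (hf : Continuous f) :
    Measurable (Function.uncurry fun x t => f (rot t x)) :=
  hf.measurable.comp continuous_rot.measurable

/-- The bound for a radial multiplier. -/
lemma jacBound_of_radial {ν r : ℝ} {lam c : Plane → ℝ} (hν : 0 ≤ ν)
    (hrot : ∀ t, ∀ᵐ x ∂ballMeasure r, lam (rot t x) = lam x)
    (hc : Integrable (fun x => c x * ‖x‖) (ballMeasure r))
    (hb : ∀ᵐ x ∂ballMeasure r, |c x| * ‖x‖ ^ 2 ≤ ν)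
    (hB : ∀ w φ : Plane → ℝ, ContDiff ℝ ∞ w → IsTest r φ →
      ∫ x, lam x * jac w φ x ∂ballMeasure r = -∫ x, c x * (w x * angDeriv φ x) ∂ballMeasure r) :
    JacBound ν r lam := by
  intro w φ hw hφ
  have hφs := hφ.smooth
  have hda := (contDiff_angDeriv hφs).continuous
  have hk := vanishLin_angDeriv hφs r
  have hv : VanishLin r fun x => w x * angDeriv φ x := hk.mul hw.continuous
  obtain ⟨C, h0, hC⟩ := hv.bound
  -- A radial multiplier does not notice a simultaneous rotation of w and φ, so the identity `hB`
  -- may be averaged over all rotations. This brings the product w ∂φ into the form of a circular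
  -- mean.
  have e1 : ∫ x, lam x * jac w φ x ∂ballMeasure r =
      -∫ x, c x * circAvg (fun y => w y * angDeriv φ y) x ∂ballMeasure r := by
    have := integral_swap_lin angleMeasure hc (C := C)
      (K := fun x t => w (rot t x) * angDeriv φ (rot t x)) h0
      (measurable_comp_rot (f := fun y => w y * angDeriv φ y) (by fun_prop))
      fun x hx t => by simpa using hC (rot t x) (by simpa using hx)
    rw [show (fun x => c x * circAvg (fun y => w y * angDeriv φ y) x) = fun x =>
      c x * ∫ t, w (rot t x) * angDeriv φ (rot t x) ∂angleMeasure from rfl, ← this, ← integral_neg]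
    have e : ∀ t, -∫ x, c x * (w (rot t x) * angDeriv φ (rot t x)) ∂ballMeasure r =
        ∫ x, lam x * jac w φ x ∂ballMeasure r := fun t => by
      rw [← integral_jac_comp_rot hrot w φ t, hB _ _ (contDiff_comp_rot hw t) (hφ.comp_rot t)]
      simp only [angDeriv_comp_rot]
    simp [e]
  have hkw := vanishLin_angDeriv hw r
  have h1 : |∫ x, c x * circAvg (fun y => w y * angDeriv φ y) x ∂ballMeasure r| ≤
      ∫ x, (ν / 2) * (circAvg (fun x => angDeriv w x ^ 2) x / ‖x‖ ^ 2 +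
        circAvg (fun x => angDeriv φ x ^ 2) x / ‖x‖ ^ 2) ∂ballMeasure r := by
    rw [← Real.norm_eq_abs]
    refine norm_integral_le_of_norm_le ((hkw.hardyNorm_eq.1.add hk.hardyNorm_eq.1).const_mul _) ?_
    filter_upwards [hb, ae_ne_zero r] with x hx hx0
    have hn : 0 < ‖x‖ ^ 2 := by positivity
    have hcx : |c x| ≤ ν / ‖x‖ ^ 2 := (le_div_iff₀ hn).2 hx
    rw [Real.norm_eq_abs, abs_mul]
    have key : |circAvg (fun y => w y * angDeriv φ y) x| ≤
        (circAvg (fun x => angDeriv w x ^ 2) x + circAvg (fun x => angDeriv φ x ^ 2) x) / 2 := by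
      have i1 : Continuous fun t => w (rot t x) := continuous_comp_rot_left hw.continuous x
      have i2 : Continuous fun t => angDeriv φ (rot t x) := continuous_comp_rot_left hda x
      -- Angular derivatives have zero mean on circles, so w can be centred at no cost; Wirtinger's
      -- inequality then bounds the centred w.
      have e2 : circAvg (fun y => w y * angDeriv φ y) x =
          ∫ t, (w (rot t x) - circAvg w x) * angDeriv φ (rot t x) ∂angleMeasure := by
        simp only [sub_mul]
        rw [integral_sub, integral_const_mul]
        · have := circAvg_angDeriv hφs x
          rw [circAvg] at this
          rw [this]; simp [circAvg]
        · exact integrable_angle (i1.mul i2)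
        · exact integrable_angle (continuous_const.mul i2)
      have e3 := wirtinger_rot hw x
      have e4 : circAvg (fun y => (w y - circAvg w y) ^ 2) x =
          ∫ t, (w (rot t x) - circAvg w x) ^ 2 ∂angleMeasure := by
        rw [circAvg]; simp only [circAvg_rot]
      rw [e2, ← Real.norm_eq_abs]
      calc _ ≤ ∫ t, ((w (rot t x) - circAvg w x) ^ 2 + angDeriv φ (rot t x) ^ 2) / 2
              ∂angleMeasure := by
            refine norm_integral_le_of_norm_le (integrable_angle
              ((((i1.sub continuous_const).pow 2).add (i2.pow 2)).div_const 2))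
              (Eventually.of_forall fun t => ?_)
            rw [Real.norm_eq_abs, abs_le]
            constructor <;> nlinarith [sq_nonneg (w (rot t x) - circAvg w x + angDeriv φ (rot t x)),
              sq_nonneg (w (rot t x) - circAvg w x - angDeriv φ (rot t x))]
        _ = (circAvg (fun y => (w y - circAvg w y) ^ 2) x +
              circAvg (fun x => angDeriv φ x ^ 2) x) / 2 := by
            rw [integral_div, integral_add, e4]
            · rfl
            · exact integrable_angle ((i1.sub continuous_const).pow 2)
            · exact integrable_angle (i2.pow 2)
        _ ≤ _ := by gcongr
    calc _ ≤ ν / ‖x‖ ^ 2 * ((circAvg (fun x => angDeriv w x ^ 2) x +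
          circAvg (fun x => angDeriv φ x ^ 2) x) / 2) := by gcongr
      _ = _ := by ring
  rw [integral_const_mul, integral_add hkw.hardyNorm_eq.1 hk.hardyNorm_eq.1, ← hkw.hardyNorm_eq.2,
    ← hk.hardyNorm_eq.2] at h1
  rw [e1, abs_neg]
  -- For a radial multiplier the angular energies suffice; the two radial terms are added only to
  -- match the common form `JacBound`.
  nlinarith [hardyNorm_nonneg r (radDeriv w), hardyNorm_nonneg r (circAvg (radDeriv φ)),
    mul_nonneg hν (hardyNorm_nonneg r (radDeriv w)),
    mul_nonneg hν (hardyNorm_nonneg r (circAvg (radDeriv φ)))]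

lemma measurable_comp_rot_fst {f : Plane → ℝ} (hf : Continuous f) :
    Measurable fun q : Plane × ℝ × ℝ => f (rot q.2.1 q.1) := by
  have h : Continuous fun q : Plane × ℝ × ℝ => ((q.1, q.2.1) : Plane × ℝ) := by fun_prop
  exact (hf.comp (continuous_rot.comp h)).measurable

lemma measurable_comp_rot_snd {f : Plane → ℝ} (hf : Continuous f) :
    Measurable fun q : Plane × ℝ × ℝ => f (rot q.2.2 q.1) := by
  have h : Continuous fun q : Plane × ℝ × ℝ => ((q.1, q.2.2) : Plane × ℝ) := by fun_prop
  exact (hf.comp (continuous_rot.comp h)).measurable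

/-- Two radial functions have zero Jacobian. To avoid differentiating circular means, w and φ are
rotated by independent angles and the integral of λ times their Jacobian is averaged: each term of
the polar Jacobian then contains the circular mean of an angular derivative, which is zero. -/
lemma integral_circAvg_mul_circAvg_eq_zero {r : ℝ} {lam c : Plane → ℝ}
    (hlam : Integrable lam (ballMeasure r))
    (hc : Integrable (fun x => c x * ‖x‖) (ballMeasure r))
    (hB : ∀ w φ : Plane → ℝ, ContDiff ℝ ∞ w → IsTest r φ →
      ∫ x, lam x * jac w φ x ∂ballMeasure r = ∫ x, c x * (w x * radDeriv φ x) ∂ballMeasure r)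
    {w φ : Plane → ℝ} (hw : ContDiff ℝ ∞ w) (hφ : IsTest r φ) :
    ∫ x, c x * (circAvg w x * circAvg (radDeriv φ) x) ∂ballMeasure r = 0 := by
  set θ := angleMeasure.prod angleMeasure
  have hφs := hφ.smooth
  have cr := (contDiff_radDeriv hφs).continuous
  have ca := (contDiff_angDeriv hφs).continuous
  have crw := (contDiff_radDeriv hw).continuous
  have caw := (contDiff_angDeriv hw).continuous
  obtain ⟨C1, h1, hC1⟩ := (vanishLin_radDeriv hφs r).bound
  obtain ⟨C2, h2, hC2⟩ := (vanishLin_angDeriv hφs r).bound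
  obtain ⟨C3, h3, hC3⟩ := (vanishLin_radDeriv hw r).bound
  obtain ⟨C4, h4, hC4⟩ := (vanishLin_angDeriv hw r).bound
  obtain ⟨C5, h5, hC5⟩ := exists_bound_on_ball hw.continuous r
  have s1 := integral_swap_lin θ hc (C := C5 * C1)
    (K := fun x p => w (rot p.1 x) * radDeriv φ (rot p.2 x)) (by positivity)
    ((measurable_comp_rot_fst hw.continuous).mul (measurable_comp_rot_snd cr)) fun x hx p => by
      rw [abs_mul, mul_assoc]
      gcongr
      · exact hC5 _ (by simpa using hx)
      · simpa using hC1 (rot p.2 x) (by simpa using hx)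
  -- The polar expression of the Jacobian of the rotated pair; it is bounded because each derivative
  -- in it is O(|x|).
  have s2 := integral_swap_bdd θ hlam (C := C3 * C2 + C4 * C1)
    (K := fun x p => (radDeriv w (rot p.1 x) * angDeriv φ (rot p.2 x) -
      angDeriv w (rot p.1 x) * radDeriv φ (rot p.2 x)) / ‖x‖ ^ 2)
    (by
      have a1 := measurable_comp_rot_fst crw
      have a2 := measurable_comp_rot_fst caw
      have a3 := measurable_comp_rot_snd cr
      have a4 := measurable_comp_rot_snd ca
      simp only [Function.uncurry_def]
      fun_prop) fun x hx p => by
      rw [abs_div, abs_of_nonneg (sq_nonneg ‖x‖)]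
      refine div_le_of_le_mul₀ (by positivity) (by positivity) ?_
      have b1 := hC1 (rot p.2 x) (by simpa using hx)
      have b2 := hC2 (rot p.2 x) (by simpa using hx)
      have b3 := hC3 (rot p.1 x) (by simpa using hx)
      have b4 := hC4 (rot p.1 x) (by simpa using hx)
      rw [LinearIsometryEquiv.norm_map] at b1 b2 b3 b4
      refine (abs_sub _ _).trans ?_
      rw [abs_mul, abs_mul]
      calc _ ≤ (C3 * ‖x‖) * (C2 * ‖x‖) + (C4 * ‖x‖) * (C1 * ‖x‖) := by gcongr
        _ = _ := by ring
  have e1 : ∫ x, c x * (circAvg w x * circAvg (radDeriv φ) x) ∂ballMeasure r =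
      ∫ x, c x * ∫ p, w (rot p.1 x) * radDeriv φ (rot p.2 x) ∂θ ∂ballMeasure r := by
    congr 1; ext x; congr 1
    exact (integral_prod_mul (fun t => w (rot t x)) (fun t => radDeriv φ (rot t x))).symm
  have e2 : ∀ x, ∫ p, (radDeriv w (rot p.1 x) * angDeriv φ (rot p.2 x) -
      angDeriv w (rot p.1 x) * radDeriv φ (rot p.2 x)) / ‖x‖ ^ 2 ∂θ = 0 := fun x => by
    have i : ∀ {f g : Plane → ℝ}, Continuous f → Continuous g →
        Integrable (fun p : ℝ × ℝ => f (rot p.1 x) * g (rot p.2 x)) θ := fun hf hg =>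
      (integrable_angle (continuous_comp_rot_left hf x)).mul_prod
        (integrable_angle (continuous_comp_rot_left hg x))
    rw [integral_div, integral_sub (i crw ca) (i caw cr),
      integral_prod_mul (fun t => radDeriv w (rot t x)) (fun t => angDeriv φ (rot t x)),
      integral_prod_mul (fun t => angDeriv w (rot t x)) (fun t => radDeriv φ (rot t x))]
    have a1 := circAvg_angDeriv hφs x
    have a2 := circAvg_angDeriv hw x
    rw [circAvg] at a1 a2
    rw [a1, a2]; simp
  simp only [e2, mul_zero, integral_zero] at s2
  rw [e1]
  refine s1.symm.trans (Eq.trans ?_ s2)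
  refine integral_congr_ae (Eventually.of_forall fun p => ?_)
  dsimp only
  have := hB _ _ (contDiff_comp_rot hw p.1) (hφ.comp_rot p.2)
  simp only [radDeriv_comp_rot] at this
  rw [← this]
  refine integral_congr_ae ?_
  filter_upwards [ae_ne_zero r] with x hx
  have hn : ‖x‖ ^ 2 ≠ 0 := by positivity
  congr 1
  rw [eq_div_iff hn, mul_comm, norm_sq_mul_jac]
  simp only [radDeriv_comp_rot, angDeriv_comp_rot]

/-- The bound for an angular multiplier. -/
lemma jacBound_of_angular {ν r : ℝ} {lam c : Plane → ℝ} (hν : 0 ≤ ν)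
    (hlam : Integrable lam (ballMeasure r))
    (hc : Integrable (fun x => c x * ‖x‖) (ballMeasure r))
    (hb : ∀ᵐ x ∂ballMeasure r, |c x| * ‖x‖ ^ 2 ≤ ν)
    (hB : ∀ w φ : Plane → ℝ, ContDiff ℝ ∞ w → IsTest r φ →
      ∫ x, lam x * jac w φ x ∂ballMeasure r = ∫ x, c x * (w x * radDeriv φ x) ∂ballMeasure r)
    (hB' : ∀ w φ : Plane → ℝ, ContDiff ℝ ∞ w → IsTest r φ →
      ∫ x, lam x * jac w φ x ∂ballMeasure r = -∫ x, c x * (φ x * radDeriv w x) ∂ballMeasure r) :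
    JacBound ν r lam := by
  intro w φ hw hφ
  have hφs := hφ.smooth
  have hkφ := vanishLin_radDeriv hφs r
  have hkw := vanishLin_radDeriv hw r
  obtain ⟨C, h0, hC⟩ := (hkφ.mul hw.continuous).bound
  obtain ⟨C1, h1, hC1⟩ := hkφ.bound
  obtain ⟨C3, h3, hC3⟩ := hkw.bound
  obtain ⟨C5, h5, hC5⟩ := exists_bound_on_ball hw.continuous r
  obtain ⟨C6, h6, hC6⟩ := exists_bound_on_ball hφs.continuous r
  have mf : Measurable fun q : Plane × ℝ => q.1 := measurable_fst
  have s1 := integral_swap_lin angleMeasure hc (C := C5 * C1)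
    (K := fun x t => w x * radDeriv φ (rot t x)) (by positivity)
    ((hw.continuous.measurable.comp mf).mul (measurable_comp_rot hkφ.continuous)) fun x hx p => by
      rw [abs_mul, mul_assoc]
      gcongr
      · exact hC5 _ hx
      · simpa using hC1 (rot p x) (by simpa using hx)
  have s2 := integral_swap_lin angleMeasure hc (C := C6 * C3)
    (K := fun x t => φ (rot t x) * radDeriv w x) (by positivity)
    ((measurable_comp_rot hφs.continuous).mul (hkw.continuous.measurable.comp mf)) fun x hx p => by
      rw [abs_mul, mul_assoc]
      gcongr
      · exact hC6 _ (by simpa using hx)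
      · exact hC3 _ hx
  -- An angular multiplier is not invariant under rotations, so φ alone is rotated: `hB` and `hB'`
  -- agree for every rotated φ, and averaging them equates the two integrals with φ replaced by its
  -- mean.
  have e12 : ∫ x, c x * (w x * circAvg (radDeriv φ) x) ∂ballMeasure r =
      -∫ x, c x * (circAvg φ x * radDeriv w x) ∂ballMeasure r := by
    simp only [integral_const_mul, integral_mul_const] at s1 s2
    simp only [circAvg]
    rw [← s1, ← s2, ← integral_neg]
    congr 1; ext t
    rw [← hB' _ _ hw (hφ.comp_rot t), hB _ _ hw (hφ.comp_rot t)]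
    simp only [radDeriv_comp_rot]
  have z := integral_circAvg_mul_circAvg_eq_zero hlam hc hB hw hφ
  have hA := hkφ.vanishLin_circAvg
  have i1 := VanishLin.integrable_mul hc (hA.mul hw.continuous)
  have i2 := VanishLin.integrable_mul hc (hA.mul (continuous_circAvg hw.continuous))
  have i3 := VanishLin.integrable_mul hc (hkw.mul hφs.continuous)
  have i4 := VanishLin.integrable_mul hc (hkw.mul (continuous_circAvg hφs.continuous))
  have d1 : ∫ x, c x * ((w x - circAvg w x) * circAvg (radDeriv φ) x) ∂ballMeasure r =
      ∫ x, c x * (w x * circAvg (radDeriv φ) x) ∂ballMeasure r := by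
    simp only [sub_mul, mul_sub]
    rw [integral_sub i1 i2, z, sub_zero]
  have d2 : ∫ x, c x * ((φ x - circAvg φ x) * radDeriv w x) ∂ballMeasure r =
      ∫ x, c x * (φ x * radDeriv w x) ∂ballMeasure r -
      ∫ x, c x * (circAvg φ x * radDeriv w x) ∂ballMeasure r := by
    simp only [sub_mul, mul_sub]
    rw [integral_sub i3 i4]
  -- Split φ into its deviation from the mean and the mean. The mean part is transferred to w by
  -- `e12`, and there w can be centred since the product of the two means contributes nothing (`z`).
  -- Hence φ enters the last term only through the mean of its radial derivative.
  have e : ∫ x, lam x * jac w φ x ∂ballMeasure r =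
      -∫ x, c x * ((φ x - circAvg φ x) * radDeriv w x) ∂ballMeasure r +
        ∫ x, c x * ((w x - circAvg w x) * circAvg (radDeriv φ) x) ∂ballMeasure r := by
    rw [hB' w φ hw hφ, d1, d2, e12]; ring
  have b1 := abs_integral_mul_mul_le hν hb (VanishLin.sub_circAvg (r := r) hφs) hkw
  have b2 := abs_integral_mul_mul_le hν hb (VanishLin.sub_circAvg (r := r) hw) hA
  have w1 := mul_le_mul_of_nonneg_left (hardyNorm_sub_circAvg_le (r := r) hφs) hν
  have w2 := mul_le_mul_of_nonneg_left (hardyNorm_sub_circAvg_le (r := r) hw) hν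
  rw [e]
  have tri := abs_add_le (-∫ x, c x * ((φ x - circAvg φ x) * radDeriv w x) ∂ballMeasure r)
    (∫ x, c x * ((w x - circAvg w x) * circAvg (radDeriv φ) x) ∂ballMeasure r)
  rw [abs_neg] at tri
  linarith

/-! ### The bound in terms of Dirichlet integrals. -/

/-- The Dirichlet integral over the disk of radius `r`. -/
def dirichlet (r : ℝ) (w : Plane → ℝ) : ℝ :=
  ∫ x, (partialDeriv 0 w x ^ 2 + partialDeriv 1 w x ^ 2) ∂ballMeasure r

lemma dirichlet_eq {r : ℝ} {w : Plane → ℝ} (hw : ContDiff ℝ ∞ w) :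
    dirichlet r w = hardyNorm r (radDeriv w) + hardyNorm r (angDeriv w) := by
  rw [hardyNorm, hardyNorm, ← integral_add (vanishLin_radDeriv hw r).integrable_sq
    (vanishLin_angDeriv hw r).integrable_sq, dirichlet]
  refine integral_congr_ae ?_
  filter_upwards [ae_ne_zero r] with x hx
  have hn : ‖x‖ ^ 2 ≠ 0 := by positivity
  rw [← add_div, radDeriv_sq_add_angDeriv_sq, mul_div_cancel_left₀ _ hn]

lemma dirichlet_nonneg (r : ℝ) (w : Plane → ℝ) : 0 ≤ dirichlet r w :=
  integral_nonneg fun x => by positivity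

lemma partialDeriv_const_mul (s : ℝ) {w : Plane → ℝ} (hw : ContDiff ℝ ∞ w) (j : Fin 2)
    (x : Plane) : partialDeriv j (fun y => s * w y) x = s * partialDeriv j w x := by
  rw [partialDeriv, fderiv_const_mul (hw.differentiable (by simp) x)]; simp [partialDeriv]

lemma dirichlet_const_mul (r s : ℝ) {w : Plane → ℝ} (hw : ContDiff ℝ ∞ w) :
    dirichlet r (fun x => s * w x) = s ^ 2 * dirichlet r w := by
  simp only [dirichlet, partialDeriv_const_mul s hw, ← integral_const_mul]
  congr 1; ext x; ring

lemma JacBound.le_dirichlet {ν r : ℝ} {lam : Plane → ℝ} (hν : 0 ≤ ν) (h : JacBound ν r lam)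
    {w φ : Plane → ℝ} (hw : ContDiff ℝ ∞ w) (hφ : IsTest r φ) :
    2 * |∫ x, lam x * jac w φ x ∂ballMeasure r| ≤ ν * (dirichlet r w + dirichlet r φ) := by
  have := h w φ hw hφ
  have h2 := mul_le_mul_of_nonneg_left
    (hardyNorm_circAvg_le (vanishLin_radDeriv hφ.smooth r)) hν
  rw [dirichlet_eq hw, dirichlet_eq hφ.smooth]; linarith

/-- Optimisation in s. Adding ε to a and b keeps the optimal s positive and finite when one of them
is zero; then ε → 0. -/
lemma le_sqrt_mul_of_forall {a b c : ℝ} (ha : 0 ≤ a) (hb : 0 ≤ b)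
    (h : ∀ s : ℝ, 0 < s → 2 * c ≤ s ^ 2 * a + b / s ^ 2) : c ≤ √a * √b := by
  have h' : ∀ ε > 0, c ≤ √(a + ε) * √(b + ε) := fun ε hε => by
    have hp : 0 < √(a + ε) := Real.sqrt_pos.2 (by linarith)
    have hq : 0 < √(b + ε) := Real.sqrt_pos.2 (by linarith)
    -- The minimiser of s²(a + ε) + (b + ε)/s².
    have := h (√(√(b + ε) / √(a + ε))) (Real.sqrt_pos.2 (by positivity))
    rw [Real.sq_sqrt (by positivity)] at this
    have e1 := Real.sq_sqrt (show 0 ≤ a + ε by linarith)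
    have e2 := Real.sq_sqrt (show 0 ≤ b + ε by linarith)
    have k1 : √(b + ε) / √(a + ε) * a ≤ √(b + ε) * √(a + ε) := by
      rw [div_mul_eq_mul_div, div_le_iff₀ hp]; nlinarith
    have k2 : b / (√(b + ε) / √(a + ε)) ≤ √(b + ε) * √(a + ε) := by
      rw [div_div_eq_mul_div, div_le_iff₀ hq]; nlinarith
    linarith
  have ht : Tendsto (fun ε => √(a + ε) * √(b + ε)) (𝓝[>] 0) (𝓝 (√(a + 0) * √(b + 0))) := by
    refine Tendsto.mono_left ?_ nhdsWithin_le_nhds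
    exact (by fun_prop : Continuous fun ε => √(a + ε) * √(b + ε)).tendsto 0
  rw [add_zero, add_zero] at ht
  exact ge_of_tendsto ht (by filter_upwards [self_mem_nhdsWithin] with ε hε using h' ε hε)

/-- The Jacobian is unchanged under (w, φ) ↦ (sw, s⁻¹φ) while the Dirichlet integrals scale by s²
and s⁻²; optimising in s turns the sum into a product. The product form makes the pairing continuous
in φ for fixed w. -/
lemma JacBound.abs_le {ν r : ℝ} {lam : Plane → ℝ} (hν : 0 ≤ ν) (h : JacBound ν r lam)
    {w φ : Plane → ℝ} (hw : ContDiff ℝ ∞ w) (hφ : IsTest r φ) :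
    |∫ x, lam x * jac w φ x ∂ballMeasure r| ≤ ν * (√(dirichlet r w) * √(dirichlet r φ)) := by
  have e : ν * (√(dirichlet r w) * √(dirichlet r φ)) =
      √(ν * dirichlet r w) * √(ν * dirichlet r φ) := by
    rw [Real.sqrt_mul hν, Real.sqrt_mul hν]
    linear_combination -(√(dirichlet r w) * √(dirichlet r φ)) * Real.mul_self_sqrt hν
  rw [e]
  refine le_sqrt_mul_of_forall (mul_nonneg hν (dirichlet_nonneg _ _))
    (mul_nonneg hν (dirichlet_nonneg _ _)) fun s hs => ?_
  have := h.le_dirichlet hν (contDiff_const.mul hw : ContDiff ℝ ∞ fun x => s * w x)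
    (hφ.const_mul s⁻¹)
  have hj : ∀ x, jac (fun x => s * w x) (fun x => s⁻¹ * φ x) x = jac w φ x := fun x => by
    simp only [jac, partialDeriv_const_mul _ hw, partialDeriv_const_mul _ hφ.smooth]
    field_simp
  rw [dirichlet_const_mul _ _ hw, dirichlet_const_mul _ _ hφ.smooth] at this
  simp only [hj] at this
  refine this.trans (le_of_eq ?_)
  field_simp

lemma integral_add_sub {α : Type*} [MeasurableSpace α] {μ : Measure α} {f g h : α → ℝ}
    (hf : Integrable f μ) (hg : Integrable g μ) (hh : Integrable h μ) :
    ∫ x, (f x + g x - h x) ∂μ = ∫ x, f x ∂μ + ∫ x, g x ∂μ - ∫ x, h x ∂μ := by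
  rw [integral_sub (f := fun x => f x + g x) (hf.add hg) hh, integral_add hf hg]

lemma integral_add_add {α : Type*} [MeasurableSpace α] {μ : Measure α} {f g h : α → ℝ}
    (hf : Integrable f μ) (hg : Integrable g μ) (hh : Integrable h μ) :
    ∫ x, (f x + g x + h x) ∂μ = ∫ x, f x ∂μ + ∫ x, g x ∂μ + ∫ x, h x ∂μ := by
  rw [integral_add (f := fun x => f x + g x) (hf.add hg) hh, integral_add hf hg]

lemma sq_integral_mul_le {α : Type*} [MeasurableSpace α] {μ : Measure α} {f g : α → ℝ}
    (hf : MemLp f 2 μ) (hg : MemLp g 2 μ) :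
    (∫ x, f x * g x ∂μ) ^ 2 ≤ (∫ x, f x ^ 2 ∂μ) * ∫ x, g x ^ 2 ∂μ := by
  have h : ∀ s : ℝ, 0 ≤ (∫ x, f x ^ 2 ∂μ) * (s * s) + (2 * ∫ x, f x * g x ∂μ) * s +
      ∫ x, g x ^ 2 ∂μ := fun s => by
    have h0 : 0 ≤ ∫ x, (s * f x + g x) ^ 2 ∂μ := integral_nonneg fun x => sq_nonneg _
    have e : ∀ x, (s * f x + g x) ^ 2 = (s * s) * f x ^ 2 + (2 * s) * (f x * g x) + g x ^ 2 :=
      fun x => by ring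
    simp only [e] at h0
    have i1 := hf.integrable_sq
    have i2 := hg.integrable_sq
    have i3 : Integrable (fun x => f x * g x) μ := hf.integrable_mul hg
    rw [integral_add_add (i1.const_mul _) (i3.const_mul _) i2, integral_const_mul,
      integral_const_mul] at h0
    linarith
  have := discrim_le_zero h
  rw [discrim] at this
  linarith

lemma memLp_ball {f : Plane → ℝ} (hf : Continuous f) (r : ℝ) (p : ℝ≥0∞) :
    MemLp f p (ballMeasure r) := by
  obtain ⟨C, -, hC⟩ := exists_bound_on_ball hf r
  refine MemLp.of_bound hf.aestronglyMeasurable C ?_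
  filter_upwards [ae_norm_lt r] with x hx using hC x hx.le

/-! ### The surplus: energy of the non-radial modes. -/

section Averages

variable {r : ℝ} {k : Plane → ℝ}

lemma VanishLin.exists_bound_mul_rot (hk : VanishLin r k) :
    ∃ C, 0 ≤ C ∧ ∀ x, ‖x‖ ≤ r → ∀ t, |k x * k (rot t x) / ‖x‖ ^ 2| ≤ C := by
  obtain ⟨C, h0, hC⟩ := hk.bound
  refine ⟨C * C, by positivity, fun x hx t => ?_⟩
  rw [abs_div, abs_of_nonneg (sq_nonneg ‖x‖), abs_mul]
  refine div_le_of_le_mul₀ (by positivity) (by positivity) ?_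
  have h1 := hC (rot t x) (by simpa using hx)
  rw [LinearIsometryEquiv.norm_map] at h1
  calc _ ≤ (C * ‖x‖) * (C * ‖x‖) := by
        gcongr
        exact hC x hx
    _ = _ := by ring

lemma VanishLin.measurable_mul_rot (hk : VanishLin r k) :
    Measurable (Function.uncurry fun x t => k x * k (rot t x) / ‖x‖ ^ 2) := by
  have h1 := measurable_comp_rot hk.continuous
  have h2 : Measurable fun q : Plane × ℝ => k q.1 := hk.continuous.measurable.comp measurable_fst
  exact (h2.mul h1).div ((measurable_norm.comp measurable_fst).pow_const 2)

lemma VanishLin.integrable_mul_rot (hk : VanishLin r k) (t : ℝ) :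
    Integrable (fun x => k x * k (rot t x) / ‖x‖ ^ 2) (ballMeasure r) := by
  obtain ⟨C, -, hC⟩ := hk.exists_bound_mul_rot
  exact integrable_of_bound (hk.measurable_mul_rot.comp (measurable_id.prodMk measurable_const))
    fun x hx => hC x hx t

lemma VanishLin.continuous_mul_rot (hk : VanishLin r k) :
    Continuous fun t => ∫ x, k x * k (rot t x) / ‖x‖ ^ 2 ∂ballMeasure r := by
  obtain ⟨C, -, hC⟩ := hk.exists_bound_mul_rot
  refine continuous_of_dominated (bound := fun _ => C) (fun t =>
    (hk.integrable_mul_rot t).aestronglyMeasurable) (fun t => ?_) (integrable_const _)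
    (Eventually.of_forall fun x => ?_)
  · filter_upwards [ae_norm_lt r] with x hx using hC x hx.le t
  · exact (continuous_const.mul (continuous_comp_rot_left hk.continuous x)).div_const _

lemma VanishLin.hardyNorm_comp_rot (t : ℝ) :
    hardyNorm r (fun x => k (rot t x)) = hardyNorm r k := by
  rw [hardyNorm, hardyNorm, ← integral_comp_rot r t fun x => k x ^ 2 / ‖x‖ ^ 2]
  simp

lemma VanishLin.hardyNorm_sub_comp_rot (hk : VanishLin r k) (t : ℝ) :
    hardyNorm r (fun x => k x - k (rot t x)) =
      2 * hardyNorm r k - 2 * ∫ x, k x * k (rot t x) / ‖x‖ ^ 2 ∂ballMeasure r := by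
  have e : ∀ x, (k x - k (rot t x)) ^ 2 / ‖x‖ ^ 2 = k x ^ 2 / ‖x‖ ^ 2 +
      k (rot t x) ^ 2 / ‖x‖ ^ 2 - 2 * (k x * k (rot t x) / ‖x‖ ^ 2) := fun x => by ring
  have i1 := hk.integrable_sq
  have i2 := (hk.comp_rot t).integrable_sq
  rw [hardyNorm]
  simp only [e]
  rw [integral_add_sub i1 i2 ((hk.integrable_mul_rot t).const_mul 2), integral_const_mul]
  have := hardyNorm_comp_rot (r := r) (k := k) t
  rw [hardyNorm, hardyNorm] at this
  rw [this, hardyNorm]; ring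

lemma VanishLin.integral_mul_circAvg (hk : VanishLin r k) :
    Integrable (fun x => k x * circAvg k x / ‖x‖ ^ 2) (ballMeasure r) ∧
    ∫ x, k x * circAvg k x / ‖x‖ ^ 2 ∂ballMeasure r =
      hardyNorm r (circAvg k) := by
  obtain ⟨C, h0, hC⟩ := hk.bound
  obtain ⟨D, h1, hD⟩ := hk.vanishLin_circAvg.bound
  have hm : Measurable fun x => k x * circAvg k x / ‖x‖ ^ 2 := by
    have m1 := hk.continuous.measurable
    have m2 := hk.vanishLin_circAvg.continuous.measurable
    fun_prop
  have hb : ∀ x, ‖x‖ ≤ r → |k x * circAvg k x / ‖x‖ ^ 2| ≤ C * D := fun x hx => by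
    rw [abs_div, abs_of_nonneg (sq_nonneg ‖x‖), abs_mul]
    refine div_le_of_le_mul₀ (by positivity) (by positivity) ?_
    calc _ ≤ (C * ‖x‖) * (D * ‖x‖) := by gcongr; exacts [hC x hx, hD x hx]
      _ = _ := by ring
  refine ⟨integrable_of_bound hm hb, ?_⟩
  rw [← (integral_circAvg hm hb).2, hardyNorm]
  congr 1; ext x
  rw [circAvg]
  simp only [circAvg_rot, LinearIsometryEquiv.norm_map]
  rw [integral_div, integral_mul_const, sq (circAvg k x)]; rfl

/-- Pythagoras: circular averaging is an orthogonal projection for the weighted inner product, as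
`VanishLin.integral_mul_circAvg` shows. -/
lemma VanishLin.hardyNorm_sub_circAvg (hk : VanishLin r k) :
    hardyNorm r (fun x => k x - circAvg k x) =
      hardyNorm r k - hardyNorm r (circAvg k) := by
  have e : ∀ x, (k x - circAvg k x) ^ 2 / ‖x‖ ^ 2 = k x ^ 2 / ‖x‖ ^ 2 +
      circAvg k x ^ 2 / ‖x‖ ^ 2 -
      2 * (k x * circAvg k x / ‖x‖ ^ 2) := fun x => by ring
  have i1 := hk.integrable_sq
  have i2 := hk.vanishLin_circAvg.integrable_sq
  rw [hardyNorm]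
  simp only [e]
  rw [integral_add_sub i1 i2 (hk.integral_mul_circAvg.1.const_mul 2), integral_const_mul, hk.integral_mul_circAvg.2, hardyNorm, hardyNorm]
  ring

/-- The mean squared difference of two independent samples is twice the variance. Deviations from
the circular mean are thus expressed through differences k − k ∘ `rot t`, which stay smooth when k
is smooth. -/
lemma VanishLin.integral_hardyNorm_sub_comp_rot (hk : VanishLin r k) :
    Continuous (fun t => hardyNorm r (fun x => k x - k (rot t x))) ∧
    ∫ t, hardyNorm r (fun x => k x - k (rot t x)) ∂angleMeasure =
      2 * (hardyNorm r k - hardyNorm r (circAvg k)) := by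
  simp only [hk.hardyNorm_sub_comp_rot]
  have hc := hk.continuous_mul_rot
  refine ⟨by fun_prop, ?_⟩
  obtain ⟨C, -, hC⟩ := hk.exists_bound_mul_rot
  have s := integral_swap_bdd angleMeasure (integrable_const (1:ℝ)) hk.measurable_mul_rot hC
  simp only [one_mul] at s
  rw [integral_sub (integrable_const _) (integrable_angle (by fun_prop)), integral_const_mul 2 fun t => ∫ x, k x * k (rot t x) / ‖x‖ ^ 2 ∂ballMeasure r,
    s, ← hk.integral_mul_circAvg.2]
  simp only [integral_div, integral_const_mul, circAvg]
  simp; ring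

end Averages

lemma IsTest.eq_zero {r : ℝ} {φ : Plane → ℝ} (h : IsTest r φ) {x : Plane} (hx : r ≤ ‖x‖) :
    φ x = 0 := by
  by_contra h0
  have := h.support (subset_tsupport _ h0)
  simp at this; linarith

lemma integral_ball_eq {r : ℝ} {f : Plane → ℝ} (h : ∀ x, r ≤ ‖x‖ → f x = 0) :
    ∫ x, f x ∂ballMeasure r = ∫ x, f x := by
  refine setIntegral_eq_integral_of_forall_compl_eq_zero fun x hx => h x ?_
  simpa using hx

/-- Integrate div(ψ² x) = 2ψ² + 2ψ x·∇ψ, the field x having divergence 2; coordinatewise this is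
`key`. -/
lemma IsTest.integral_sq {r : ℝ} {ψ : Plane → ℝ} (h : IsTest r ψ) :
    ∫ x, ψ x ^ 2 ∂ballMeasure r = -∫ x, ψ x * radDeriv ψ x ∂ballMeasure r := by
  have hs := h.smooth
  have ic : ∀ {f : Plane → ℝ}, IsTest r f → Integrable f := fun hf =>
    hf.smooth.continuous.integrable_of_hasCompactSupport hf.compact
  have h2 : IsTest r fun x => ψ x * ψ x := h.mul_left hs
  have key : ∀ j : Fin 2, ∫ x : Plane, x j * (2 * (ψ x * partialDeriv j ψ x)) =
      -∫ x, ψ x * ψ x := fun j => by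
    have cj : ContDiff ℝ ∞ fun x : Plane => x j := by fun_prop
    have dj : ∀ x : Plane, fderiv ℝ (fun x : Plane => x j) x (EuclideanSpace.single j 1) = 1 := by
      intro x
      have : (fun x : Plane => x j) = (EuclideanSpace.proj j : Plane →L[ℝ] ℝ) := rfl
      rw [this, ContinuousLinearMap.fderiv]; simp
    have := integral_mul_fderiv_eq_neg_fderiv_mul_of_integrable (μ := volume)
      (f := fun x : Plane => x j) (g := fun x => ψ x * ψ x) (v := EuclideanSpace.single j 1)
      (by simpa only [dj, one_mul] using ic h2)
      (ic ((h2.isTest_partialDeriv j).mul_left cj)) (ic (h2.mul_left cj))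
      (fun x _ => cj.differentiable (by simp) x) (fun x _ => h2.smooth.differentiable (by simp) x)
    simp only [dj, one_mul] at this
    rw [← this]
    congr 1; ext x
    have := partialDeriv_mul hs hs j x
    rw [partialDeriv] at this
    rw [this]; ring
  have ij : ∀ j : Fin 2, Integrable fun x : Plane => x j * (2 * (ψ x * partialDeriv j ψ x)) :=
    fun j => ic (((h.mul_right (contDiff_partialDeriv hs j)).const_mul 2).mul_left
      (by fun_prop : ContDiff ℝ ∞ fun x : Plane => x j))
  rw [integral_ball_eq fun x hx => by rw [h.eq_zero hx]; simp,
    integral_ball_eq fun x hx => by rw [h.eq_zero hx]; simp]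
  have e : ∀ x, ψ x * radDeriv ψ x = (1 / 2) * (x 0 * (2 * (ψ x * partialDeriv 0 ψ x)) +
      x 1 * (2 * (ψ x * partialDeriv 1 ψ x))) := fun x => by rw [radDeriv_eq]; ring
  simp only [e]
  rw [integral_const_mul, integral_add (ij 0) (ij 1), key, key]
  simp only [sq]; ring

/-- A Poincaré inequality using radial derivatives only. The previous identity and ab ≤ (a² + b²)/2
give the bound by the unweighted norm of x·∇ψ, and the weight 1/|x|² is at least one on a disk of
radius at most one. -/
lemma IsTest.integral_sq_le {r : ℝ} (hr : r ≤ 1) {ψ : Plane → ℝ} (h : IsTest r ψ) :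
    ∫ x, ψ x ^ 2 ∂ballMeasure r ≤ hardyNorm r (radDeriv ψ) := by
  have hc := h.smooth.continuous
  have hrc := (contDiff_radDeriv h.smooth).continuous
  have i1 : Integrable (fun x => ψ x ^ 2) (ballMeasure r) := integrable_ball (hc.pow 2) r
  have i2 : Integrable (fun x => radDeriv ψ x ^ 2) (ballMeasure r) :=
    integrable_ball (hrc.pow 2) r
  have h1 : -∫ x, ψ x * radDeriv ψ x ∂ballMeasure r ≤
      ∫ x, (ψ x ^ 2 + radDeriv ψ x ^ 2) / 2 ∂ballMeasure r := by
    rw [← integral_neg]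
    refine integral_mono (integrable_ball (by fun_prop) r) ((i1.add i2).div_const 2) fun x => ?_
    dsimp only
    nlinarith [sq_nonneg (ψ x + radDeriv ψ x)]
  rw [integral_div, integral_add i1 i2, ← h.integral_sq] at h1
  have h2 : ∫ x, radDeriv ψ x ^ 2 ∂ballMeasure r ≤
      hardyNorm r (radDeriv ψ) := by
    refine integral_mono_ae i2 (vanishLin_radDeriv h.smooth r).integrable_sq ?_
    filter_upwards [ae_norm_lt r, ae_ne_zero r] with x hx hx0
    have hp : 0 < ‖x‖ ^ 2 := by positivity
    rw [le_div_iff₀ hp]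
    refine mul_le_of_le_one_right (sq_nonneg _) ?_
    have := norm_nonneg x
    nlinarith
  linarith

/-- The part of the radial Dirichlet energy carried by the non-radial modes. -/
def nonradialEnergy (r : ℝ) (φ : Plane → ℝ) : ℝ :=
  hardyNorm r (radDeriv φ) - hardyNorm r (circAvg (radDeriv φ))

lemma nonradialEnergy_nonneg {r : ℝ} {φ : Plane → ℝ} (h : ContDiff ℝ ∞ φ) :
    0 ≤ nonradialEnergy r φ :=
  sub_nonneg.2 (hardyNorm_circAvg_le (vanishLin_radDeriv h r))

lemma hardyNorm_norm_mul {r : ℝ} (f : Plane → ℝ) :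
    hardyNorm r (fun x => f x * ‖x‖) = ∫ x, f x ^ 2 ∂ballMeasure r := by
  refine integral_congr_ae ?_
  filter_upwards [ae_ne_zero r] with x hx
  have : ‖x‖ ≠ 0 := by positivity
  field_simp

lemma vanishLin_mul_norm {r : ℝ} {f : Plane → ℝ} (hf : Continuous f) :
    VanishLin r fun x => f x * ‖x‖ :=
  VanishLin.mul (k := fun x => ‖x‖) ⟨continuous_norm, 1, zero_le_one, fun x _ => by simp⟩ hf

/-- The Poincaré inequality is applied to the test functions φ − φ ∘ `rot t` and averaged over t;
both sides become twice a variance. Applying it to φ minus its circular mean would require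
smoothness of the mean. -/
lemma IsTest.integral_sub_circAvg_sq_le {r : ℝ} (hr : r ≤ 1) {φ : Plane → ℝ} (h : IsTest r φ) :
    ∫ x, (φ x - circAvg φ x) ^ 2 ∂ballMeasure r ≤ nonradialEnergy r φ := by
  -- The factor |x| cancels the weight in `hardyNorm`, so the averaging identities also cover the
  -- plain L² norm.
  have hk : VanishLin r fun x => φ x * ‖x‖ := vanishLin_mul_norm h.smooth.continuous
  have ha : circAvg (fun x => φ x * ‖x‖) = fun x => circAvg φ x * ‖x‖ := by
    ext x; simp [circAvg, integral_mul_const]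
  have e1 := hk.hardyNorm_sub_circAvg
  have e2 := hk.integral_hardyNorm_sub_comp_rot
  rw [← e1, ha] at e2
  have hR := vanishLin_radDeriv h.smooth r
  have e3 := hR.integral_hardyNorm_sub_comp_rot
  have e4 : hardyNorm r (fun x => φ x * ‖x‖ - circAvg φ x * ‖x‖) =
      ∫ x, (φ x - circAvg φ x) ^ 2 ∂ballMeasure r := by
    rw [← hardyNorm_norm_mul]; simp only [sub_mul]
  rw [e4] at e2
  have : ∫ t, hardyNorm r (fun x => φ x * ‖x‖ - φ (rot t x) * ‖rot t x‖) ∂angleMeasure ≤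
      ∫ t, hardyNorm r (fun x => radDeriv φ x -
        radDeriv φ (rot t x)) ∂angleMeasure := by
    refine integral_mono (integrable_angle e2.1) (integrable_angle e3.1) fun t => ?_
    have := (h.sub (h.comp_rot t)).integral_sq_le hr
    rw [← hardyNorm_norm_mul] at this
    simp only [LinearIsometryEquiv.norm_map, ← sub_mul]
    refine this.trans (le_of_eq ?_)
    congr 1; ext x
    rw [← radDeriv_comp_rot, radDeriv, fderiv_fun_sub
      (h.smooth.differentiable (by simp) x) ((h.comp_rot t).smooth.differentiable (by simp) x)]
    rfl
  rw [nonradialEnergy]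
  linarith [e2.2, e3.2]

/-- The circular mean of φ is orthogonal to every angular derivative, so only the deviation from it
is paired with `angDeriv χ`. The pairing is linear in φ without derivatives of φ, so it passes to
limits in L². -/
lemma IsTest.sq_integral_mul_angDeriv_le {r : ℝ} (hr : r ≤ 1) {φ χ : Plane → ℝ} (h : IsTest r φ)
    (hχ : IsTest r χ) : (∫ x, φ x * angDeriv χ x ∂ballMeasure r) ^ 2 ≤
      nonradialEnergy r φ * ∫ x, angDeriv χ x ^ 2 ∂ballMeasure r := by
  have hc := h.smooth.continuous
  have hA := continuous_circAvg hc
  have ha := (contDiff_angDeriv hχ.smooth).continuous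
  have z : ∫ x, circAvg φ x * angDeriv χ x ∂ballMeasure r = 0 := by
    have hm : Continuous fun x => circAvg φ x * angDeriv χ x := hA.mul ha
    obtain ⟨C, -, hC⟩ := exists_bound_on_ball hm r
    rw [← (integral_circAvg hm.measurable hC).2]
    have : ∀ x, circAvg (fun x => circAvg φ x * angDeriv χ x) x = 0 := fun x => by
      have := circAvg_angDeriv hχ.smooth x
      rw [circAvg] at this ⊢
      simp only [circAvg_rot]
      rw [integral_const_mul, this, mul_zero]
    simp [this]
  have e : ∫ x, φ x * angDeriv χ x ∂ballMeasure r =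
      ∫ x, (φ x - circAvg φ x) * angDeriv χ x ∂ballMeasure r := by
    simp only [sub_mul]
    rw [integral_sub (f := fun x => φ x * angDeriv χ x) (g := fun x => circAvg φ x * angDeriv χ x)
      (integrable_ball (hc.mul ha) r) (integrable_ball (hA.mul ha) r), z, sub_zero]
  rw [e]
  refine (sq_integral_mul_le (memLp_ball (hc.sub hA) r 2) (memLp_ball ha r 2)).trans ?_
  exact mul_le_mul_of_nonneg_right (h.integral_sub_circAvg_sq_le hr)
    (integral_nonneg fun x => sq_nonneg _)

/-- `JacBound` misses the non-radial energy of its second argument only. The Jacobian is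
antisymmetric, so the bound holds with the roles exchanged as well, and the mean of the two gives
half the surplus for each function. -/
lemma JacBound.le_sub_nonradial {ν r : ℝ} {lam : Plane → ℝ} (h : JacBound ν r lam)
    {φ ψ : Plane → ℝ} (hφ : IsTest r φ) (hψ : IsTest r ψ) :
    2 * |∫ x, lam x * jac φ ψ x ∂ballMeasure r| ≤ ν * (dirichlet r φ + dirichlet r ψ) -
      ν / 2 * (nonradialEnergy r φ + nonradialEnergy r ψ) := by
  have h1 := h φ ψ hφ.smooth hψ
  have h2 := h ψ φ hψ.smooth hφ
  have e : ∫ x, lam x * jac ψ φ x ∂ballMeasure r = -∫ x, lam x * jac φ ψ x ∂ballMeasure r := by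
    rw [← integral_neg]; congr 1; ext x; simp only [jac]; ring
  rw [e, abs_neg] at h2
  rw [dirichlet_eq hφ.smooth, dirichlet_eq hψ.smooth, nonradialEnergy, nonradialEnergy]
  linarith

/-! ### Weak gradients of functions of one polar variable. -/

lemma inner_perp_eq (x g : Plane) : inner ℝ (perp x) g = -x 1 * g 0 + x 0 * g 1 := by
  rw [PiLp.inner_apply, Fin.sum_univ_two]; simp; ring

lemma inner_eq (x g : Plane) : inner ℝ x g = x 0 * g 0 + x 1 * g 1 := by
  rw [PiLp.inner_apply, Fin.sum_univ_two]; simp; ring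

lemma partialDeriv_coord (i j : Fin 2) (x : Plane) :
    partialDeriv j (fun y : Plane => y i) x = if i = j then 1 else 0 := by
  have : (fun x : Plane => x i) = (EuclideanSpace.proj i : Plane →L[ℝ] ℝ) := rfl
  rw [partialDeriv, this, ContinuousLinearMap.fderiv]
  simp

lemma contDiff_coord (i : Fin 2) : ContDiff ℝ ∞ fun x : Plane => x i := by fun_prop

lemma HasGradOn.integral_inner_perp {r : ℝ} {lam : Plane → ℝ} {G : Plane → Plane}
    (h : HasGradOn r lam G) {ψ : Plane → ℝ} (hψ : IsTest r ψ) :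
    ∫ x, inner ℝ (perp x) (G x) * ψ x ∂ballMeasure r =
      -∫ x, lam x * angDeriv ψ x ∂ballMeasure r := by
  have t0 := hψ.mul_left (contDiff_coord 0)
  have t1 := hψ.mul_left (contDiff_coord 1)
  have e0 := h.integral_eq _ t0 1
  have e1 := h.integral_eq _ t1 0
  have i0 := integrable_mul_continuous h.integrable (contDiff_partialDeriv t0.smooth 1).continuous
  have i1 := integrable_mul_continuous h.integrable (contDiff_partialDeriv t1.smooth 0).continuous
  have j0 := integrable_mul_continuous (integrable_coord h.integrable_grad 1) t0.smooth.continuous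
  have j1 := integrable_mul_continuous (integrable_coord h.integrable_grad 0) t1.smooth.continuous
  have k1 : ∀ x, inner ℝ (perp x) (G x) * ψ x = G x 1 * (x 0 * ψ x) - G x 0 * (x 1 * ψ x) :=
    fun x => by rw [inner_perp_eq]; ring
  have k2 : ∀ x, lam x * angDeriv ψ x = lam x * partialDeriv 1 (fun x => x 0 * ψ x) x -
      lam x * partialDeriv 0 (fun x => x 1 * ψ x) x := fun x => by
    rw [partialDeriv_mul (contDiff_coord 0) hψ.smooth, partialDeriv_mul (contDiff_coord 1) hψ.smooth,
      partialDeriv_coord, partialDeriv_coord, angDeriv_eq]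
    simp; ring
  simp only [k1, k2]
  rw [integral_sub j0 j1, integral_sub i0 i1, e0, e1]; ring

/-- The term 2ψ is the divergence of the field x; the rotated field x^⊥ of the preceding lemma is
divergence free. -/
lemma HasGradOn.integral_inner_self {r : ℝ} {lam : Plane → ℝ} {G : Plane → Plane}
    (h : HasGradOn r lam G) {ψ : Plane → ℝ} (hψ : IsTest r ψ) :
    ∫ x, inner ℝ x (G x) * ψ x ∂ballMeasure r =
      -∫ x, lam x * (2 * ψ x + radDeriv ψ x) ∂ballMeasure r := by
  have t0 := hψ.mul_left (contDiff_coord 0)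
  have t1 := hψ.mul_left (contDiff_coord 1)
  have e0 := h.integral_eq _ t0 0
  have e1 := h.integral_eq _ t1 1
  have i0 := integrable_mul_continuous h.integrable (contDiff_partialDeriv t0.smooth 0).continuous
  have i1 := integrable_mul_continuous h.integrable (contDiff_partialDeriv t1.smooth 1).continuous
  have j0 := integrable_mul_continuous (integrable_coord h.integrable_grad 0) t0.smooth.continuous
  have j1 := integrable_mul_continuous (integrable_coord h.integrable_grad 1) t1.smooth.continuous
  have k1 : ∀ x, inner ℝ x (G x) * ψ x = G x 0 * (x 0 * ψ x) + G x 1 * (x 1 * ψ x) :=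
    fun x => by rw [inner_eq]; ring
  have k2 : ∀ x, lam x * (2 * ψ x + radDeriv ψ x) = lam x * partialDeriv 0 (fun x => x 0 * ψ x) x +
      lam x * partialDeriv 1 (fun x => x 1 * ψ x) x := fun x => by
    rw [partialDeriv_mul (contDiff_coord 0) hψ.smooth, partialDeriv_mul (contDiff_coord 1) hψ.smooth,
      partialDeriv_coord, partialDeriv_coord, radDeriv_eq]
    simp; ring
  simp only [k1, k2]
  rw [integral_add j0 j1, integral_add i0 i1, e0, e1]; ring

lemma ae_eq_zero_of_forall_isTest {r : ℝ} {f : Plane → ℝ} (hf : Integrable f (ballMeasure r))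
    (h : ∀ ψ, IsTest r ψ → ∫ x, f x * ψ x ∂ballMeasure r = 0) : ∀ᵐ x ∂ballMeasure r, f x = 0 := by
  have hl : LocallyIntegrableOn f (Metric.ball 0 r) volume :=
    IntegrableOn.locallyIntegrableOn hf
  have := Metric.isOpen_ball.ae_eq_zero_of_integral_contDiff_smul_eq_zero hl
    fun g hg hc hs => by
      have := h g ⟨hg, hc, hs⟩
      rw [integral_ball_eq fun x hx => by rw [IsTest.eq_zero ⟨hg, hc, hs⟩ hx, mul_zero]] at this
      rw [← this]; congr 1; ext x; rw [smul_eq_mul, mul_comm]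
  exact (ae_restrict_iff' Metric.isOpen_ball.measurableSet).2 this

lemma integrable_inner {r : ℝ} {G : Plane → Plane} (hG : Integrable G (ballMeasure r)) :
    Integrable (fun x => inner ℝ x (G x)) (ballMeasure r) := by
  simp only [inner_eq]
  have := (integrable_mul_continuous (integrable_coord hG 0) (contDiff_coord 0).continuous).add
    (integrable_mul_continuous (integrable_coord hG 1) (contDiff_coord 1).continuous)
  refine this.congr (Eventually.of_forall fun x => ?_)
  simp; ring

lemma integrable_inner_perp {r : ℝ} {G : Plane → Plane} (hG : Integrable G (ballMeasure r)) :
    Integrable (fun x => inner ℝ (perp x) (G x)) (ballMeasure r) := by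
  simp only [inner_perp_eq]
  have := (integrable_mul_continuous (integrable_coord hG 1) (contDiff_coord 0).continuous).sub
    (integrable_mul_continuous (integrable_coord hG 0) (contDiff_coord 1).continuous)
  refine this.congr (Eventually.of_forall fun x => ?_)
  simp; ring

/-- Tested with ψ, the angular derivative of λ is −∫λ `angDeriv ψ`. By invariance of λ this may be
averaged over rotations of ψ, and circular means of angular derivatives vanish. -/
lemma HasGradOn.ae_inner_perp_eq_zero {r : ℝ} {lam : Plane → ℝ} {G : Plane → Plane}
    (h : HasGradOn r lam G) (hrot : ∀ t, ∀ᵐ x ∂ballMeasure r, lam (rot t x) = lam x) :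
    ∀ᵐ x ∂ballMeasure r, inner ℝ (perp x) (G x) = 0 := by
  refine ae_eq_zero_of_forall_isTest (integrable_inner_perp h.integrable_grad) fun ψ hψ => ?_
  rw [h.integral_inner_perp hψ, neg_eq_zero]
  have ha := (contDiff_angDeriv hψ.smooth).continuous
  obtain ⟨C, h0, hC⟩ := exists_bound_on_ball ha r
  have s := integral_swap_bdd angleMeasure h.integrable (measurable_comp_rot ha)
    fun x hx t => hC (rot t x) (by simpa using hx)
  have z : ∀ x, ∫ t, angDeriv ψ (rot t x) ∂angleMeasure = 0 := circAvg_angDeriv hψ.smooth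
  have e : ∀ t, ∫ x, lam x * angDeriv ψ (rot t x) ∂ballMeasure r =
      ∫ x, lam x * angDeriv ψ x ∂ballMeasure r := fun t => by
    rw [← integral_comp_rot r t fun x => lam x * angDeriv ψ x]
    refine integral_congr_ae ?_
    filter_upwards [hrot t] with x hx
    rw [hx]
  simp only [z, e, mul_zero, integral_zero] at s
  simpa using s

lemma polarAngle_smul {s : ℝ} (hs : 0 < s) (x : Plane) : polarAngle (s • x) = polarAngle x := by
  have : (⟨(s • x) 0, (s • x) 1⟩ : ℂ) = (s : ℂ) * ⟨x 0, x 1⟩ := by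
    apply Complex.ext <;> simp
  rw [polarAngle, this, Complex.arg_real_mul _ hs, polarAngle]

lemma integral_swap_bdd_on {T : Type*} [MeasurableSpace T] (θ : Measure T) [IsFiniteMeasure θ]
    {r C : ℝ} {g : Plane → ℝ} (hg : Integrable g (ballMeasure r)) {K : Plane → T → ℝ}
    (hm : Measurable (Function.uncurry K)) {S : Set T} (hS : MeasurableSet S)
    (hθ : ∀ᵐ t ∂θ, t ∈ S) (hC0 : 0 ≤ C)
    (hC : ∀ x, ‖x‖ ≤ r → ∀ t ∈ S, |K x t| ≤ C) :
    ∫ t, ∫ x, g x * K x t ∂ballMeasure r ∂θ = ∫ x, g x * ∫ t, K x t ∂θ ∂ballMeasure r := by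
  have hm' : Measurable (Function.uncurry fun x t => S.indicator (K x) t) := by
    have : (Function.uncurry fun x t => S.indicator (K x) t) =
        (Prod.snd ⁻¹' S).indicator (Function.uncurry K) := by
      ext ⟨x, t⟩; rfl
    rw [this]; exact hm.indicator (measurable_snd hS)
  have := integral_swap_bdd θ hg hm' (C := C) fun x hx t => by
    by_cases ht : t ∈ S
    · simpa [ht] using hC x hx t ht
    · simpa [ht] using hC0
  calc _ = ∫ t, ∫ x, g x * S.indicator (K x) t ∂ballMeasure r ∂θ := by
        refine integral_congr_ae ?_
        filter_upwards [hθ] with t ht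
        simp [ht]
    _ = _ := this
    _ = _ := by
        congr 1; ext x; congr 1
        refine integral_congr_ae ?_
        filter_upwards [hθ] with t ht
        simp [ht]

/-- The analogue for dilations. A function of the angle is homogeneous of degree zero, so ∫λ(x)
e^{2t} χ(e^t x) does not depend on t ≥ 0; with χ = 2ψ + x·∇ψ the integrand is λ times the
t-derivative of e^{2t} ψ(e^t x). Integrating over t in (0, 1] yields a difference of two equal
integrals. Taking t ≥ 0 keeps the supports inside the disk. -/
lemma HasGradOn.ae_inner_self_eq_zero {r : ℝ} {lam : Plane → ℝ} {G : Plane → Plane}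
    (h : HasGradOn r lam G) {l : ℝ → ℝ}
    (hl : ∀ᵐ x ∂ballMeasure r, lam x = l (polarAngle x)) :
    ∀ᵐ x ∂ballMeasure r, inner ℝ x (G x) = 0 := by
  refine ae_eq_zero_of_forall_isTest (integrable_inner h.integrable_grad) fun ψ hψ => ?_
  rw [h.integral_inner_self hψ, neg_eq_zero]
  have hscale : ∀ χ, IsTest r χ → ∀ t : ℝ, 0 ≤ t →
      ∫ x, lam x * (Real.exp t ^ 2 * χ (Real.exp t • x)) ∂ballMeasure r =
        ∫ x, lam x * χ x ∂ballMeasure r := fun χ hχ t ht => by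
    have e1 : ∀ f : Plane → ℝ, ∫ x, lam x * f x ∂ballMeasure r =
        ∫ x, l (polarAngle x) * f x ∂ballMeasure r := fun f =>
      integral_congr_ae (by filter_upwards [hl] with x hx; rw [hx])
    rw [e1, e1, integral_ball_eq (f := fun x => l (polarAngle x) * χ x) fun x hx => by
      rw [hχ.eq_zero hx, mul_zero], integral_ball_eq]
    · have := Measure.integral_comp_smul volume (fun x : Plane => l (polarAngle x) * χ x)
        (Real.exp t)
      simp only [polarAngle_smul (Real.exp_pos t), finrank_euclideanSpace, Fintype.card_fin] at this
      have he : (0:ℝ) < Real.exp t ^ 2 := by positivity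
      have e2 : ∀ x, l (polarAngle x) * (Real.exp t ^ 2 * χ (Real.exp t • x)) =
          Real.exp t ^ 2 * (l (polarAngle x) * χ (Real.exp t • x)) := fun x => by ring
      simp only [e2]
      rw [integral_const_mul, this, abs_of_pos (by positivity), smul_eq_mul, mul_inv_cancel_left₀ he.ne']
    · intro x hx
      rw [hχ.eq_zero, mul_zero, mul_zero]
      rw [norm_smul, Real.norm_eq_abs, Real.abs_exp]
      have := Real.one_le_exp ht
      nlinarith [norm_nonneg x]
  set χ : Plane → ℝ := fun x => 2 * ψ x + radDeriv ψ x with hχd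
  have hχ : IsTest r χ := by
    have := (hψ.const_mul 2).sub (hψ.isTest_radDeriv.const_mul (-1))
    convert this using 2 with x
    ring
  have hχc := hχ.smooth.continuous
  have hd : ∀ x t, HasDerivAt (fun t => Real.exp t ^ 2 * ψ (Real.exp t • x))
      (Real.exp t ^ 2 * χ (Real.exp t • x)) t := fun x t => by
    have h1 := (Real.hasDerivAt_exp t).smul_const x
    have h2 := ((hψ.smooth.differentiable (by simp)) (Real.exp t • x)).hasFDerivAt.comp_hasDerivAt t h1
    have h3 := ((Real.hasDerivAt_exp t).pow 2).mul h2
    refine HasDerivAt.congr_deriv (f := fun t => Real.exp t ^ 2 * ψ (Real.exp t • x)) h3 ?_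
    simp only [hχd, radDeriv, map_smul, smul_eq_mul, Pi.pow_apply, Function.comp_apply]
    push_cast; ring
  obtain ⟨C, hC⟩ := hχ.compact.exists_bound_of_continuous hχc
  have hC0 : 0 ≤ C := (norm_nonneg _).trans (hC 0)
  have hcont : Continuous fun q : Plane × ℝ => Real.exp q.2 ^ 2 * χ (Real.exp q.2 • q.1) := by
    fun_prop
  have s := integral_swap_bdd_on (volume.restrict (Set.Ioc (0:ℝ) 1)) h.integrable
    (K := fun x t => Real.exp t ^ 2 * χ (Real.exp t • x)) hcont.measurable measurableSet_Ioc
    (ae_restrict_mem measurableSet_Ioc) (C := Real.exp 1 ^ 2 * C) (by positivity)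
    fun x _ t ht => by
      rw [abs_mul, abs_of_nonneg (by positivity)]
      gcongr
      · exact ht.2
      · exact hC _
  have e3 : ∀ x, ∫ t in Set.Ioc (0:ℝ) 1, Real.exp t ^ 2 * χ (Real.exp t • x) =
      Real.exp 1 ^ 2 * ψ (Real.exp 1 • x) - ψ x := fun x => by
    rw [← intervalIntegral.integral_of_le zero_le_one,
      intervalIntegral.integral_eq_sub_of_hasDerivAt (fun t _ => hd x t)]
    · simp
    · have : Continuous fun t => Real.exp t ^ 2 * χ (Real.exp t • x) := by fun_prop
      exact this.intervalIntegrable _ _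
  have e4 : ∫ t in Set.Ioc (0:ℝ) 1,
      ∫ x, lam x * (Real.exp t ^ 2 * χ (Real.exp t • x)) ∂ballMeasure r =
        ∫ x, lam x * χ x ∂ballMeasure r := by
    rw [setIntegral_congr_fun measurableSet_Ioc fun t ht => hscale χ hχ t ht.1.le]
    simp
  have hψc := hψ.smooth.continuous
  rw [e4] at s
  rw [s]
  simp only [e3, mul_sub]
  rw [integral_sub, hscale ψ hψ 1 zero_le_one, sub_self]
  · exact integrable_mul_continuous h.integrable
      (f := fun x => Real.exp 1 ^ 2 * ψ (Real.exp 1 • x)) (by fun_prop)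
  · exact integrable_mul_continuous h.integrable hψc

lemma integrable_inner_div {r : ℝ} {G : Plane → Plane} (L : Plane → Plane) (hL : Continuous L)
    (hLn : ∀ x, ‖L x‖ = ‖x‖) (hG : Integrable G (ballMeasure r)) :
    Integrable (fun x => inner ℝ (L x) (G x) / ‖x‖ ^ 2 * ‖x‖) (ballMeasure r) := by
  refine hG.norm.mono' ?_ ?_
  · have h1 : AEStronglyMeasurable (fun x => inner ℝ (L x) (G x)) (ballMeasure r) :=
      hL.aestronglyMeasurable.inner hG.aestronglyMeasurable
    have h2 : AEStronglyMeasurable (fun x : Plane => (‖x‖ ^ 2)⁻¹ * ‖x‖) (ballMeasure r) :=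
      (by fun_prop : Measurable (fun x : Plane => (‖x‖ ^ 2)⁻¹ * ‖x‖)).aestronglyMeasurable
    refine (h1.mul h2).congr (Eventually.of_forall fun x => ?_)
    simp; ring
  · filter_upwards [ae_ne_zero r] with x hx
    have hn : 0 < ‖x‖ := by positivity
    rw [Real.norm_eq_abs, abs_mul, abs_div, abs_norm, abs_of_nonneg (sq_nonneg ‖x‖),
      div_mul_eq_mul_div, div_le_iff₀ (by positivity)]
    have := abs_real_inner_le_norm (L x) (G x)
    rw [hLn] at this
    nlinarith

/-- A radial or angular multiplier with `|x| |∇λ| ≤ ν` satisfies the energy bound. -/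
theorem HasGradOn.jacBound {ν r : ℝ} (hν : 0 ≤ ν) {lam : Plane → ℝ} {G : Plane → Plane}
    (h : HasGradOn r lam G)
    (hR : ∀ᵐ x ∂ballMeasure r, |inner ℝ x (G x)| ≤ ν)
    (hT : ∀ᵐ x ∂ballMeasure r, |inner ℝ (perp x) (G x)| ≤ ν)
    (hone : (∃ l : ℝ → ℝ, ∀ᵐ x ∂ballMeasure r, lam x = l ‖x‖) ∨
      ∃ l : ℝ → ℝ, ∀ᵐ x ∂ballMeasure r, lam x = l (polarAngle x)) : JacBound ν r lam := by
  -- The polar form of the cross product of ∇λ and ∇φ. In each case one of its two terms vanishes,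
  -- and the coefficient of the other, divided by |x|², is the c of the preceding bounds.
  have key : ∀ (x g : Plane) (φ : Plane → ℝ), ‖x‖ ^ 2 *
      (g 1 * partialDeriv 0 φ x - g 0 * partialDeriv 1 φ x) =
      inner ℝ (perp x) g * radDeriv φ x - inner ℝ x g * angDeriv φ x := fun x g φ => by
    rw [norm_sq_eq, inner_perp_eq, inner_eq, radDeriv_eq, angDeriv_eq]; ring
  have hbd : ∀ {f : Plane → ℝ}, (∀ᵐ x ∂ballMeasure r, |f x| ≤ ν) →
      ∀ᵐ x ∂ballMeasure r, |f x / ‖x‖ ^ 2| * ‖x‖ ^ 2 ≤ ν := fun hf => by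
    filter_upwards [hf, ae_ne_zero r] with x hx hx0
    have hn : 0 < ‖x‖ ^ 2 := by positivity
    rwa [abs_div, abs_of_pos hn, div_mul_cancel₀ _ hn.ne']
  obtain ⟨l, hl⟩ | ⟨l, hl⟩ := hone
  · have hrot : ∀ t, ∀ᵐ x ∂ballMeasure r, lam (rot t x) = lam x := fun t => by
      filter_upwards [hl, (measurePreserving_rot r t).quasiMeasurePreserving.ae hl] with x h1 h2
      rw [h1, h2, LinearIsometryEquiv.norm_map]
    have hz := h.ae_inner_perp_eq_zero hrot
    refine jacBound_of_radial hν hrot (c := fun x => inner ℝ x (G x) / ‖x‖ ^ 2)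
      (integrable_inner_div (fun x => x) continuous_id (fun _ => rfl) h.integrable_grad)
      (hbd hR) fun w φ hw hφ => ?_
    rw [h.integral_jac hw hφ, ← integral_neg]
    refine integral_congr_ae ?_
    filter_upwards [hz, ae_ne_zero r] with x hx hx0
    have hn : ‖x‖ ^ 2 ≠ 0 := by positivity
    have := key x (G x) φ
    rw [hx] at this
    field_simp
    linear_combination (w x) * this
  · have hz := h.ae_inner_self_eq_zero hl
    refine jacBound_of_angular hν (c := fun x => inner ℝ (perp x) (G x) / ‖x‖ ^ 2) h.integrable
      (integrable_inner_div (fun x => perp x) perp.continuous norm_perp h.integrable_grad)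
      (hbd hT) (fun w φ hw hφ => ?_) fun w φ hw hφ => ?_
    · rw [h.integral_jac hw hφ]
      refine integral_congr_ae ?_
      filter_upwards [hz, ae_ne_zero r] with x hx hx0
      have hn : ‖x‖ ^ 2 ≠ 0 := by positivity
      have := key x (G x) φ
      rw [hx] at this
      field_simp
      linear_combination (w x) * this
    · rw [h.integral_jac' hw hφ, ← integral_neg]
      refine integral_congr_ae ?_
      filter_upwards [hz, ae_ne_zero r] with x hx hx0
      have hn : ‖x‖ ^ 2 ≠ 0 := by positivity
      have := key x (G x) w
      rw [hx] at this
      field_simp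
      linear_combination -(φ x) * this

lemma polar_coord_eq (x : Plane) :
    ‖x‖ * Real.cos (polarAngle x) = x 0 ∧ ‖x‖ * Real.sin (polarAngle x) = x 1 := by
  have hn : ‖x‖ = ‖(⟨x 0, x 1⟩ : ℂ)‖ := by
    rw [← sq_eq_sq₀ (norm_nonneg _) (norm_nonneg _), norm_sq_eq, Complex.sq_norm, Complex.normSq_mk]
    ring
  rw [hn, polarAngle]
  exact ⟨Complex.norm_mul_cos_arg _, Complex.norm_mul_sin_arg _⟩

/-- Since |x| e_R = x and |x| e_θ = x^⊥, the polar components of |x|G are the pairings of G with x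
and x^⊥. -/
lemma ae_inner_le_of_polarSupNorm_le {ν : ℝ} (hν : 0 ≤ ν) {G : Plane → Plane}
    (h : polarSupNorm (fun x => ‖x‖ • G x) ≤ ENNReal.ofReal ν) :
    (∀ᵐ x ∂diskMeasure, |inner ℝ x (G x)| ≤ ν) ∧
      ∀ᵐ x ∂diskMeasure, |inner ℝ (perp x) (G x)| ≤ ν := by
  have e1 : ∀ x, inner ℝ (‖x‖ • G x) (eR x) = inner ℝ x (G x) := fun x => by
    obtain ⟨h0, h1⟩ := polar_coord_eq x
    rw [inner_eq, inner_eq]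
    simp [eR]
    linear_combination (G x 0) * h0 + (G x 1) * h1
  have e2 : ∀ x, inner ℝ (‖x‖ • G x) (eTheta x) = inner ℝ (perp x) (G x) := fun x => by
    obtain ⟨h0, h1⟩ := polar_coord_eq x
    rw [inner_eq, inner_perp_eq]
    simp [eTheta]
    linear_combination (G x 1) * h0 - (G x 0) * h1
  rw [polarSupNorm] at h
  simp only [e1, e2] at h
  have aux : ∀ f : Plane → ℝ, eLpNorm f ∞ diskMeasure ≤ ENNReal.ofReal ν →
      ∀ᵐ x ∂diskMeasure, |f x| ≤ ν := fun f hf => by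
    rw [eLpNorm_exponent_top] at hf
    filter_upwards [enorm_ae_le_eLpNormEssSup f diskMeasure] with x hx
    have := hx.trans hf
    rwa [Real.enorm_eq_ofReal_abs, ENNReal.ofReal_le_ofReal_iff hν] at this
  exact ⟨aux _ ((le_max_left _ _).trans h), aux _ ((le_max_right _ _).trans h)⟩

/-! ### Mollification and interior smooth approximation. -/

/-- The mollification of `g` by a normalized bump function. -/
def mollify (ρ : ContDiffBump (0 : Plane)) (g : Plane → ℝ) : Plane → ℝ :=
  convolution (ρ.normed volume) g (ContinuousLinearMap.lsmul ℝ ℝ) volume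

lemma mollify_apply (ρ : ContDiffBump (0 : Plane)) (g : Plane → ℝ) (x : Plane) :
    mollify ρ g x = ∫ t, ρ.normed volume t * g (x - t) := by
  rw [mollify, convolution_def]; rfl

lemma mollify_congr (ρ : ContDiffBump (0 : Plane)) {g g' : Plane → ℝ} (h : g =ᵐ[volume] g') :
    mollify ρ g = mollify ρ g' := by
  ext x
  rw [mollify_apply, mollify_apply]
  refine integral_congr_ae ?_
  have := (quasiMeasurePreserving_sub_left (volume : Measure Plane) x).ae_eq h
  filter_upwards [this] with t ht
  simp only [Function.comp_apply] at ht
  rw [ht]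

/-- The probability measure with density a normalized bump function. -/
def bumpMeasure (ρ : ContDiffBump (0 : Plane)) : Measure Plane :=
  volume.withDensity fun t => ENNReal.ofReal (ρ.normed volume t)

instance (ρ : ContDiffBump (0 : Plane)) : IsProbabilityMeasure (bumpMeasure ρ) := ⟨by
  rw [bumpMeasure, withDensity_apply _ MeasurableSet.univ, Measure.restrict_univ,
    ← ofReal_integral_eq_lintegral_ofReal (ρ.integrable_normed)
      (Eventually.of_forall fun t => ρ.nonneg_normed t), ρ.integral_normed, ENNReal.ofReal_one]⟩

lemma mollify_eq_integral (ρ : ContDiffBump (0 : Plane)) (g : Plane → ℝ) (x : Plane) :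
    mollify ρ g x = ∫ t, g (x - t) ∂bumpMeasure ρ := by
  rw [mollify_apply, bumpMeasure, integral_withDensity_eq_integral_toReal_smul]
  · congr 1; ext t
    rw [ENNReal.toReal_ofReal (ρ.nonneg_normed t), smul_eq_mul]
  · exact ENNReal.measurable_ofReal.comp ρ.continuous_normed.measurable
  · exact Eventually.of_forall fun t => ENNReal.ofReal_lt_top

/-- Mollification is a contraction of `L^p`. -/
theorem eLpNorm_mollify_le (ρ : ContDiffBump (0 : Plane)) {p : ℝ≥0∞} (hp1 : 1 ≤ p) (hp : p ≠ ⊤)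
    {g : Plane → ℝ} (hg : AEStronglyMeasurable g volume) :
    eLpNorm (mollify ρ g) p volume ≤ eLpNorm g p volume := by
  wlog hm : Measurable g generalizing g
  · have e := hg.ae_eq_mk
    rw [mollify_congr ρ e, eLpNorm_congr_ae e]
    exact this hg.stronglyMeasurable_mk.aestronglyMeasurable hg.stronglyMeasurable_mk.measurable
  have hp0 : p ≠ 0 := (zero_lt_one.trans_le hp1).ne'
  have hpr : 0 < p.toReal := ENNReal.toReal_pos hp0 hp
  have hm2 : ∀ x, Measurable fun t => g (x - t) := fun x => hm.comp (by fun_prop)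
  -- Jensen's inequality, in the form that L^p norms of a probability measure increase with the
  -- exponent.
  have key : ∀ x, ‖mollify ρ g x‖ₑ ^ p.toReal ≤ ∫⁻ t, ‖g (x - t)‖ₑ ^ p.toReal ∂bumpMeasure ρ := by
    intro x
    have h1 : ‖mollify ρ g x‖ₑ ≤ eLpNorm (fun t => g (x - t)) p (bumpMeasure ρ) := by
      rw [mollify_eq_integral]
      refine (enorm_integral_le_lintegral_enorm _).trans ?_
      rw [← eLpNorm_one_eq_lintegral_enorm]
      exact eLpNorm_le_eLpNorm_of_exponent_le hp1 (hm2 x).aestronglyMeasurable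
    rw [eLpNorm_eq_lintegral_rpow_enorm_toReal hp0 hp] at h1
    calc _ ≤ _ := ENNReal.rpow_le_rpow h1 hpr.le
      _ = _ := by rw [← ENNReal.rpow_mul, one_div, inv_mul_cancel₀ hpr.ne', ENNReal.rpow_one]
  rw [eLpNorm_eq_lintegral_rpow_enorm_toReal hp0 hp, eLpNorm_eq_lintegral_rpow_enorm_toReal hp0 hp]
  refine ENNReal.rpow_le_rpow ?_ (by positivity)
  calc _ ≤ ∫⁻ x, ∫⁻ t, ‖g (x - t)‖ₑ ^ p.toReal ∂bumpMeasure ρ := lintegral_mono key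
    _ = ∫⁻ t, ∫⁻ x, ‖g (x - t)‖ₑ ^ p.toReal ∂volume ∂bumpMeasure ρ := by
        refine lintegral_lintegral_swap ?_
        have : Measurable fun q : Plane × Plane => g (q.1 - q.2) :=
          hm.comp (measurable_fst.sub measurable_snd)
        exact (this.enorm.pow_const _).aemeasurable
    _ = ∫⁻ t, ∫⁻ x, ‖g x‖ₑ ^ p.toReal ∂volume ∂bumpMeasure ρ := by
        congr 1; ext t
        exact lintegral_sub_right_eq_self (fun x => ‖g x‖ₑ ^ p.toReal) t
    _ = _ := by simp

lemma contDiff_mollify (ρ : ContDiffBump (0 : Plane)) {g : Plane → ℝ}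
    (hg : LocallyIntegrable g volume) : ContDiff ℝ ∞ (mollify ρ g) :=
  ρ.hasCompactSupport_normed.contDiff_convolution_left _ ρ.contDiff_normed hg

lemma mollify_sub (ρ : ContDiffBump (0 : Plane)) {g h : Plane → ℝ}
    (hg : LocallyIntegrable g volume) (hh : LocallyIntegrable h volume) :
    mollify ρ (g - h) = mollify ρ g - mollify ρ h := by
  ext x
  have e : ∀ {f : Plane → ℝ}, LocallyIntegrable f volume →
      Integrable (fun t => ρ.normed volume t * f (x - t)) := fun hf =>
    ρ.hasCompactSupport_normed.convolutionExists_left (ContinuousLinearMap.lsmul ℝ ℝ)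
      ρ.continuous_normed hf x
  rw [Pi.sub_apply, mollify_apply, mollify_apply, mollify_apply, ← integral_sub (e hg) (e hh)]
  congr 1; ext t; simp [mul_sub]

lemma eLpNorm_ball_le {r : ℝ} {p : ℝ≥0∞} (f : Plane → ℝ) :
    eLpNorm f p (ballMeasure r) ≤ eLpNorm f p volume := eLpNorm_mono_measure _ Measure.restrict_le_self

/-- Approximate g in L^p by a continuous h of compact support. Mollification contracts g − h and
converges uniformly on h; on a disk of finite measure uniform convergence implies L^p convergence.
-/
theorem tendsto_eLpNorm_mollify_sub {ρ : ℕ → ContDiffBump (0 : Plane)}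
    (hρ : Tendsto (fun n => (ρ n).rOut) atTop (𝓝 0)) {p : ℝ≥0∞} (hp1 : 1 ≤ p) (hp : p ≠ ⊤)
    {g : Plane → ℝ} (hg : MemLp g p volume) (r : ℝ) :
    Tendsto (fun n => eLpNorm (mollify (ρ n) g - g) p (ballMeasure r)) atTop (𝓝 0) := by
  rw [ENNReal.tendsto_nhds_zero]
  intro ε hε
  have hε3 : ε / 3 ≠ 0 := (ENNReal.div_pos hε.ne' (by simp)).ne'
  obtain ⟨h, hhc, hgh, hcont, hhm⟩ := hg.exists_hasCompactSupport_eLpNorm_sub_le hp hε3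
  have hgl := hg.locallyIntegrable hp1
  have hhl := hcont.locallyIntegrable (μ := volume)
  set V := ballMeasure r Set.univ ^ p.toReal⁻¹ with hV
  have hVt : V ≠ ⊤ := ENNReal.rpow_ne_top_of_nonneg (by positivity) (measure_ne_top _ _)
  obtain ⟨δ, hδ, hδV⟩ : ∃ δ : ℝ, 0 < δ ∧ V * ENNReal.ofReal δ ≤ ε / 3 := by
    have ht : Tendsto (fun δ : ℝ => V * ENNReal.ofReal δ) (𝓝[>] 0) (𝓝 (V * ENNReal.ofReal 0)) := by
      refine Tendsto.mono_left ?_ nhdsWithin_le_nhds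
      exact ENNReal.Tendsto.const_mul (ENNReal.continuous_ofReal.tendsto 0) (Or.inr hVt)
    rw [ENNReal.ofReal_zero, mul_zero] at ht
    have h1 := (ENNReal.tendsto_nhds_zero.1 ht) (ε / 3) (pos_iff_ne_zero.2 hε3)
    obtain ⟨δ, h2, h3⟩ := (h1.and self_mem_nhdsWithin).exists
    exact ⟨δ, h3, h2⟩
  obtain ⟨η, hη, hu⟩ := Metric.uniformContinuous_iff.1
    (hhc.uniformContinuous_of_continuous hcont) δ hδ
  have hn : ∀ᶠ n in atTop, (ρ n).rOut < η := (tendsto_order.1 hρ).2 η hη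
  filter_upwards [hn] with n hn
  have e : mollify (ρ n) g - g = mollify (ρ n) (g - h) + (mollify (ρ n) h - h) - (g - h) := by
    rw [mollify_sub _ hgl hhl]; ring
  have m1 : AEStronglyMeasurable (mollify (ρ n) (g - h)) (ballMeasure r) :=
    (contDiff_mollify _ (hgl.sub hhl)).continuous.aestronglyMeasurable
  have m2 : AEStronglyMeasurable (mollify (ρ n) h - h) (ballMeasure r) :=
    ((contDiff_mollify _ hhl).continuous.sub hcont).aestronglyMeasurable
  have m3 : AEStronglyMeasurable (g - h) (ballMeasure r) := (hg.sub hhm).1.restrict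
  have b1 : eLpNorm (mollify (ρ n) (g - h)) p (ballMeasure r) ≤ ε / 3 :=
    (eLpNorm_ball_le _).trans ((eLpNorm_mollify_le _ hp1 hp (hg.sub hhm).1).trans hgh)
  have b2 : eLpNorm (mollify (ρ n) h - h) p (ballMeasure r) ≤ ε / 3 := by
    refine (eLpNorm_le_of_ae_bound (C := δ) (Eventually.of_forall fun x => ?_)).trans hδV
    rw [Pi.sub_apply, ← dist_eq_norm]
    refine ContDiffBump.dist_normed_convolution_le hcont.aestronglyMeasurable fun y hy => ?_
    exact (hu ((Metric.mem_ball.1 hy).trans hn)).le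
  have b3 : eLpNorm (g - h) p (ballMeasure r) ≤ ε / 3 := (eLpNorm_ball_le _).trans hgh
  rw [e]
  calc _ ≤ eLpNorm (mollify (ρ n) (g - h)) p (ballMeasure r) +
        eLpNorm (mollify (ρ n) h - h) p (ballMeasure r) + eLpNorm (g - h) p (ballMeasure r) :=
        (eLpNorm_sub_le (m1.add m2) m3 hp1).trans (by gcongr; exact eLpNorm_add_le m1 m2 hp1)
    _ ≤ ε / 3 + ε / 3 + ε / 3 := by gcongr
    _ = ε := ENNReal.add_thirds ε

/-- Extension by zero outside the unit disk. -/
def extendZero (g : Plane → ℝ) : Plane → ℝ := (Metric.ball (0 : Plane) 1).indicator g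

lemma integrable_extendZero {g : Plane → ℝ} (hg : Integrable g (ballMeasure 1)) :
    Integrable (extendZero g) := (integrable_indicator_iff Metric.isOpen_ball.measurableSet).2 hg

lemma memLp_extendZero {g : Plane → ℝ} {p : ℝ≥0∞} (hg : MemLp g p (ballMeasure 1)) :
    MemLp (extendZero g) p volume := (memLp_indicator_iff_restrict Metric.isOpen_ball.measurableSet).2 hg

lemma integral_mul_extendZero (f g : Plane → ℝ) :
    ∫ x, f x * extendZero g x = ∫ x, g x * f x ∂ballMeasure 1 := by
  rw [ballMeasure, ← integral_indicator Metric.isOpen_ball.measurableSet]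
  congr 1; ext x
  by_cases hx : x ∈ Metric.ball (0 : Plane) 1
  · simp [extendZero, hx, mul_comm]
  · simp only [extendZero, Set.indicator_of_notMem hx, mul_zero]

/-- The derivative falls on the kernel, and y ↦ κ(x − y) is a test function in the unit disk as long
as its support, a ball of radius `ρ.rOut` about x, stays inside. Extension by zero is therefore
harmless away from the boundary. -/
lemma HasGradOn.partialDeriv_mollify {w : Plane → ℝ} {G : Plane → Plane} (h : HasGradOn 1 w G)
    (ρ : ContDiffBump (0 : Plane)) {x : Plane} (hx : ‖x‖ + ρ.rOut < 1) (j : Fin 2) :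
    partialDeriv j (mollify ρ (extendZero w)) x = mollify ρ (extendZero fun y => G y j) x := by
  set κ := ρ.normed volume with hκ
  have hκs : ContDiff ℝ ∞ κ := ρ.contDiff_normed
  have hw := (integrable_extendZero h.integrable).locallyIntegrable
  have h1 := ρ.hasCompactSupport_normed.hasFDerivAt_convolution_left (μ := volume)
    (ContinuousLinearMap.lsmul ℝ ℝ) (hκs.of_le (by exact_mod_cast le_top)) hw x
  have ex : ConvolutionExistsAt (fderiv ℝ κ) (extendZero w) x
      ((ContinuousLinearMap.lsmul ℝ ℝ).precompL Plane) volume :=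
    (ρ.hasCompactSupport_normed.fderiv (𝕜 := ℝ)).convolutionExists_left _
      (hκs.continuous_fderiv (by simp)) hw x
  have e1 : partialDeriv j (mollify ρ (extendZero w)) x =
      ∫ t, partialDeriv j κ t * extendZero w (x - t) := by
    rw [partialDeriv, mollify, h1.fderiv, convolution_def, ContinuousLinearMap.integral_apply ex]
    congr 1
  have test : IsTest 1 fun y => κ (x - y) := by
    refine ⟨hκs.comp (contDiff_const.sub contDiff_id), ?_, ?_⟩
    · exact ρ.hasCompactSupport_normed.comp_homeomorph (Homeomorph.subLeft x)
    · have e : tsupport (fun y => κ (x - y)) = (fun y => x - y) ⁻¹' tsupport κ :=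
        tsupport_comp_eq_preimage κ (Homeomorph.subLeft x)
      rw [e, hκ, ρ.tsupport_normed_eq]
      intro y hy
      simp only [Set.mem_preimage, Metric.mem_closedBall, dist_zero_right] at hy
      rw [mem_ball_zero_iff]
      calc ‖y‖ = ‖x - (x - y)‖ := by congr 1; abel
        _ ≤ ‖x‖ + ‖x - y‖ := norm_sub_le _ _
        _ < 1 := by linarith
  have e2 : ∀ y, partialDeriv j (fun y => κ (x - y)) y = -partialDeriv j κ (x - y) := fun y => by
    have hd : HasFDerivAt κ (fderiv ℝ κ (x - y)) (x - y) :=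
      (hκs.differentiable (by simp) (x - y)).hasFDerivAt
    have := hd.comp y ((hasFDerivAt_id y).const_sub x)
    have e := this.fderiv
    rw [partialDeriv, show (fun y => κ (x - y)) = κ ∘ HSub.hSub x from rfl, e]
    simp [partialDeriv]
  have e3 := h.integral_eq _ test j
  rw [← integral_mul_extendZero, ← integral_mul_extendZero] at e3
  simp only [e2] at e3
  rw [e1, mollify_apply, ← integral_sub_left_eq_self (fun y => partialDeriv j κ y *
    extendZero w (x - y)) volume x, ← integral_sub_left_eq_self (fun y => κ y *
    extendZero (fun y => G y j) (x - y)) volume x]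
  simp only [sub_sub_cancel, neg_mul, integral_neg] at e3 ⊢
  exact neg_injective e3

/-- Interior approximation of a Sobolev function by smooth functions. -/
theorem HasGradOn.exists_smooth_approx {w : Plane → ℝ} {G : Plane → Plane} (h : HasGradOn 1 w G)
    {p : ℝ≥0∞} (hp1 : 1 ≤ p) (hp : p ≠ ⊤) (hw : MemLp w p (ballMeasure 1))
    (hG : ∀ j : Fin 2, MemLp (fun x => G x j) p (ballMeasure 1)) {r : ℝ} (hr : r < 1) :
    ∃ f : ℕ → Plane → ℝ, (∀ n, ContDiff ℝ ∞ (f n)) ∧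
      Tendsto (fun n => eLpNorm (f n - w) p (ballMeasure r)) atTop (𝓝 0) ∧
      ∀ j : Fin 2, Tendsto (fun n => eLpNorm (partialDeriv j (f n) - fun x => G x j) p
        (ballMeasure r)) atTop (𝓝 0) := by
  let ρ : ℕ → ContDiffBump (0 : Plane) := fun n =>
    ⟨(1 - r) / (n + 3), (1 - r) / (n + 2), by have : 0 < 1 - r := by linarith
                                              positivity,
      div_lt_div_of_pos_left (by linarith) (by positivity) (by linarith)⟩
  have hρ : Tendsto (fun n => (ρ n).rOut) atTop (𝓝 0) := by
    have : Tendsto (fun n : ℕ => (1 - r) / ((n : ℝ) + 2)) atTop (𝓝 0) :=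
      tendsto_const_nhds.div_atTop (tendsto_atTop_add_const_right _ _ tendsto_natCast_atTop_atTop)
    exact this
  have hr1 : ∀ n, (ρ n).rOut < 1 - r := fun n => by
    show (1 - r) / ((n : ℝ) + 2) < 1 - r
    rw [div_lt_iff₀ (by positivity)]
    have : (0 : ℝ) ≤ n := n.cast_nonneg
    nlinarith
  have aeq : ∀ g : Plane → ℝ, ∀ᵐ x ∂ballMeasure r, extendZero g x = g x := fun g => by
    filter_upwards [ae_norm_lt r] with x hx
    exact Set.indicator_of_mem (by simpa using hx.trans hr) _
  refine ⟨fun n => mollify (ρ n) (extendZero w), fun n => contDiff_mollify _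
    (integrable_extendZero h.integrable).locallyIntegrable, ?_, fun j => ?_⟩
  · refine (tendsto_eLpNorm_mollify_sub hρ hp1 hp (memLp_extendZero hw) r).congr fun n => ?_
    refine eLpNorm_congr_ae ?_
    filter_upwards [aeq w] with x hx
    simp [hx]
  · refine (tendsto_eLpNorm_mollify_sub hρ hp1 hp (memLp_extendZero (hG j)) r).congr fun n => ?_
    refine eLpNorm_congr_ae ?_
    filter_upwards [aeq fun x => G x j, ae_norm_lt r] with x hx hxr
    have := h.partialDeriv_mollify (ρ n) (x := x) (by linarith [hr1 n]) j
    simp [hx, this]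

/-! ### Limits of integrals of products. -/

section L2

variable {α : Type*} [MeasurableSpace α] {μ : Measure α}

lemma tendsto_integral_mul_of_L2 {f g : ℕ → α → ℝ} {f₀ g₀ : α → ℝ}
    (hf : ∀ n, MemLp (f n) 2 μ) (hf₀ : MemLp f₀ 2 μ) (hg : ∀ n, MemLp (g n) 2 μ)
    (hg₀ : MemLp g₀ 2 μ) (h1 : Tendsto (fun n => eLpNorm (f n - f₀) 2 μ) atTop (𝓝 0))
    (h2 : Tendsto (fun n => eLpNorm (g n - g₀) 2 μ) atTop (𝓝 0)) :
    Tendsto (fun n => ∫ x, f n x * g n x ∂μ) atTop (𝓝 (∫ x, f₀ x * g₀ x ∂μ)) := by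
  have t1 := (Lp.tendsto_Lp_iff_tendsto_eLpNorm'' f hf f₀ hf₀).2 h1
  have t2 := (Lp.tendsto_Lp_iff_tendsto_eLpNorm'' g hg g₀ hg₀).2 h2
  have e : ∀ {u v : α → ℝ} (hu : MemLp u 2 μ) (hv : MemLp v 2 μ),
      inner ℝ hu.toLp hv.toLp = ∫ x, u x * v x ∂μ := fun {u v} hu hv => by
    rw [L2.inner_def]
    refine integral_congr_ae ?_
    filter_upwards [hu.coeFn_toLp, hv.coeFn_toLp] with x h1 h2
    rw [h1, h2]; simp [mul_comm]
  have := t1.inner (𝕜 := ℝ) t2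
  simpa only [e] using this

lemma MemLp.mul_of_bound {p : ℝ≥0∞} {a f : α → ℝ} {b : ℝ} (ha : AEStronglyMeasurable a μ)
    (hb : ∀ᵐ x ∂μ, |a x| ≤ b) (hf : MemLp f p μ) : MemLp (fun x => a x * f x) p μ := by
  refine hf.of_le_mul (c := b) (ha.mul hf.1) ?_
  filter_upwards [hb] with x hx
  rw [Real.norm_eq_abs, abs_mul]
  exact mul_le_mul_of_nonneg_right hx (abs_nonneg _)

lemma tendsto_eLpNorm_mul_of_bound {p : ℝ≥0∞} {a : α → ℝ} {f : ℕ → α → ℝ} {f₀ : α → ℝ} {b : ℝ}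
    (hb : ∀ᵐ x ∂μ, |a x| ≤ b) (h1 : Tendsto (fun n => eLpNorm (f n - f₀) p μ) atTop (𝓝 0)) :
    Tendsto (fun n => eLpNorm ((fun x => a x * f n x) - fun x => a x * f₀ x) p μ) atTop (𝓝 0) := by
  have h : ∀ n, eLpNorm ((fun x => a x * f n x) - fun x => a x * f₀ x) p μ ≤
      ENNReal.ofReal b * eLpNorm (f n - f₀) p μ := fun n => by
    refine eLpNorm_le_mul_eLpNorm_of_ae_le_mul ?_ p
    filter_upwards [hb] with x hx
    rw [Pi.sub_apply, Pi.sub_apply, ← mul_sub, norm_mul]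
    exact mul_le_mul_of_nonneg_right hx (norm_nonneg _)
  refine tendsto_of_tendsto_of_tendsto_of_le_of_le tendsto_const_nhds ?_ (fun _ => zero_le) h
  simpa using ENNReal.Tendsto.const_mul h1 (Or.inr ENNReal.ofReal_ne_top)

lemma tendsto_integral_mul_of_L1 {f : ℕ → α → ℝ} {f₀ : α → ℝ} {a : α → ℝ} {b : ℝ}
    (ha : AEStronglyMeasurable a μ) (hb : ∀ᵐ x ∂μ, |a x| ≤ b) (hf : ∀ n, Integrable (f n) μ)
    (hf₀ : Integrable f₀ μ) (h1 : Tendsto (fun n => eLpNorm (f n - f₀) 1 μ) atTop (𝓝 0)) :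
    Tendsto (fun n => ∫ x, a x * f n x ∂μ) atTop (𝓝 (∫ x, a x * f₀ x ∂μ)) :=
  tendsto_integral_of_L1' _ (ha.mul hf₀.1) (Eventually.of_forall fun n => (hf n).bdd_mul ha hb)
    (tendsto_eLpNorm_mul_of_bound hb h1)

end L2

/-! ### Chain rule, density and Sobolev embedding. -/

lemma IsTest.exists_lt {ψ : Plane → ℝ} (h : IsTest 1 ψ) : ∃ r, 0 < r ∧ r < 1 ∧ IsTest r ψ := by
  obtain ⟨r, hr, hs⟩ := exists_pos_lt_subset_ball one_pos (isClosed_tsupport ψ) h.support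
  exact ⟨r, hr.1, hr.2, h.smooth, h.compact, hs⟩

lemma IsTest.integral_eq {r s : ℝ} {ψ : Plane → ℝ} (h : IsTest r ψ) (hrs : r ≤ s)
    (f : Plane → ℝ) : ∫ x, f x * ψ x ∂ballMeasure s = ∫ x, f x * ψ x ∂ballMeasure r := by
  rw [integral_ball_eq fun x hx => by rw [h.eq_zero (hrs.trans hx), mul_zero],
    integral_ball_eq fun x hx => by rw [h.eq_zero hx, mul_zero]]

lemma ballMeasure_mono {r s : ℝ} (h : r ≤ s) : ballMeasure r ≤ ballMeasure s :=
  Measure.restrict_mono (Metric.ball_subset_ball h) le_rfl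

lemma ae_ball_mono {r s : ℝ} (h : r ≤ s) {P : Plane → Prop} (hP : ∀ᵐ x ∂ballMeasure s, P x) :
    ∀ᵐ x ∂ballMeasure r, P x := (Measure.absolutelyContinuous_of_le (ballMeasure_mono h)).ae_le hP

lemma integral_partialDeriv_of_contDiff {r : ℝ} {w ψ : Plane → ℝ} (hw : ContDiff ℝ ∞ w)
    (hψ : IsTest r ψ) (j : Fin 2) : ∫ x, w x * partialDeriv j ψ x ∂ballMeasure r =
      -∫ x, partialDeriv j w x * ψ x ∂ballMeasure r := by
  have ic : ∀ {f : Plane → ℝ}, IsTest r f → Integrable f := fun hf =>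
    hf.smooth.continuous.integrable_of_hasCompactSupport hf.compact
  rw [integral_ball_eq fun x hx => by rw [(hψ.isTest_partialDeriv j).eq_zero hx, mul_zero],
    integral_ball_eq fun x hx => by rw [hψ.eq_zero hx, mul_zero]]
  exact integral_mul_fderiv_eq_neg_fderiv_mul_of_integrable
    (ic (hψ.mul_left (contDiff_partialDeriv hw j))) (ic ((hψ.isTest_partialDeriv j).mul_left hw))
    (ic (hψ.mul_left hw)) (fun x _ => hw.differentiable (by simp) x)
    (fun x _ => hψ.smooth.differentiable (by simp) x)

lemma aestronglyMeasurable_of_continuous {f : Plane → ℝ} (hf : Continuous f) (r : ℝ) :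
    AEStronglyMeasurable f (ballMeasure r) := hf.aestronglyMeasurable

lemma ae_bound_on_ball {f : Plane → ℝ} (hf : Continuous f) (r : ℝ) :
    ∃ C, ∀ᵐ x ∂ballMeasure r, |f x| ≤ C := by
  obtain ⟨C, -, hC⟩ := exists_bound_on_ball hf r
  exact ⟨C, by filter_upwards [ae_norm_lt r] with x hx using hC x hx.le⟩

/-- The chain rule for a smooth function with derivative bounded by one. -/
theorem HasGradOn.comp {lam : Plane → ℝ} {G : Plane → Plane} (h : HasGradOn 1 lam G)
    {F : ℝ → ℝ} (hF : ContDiff ℝ ∞ F) (hF' : ∀ s, |deriv F s| ≤ 1) :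
    HasGradOn 1 (fun x => F (lam x)) (fun x => deriv F (lam x) • G x) := by
  have hFd : Differentiable ℝ F := hF.differentiable (by simp)
  have hF1 : Continuous (deriv F) := hF.continuous_deriv (by simp)
  have hlip : ∀ a b, |F a - F b| ≤ |a - b| := fun a b => by
    have := convex_univ.norm_image_sub_le_of_norm_deriv_le (f := F) (C := 1) (x := b) (y := a)
      (fun x _ => hFd x) (fun x _ => hF' x) trivial trivial
    simpa using this
  have hmd : AEStronglyMeasurable (fun x => deriv F (lam x)) (ballMeasure 1) :=
    hF1.comp_aestronglyMeasurable h.integrable.1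
  refine ⟨?_, ?_, fun ψ hψ1 j => ?_⟩
  · refine ((integrable_const |F 0|).add h.integrable.norm).mono'
      (hF.continuous.comp_aestronglyMeasurable h.integrable.1) (Eventually.of_forall fun x => ?_)
    have := hlip (lam x) 0
    rw [sub_zero] at this
    simp only [Real.norm_eq_abs, Pi.add_apply]
    linarith [abs_sub_abs_le_abs_sub (F (lam x)) (F 0)]
  · refine h.integrable_grad.norm.mono' (hmd.smul h.integrable_grad.1) (Eventually.of_forall fun x => ?_)
    rw [norm_smul]
    exact mul_le_of_le_one_left (norm_nonneg _) (hF' _)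
  obtain ⟨r, hr0, hr, hψ⟩ := hψ1.exists_lt
  have hint : Integrable lam (ballMeasure r) := h.integrable.mono_measure (ballMeasure_mono hr.le)
  have hG : ∀ j, Integrable (fun x => G x j) (ballMeasure r) := fun j =>
    (integrable_coord h.integrable_grad j).mono_measure (ballMeasure_mono hr.le)
  obtain ⟨f₀, hf₀, hfl₀, hfg₀⟩ := h.exists_smooth_approx le_rfl ENNReal.one_ne_top
    (memLp_one_iff_integrable.2 h.integrable)
    (fun j => memLp_one_iff_integrable.2 (integrable_coord h.integrable_grad j)) hr
  -- An almost everywhere convergent subsequence is required for F'(fₙ) → F'(λ), since F' is only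
  -- bounded and continuous in this argument.
  obtain ⟨ns, hns, hae⟩ := (tendstoInMeasure_of_tendsto_eLpNorm one_ne_zero
    (fun n => (hf₀ n).continuous.aestronglyMeasurable) hint.1 hfl₀).exists_seq_tendsto_ae
  set f : ℕ → Plane → ℝ := fun n => f₀ (ns n)
  have hf : ∀ n, ContDiff ℝ ∞ (f n) := fun n => hf₀ _
  have hfl : Tendsto (fun n => eLpNorm (f n - lam) 1 (ballMeasure r)) atTop (𝓝 0) :=
    hfl₀.comp hns.tendsto_atTop
  have hfg : Tendsto (fun n => eLpNorm (partialDeriv j (f n) - fun x => G x j) 1 (ballMeasure r))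
      atTop (𝓝 0) := (hfg₀ j).comp hns.tendsto_atTop
  have hψc := hψ.smooth.continuous
  have hψjc := (contDiff_partialDeriv hψ.smooth j).continuous
  have cont1 : ∀ n, Continuous fun x => F (f n x) := fun n => hF.continuous.comp (hf n).continuous
  have cont2 : ∀ n, Continuous fun x => deriv F (f n x) := fun n => hF1.comp (hf n).continuous
  have cont3 : ∀ n, Continuous (partialDeriv j (f n)) := fun n =>
    (contDiff_partialDeriv (hf n) j).continuous
  -- Write F'(fₙ)∂fₙ = F'(fₙ)(∂fₙ − G) + F'(fₙ)G: the first part tends to zero in L¹ because |F'| ≤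
  -- 1, the second converges by domination.
  have e : ∀ n, ∫ x, partialDeriv j ψ x * F (f n x) ∂ballMeasure r =
      -(∫ x, ψ x * (deriv F (f n x) * (partialDeriv j (f n) x - G x j)) ∂ballMeasure r +
        ∫ x, ψ x * (deriv F (f n x) * G x j) ∂ballMeasure r) := fun n => by
    have := integral_partialDeriv_of_contDiff (hF.comp (hf n)) hψ j
    have e1 : ∀ x, partialDeriv j (F ∘ f n) x = deriv F (f n x) * partialDeriv j (f n) x := fun x => by
      have h1 := (hFd (f n x)).hasDerivAt.comp_hasFDerivAt x
        ((hf n).differentiable (by simp) x).hasFDerivAt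
      rw [partialDeriv, h1.fderiv]; simp [partialDeriv]
    simp only [e1, Function.comp_apply] at this
    rw [← integral_add]
    · calc _ = _ := by congr 1; ext x; rw [mul_comm]
        _ = _ := this
        _ = _ := by congr 2; ext x; ring
    · have i1 := integrable_mul_continuous (integrable_ball (cont3 n) r) ((cont2 n).mul hψc)
      have i2 := integrable_mul_continuous (hG j) ((cont2 n).mul hψc)
      refine (i1.sub i2).congr (Eventually.of_forall fun x => ?_)
      simp; ring
    · refine (integrable_mul_continuous (hG j) ((cont2 n).mul hψc)).congr
        (Eventually.of_forall fun x => ?_)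
      simp; ring
  have hm0 : AEStronglyMeasurable lam (ballMeasure r) := hint.1
  have l1 : Tendsto (fun n => ∫ x, partialDeriv j ψ x * F (f n x) ∂ballMeasure r) atTop
      (𝓝 (∫ x, partialDeriv j ψ x * F (lam x) ∂ballMeasure r)) := by
    obtain ⟨C, hC⟩ := ae_bound_on_ball hψjc r
    refine tendsto_integral_mul_of_L1 (aestronglyMeasurable_of_continuous hψjc r) hC
      (fun n => integrable_ball (cont1 n) r) ?_ ?_
    · refine ((integrable_const |F 0|).add hint.norm).mono'
        (hF.continuous.comp_aestronglyMeasurable hint.1) (Eventually.of_forall fun x => ?_)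
      have := hlip (lam x) 0
      rw [sub_zero] at this
      simp only [Real.norm_eq_abs, Pi.add_apply]
      linarith [abs_sub_abs_le_abs_sub (F (lam x)) (F 0)]
    · refine tendsto_of_tendsto_of_tendsto_of_le_of_le tendsto_const_nhds hfl (fun _ => zero_le)
        fun n => eLpNorm_mono fun x => hlip _ _
  obtain ⟨C, hC⟩ := ae_bound_on_ball hψc r
  have l2 : Tendsto (fun n => ∫ x, ψ x * (deriv F (f n x) * (partialDeriv j (f n) x - G x j))
      ∂ballMeasure r) atTop (𝓝 (∫ x, ψ x * 0 ∂ballMeasure r)) := by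
    refine tendsto_integral_mul_of_L1 (aestronglyMeasurable_of_continuous hψc r) hC
      (fun n => ?_) (integrable_zero _ _ _) ?_
    · refine (integrable_mul_continuous ((integrable_ball (cont3 n) r).sub (hG j)) (cont2 n)).congr
        (Eventually.of_forall fun x => ?_)
      simp; ring
    · refine tendsto_of_tendsto_of_tendsto_of_le_of_le tendsto_const_nhds hfg (fun _ => zero_le)
        fun n => eLpNorm_mono fun x => ?_
      simp only [Pi.sub_apply, sub_zero, norm_mul]
      exact mul_le_of_le_one_left (norm_nonneg _) (hF' _)
  have l3 : Tendsto (fun n => ∫ x, ψ x * (deriv F (f n x) * G x j) ∂ballMeasure r) atTop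
      (𝓝 (∫ x, ψ x * (deriv F (lam x) * G x j) ∂ballMeasure r)) := by
    refine tendsto_integral_of_dominated_convergence (fun x => C * |G x j|) (fun n => ?_)
      ((hG j).abs.const_mul C) (fun n => ?_) ?_
    · exact hψc.aestronglyMeasurable.mul ((cont2 n).aestronglyMeasurable.mul (hG j).1)
    · filter_upwards [hC] with x hx
      rw [norm_mul, norm_mul]
      gcongr
      · exact (abs_nonneg _).trans hx
      · exact hx
      · exact mul_le_of_le_one_left (norm_nonneg _) (hF' _)
    · filter_upwards [hae] with x hx
      exact ((hF1.continuousAt.tendsto.comp hx).mul_const _).const_mul _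
  simp only [e] at l1
  have := tendsto_nhds_unique l1 (l2.add l3).neg
  simp only [mul_zero, integral_zero, zero_add] at this
  rw [(hψ.isTest_partialDeriv j).integral_eq hr.le, hψ.integral_eq hr.le]
  simp only [PiLp.smul_apply, smul_eq_mul]
  calc _ = _ := by congr 1; ext x; rw [mul_comm]
    _ = _ := this
    _ = _ := by congr 2; ext x; rw [mul_comm]

/-- The energy bound extended to Sobolev functions, for bounded multipliers. -/
theorem JacBound.abs_le_of_hasGradOn {ν r b : ℝ} (hν : 0 ≤ ν) (hr : r < 1) {lam w : Plane → ℝ}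
    {G : Plane → Plane} (h : JacBound ν r lam) (hm : AEStronglyMeasurable lam (ballMeasure r))
    (hb : ∀ᵐ x ∂ballMeasure r, |lam x| ≤ b) (hw : HasGradOn 1 w G)
    (hw2 : MemLp w 2 (ballMeasure 1)) (hG : ∀ j : Fin 2, MemLp (fun x => G x j) 2 (ballMeasure 1))
    {φ : Plane → ℝ} (hφ : IsTest r φ) :
    |∫ x, lam x * (G x 0 * partialDeriv 1 φ x - G x 1 * partialDeriv 0 φ x) ∂ballMeasure r| ≤
      ν * (√(∫ x, (G x 0 ^ 2 + G x 1 ^ 2) ∂ballMeasure r) * √(dirichlet r φ)) := by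
  obtain ⟨f, hf, -, hfg⟩ := hw.exists_smooth_approx (by norm_num) ENNReal.ofNat_ne_top hw2 hG hr
  have hGr : ∀ j : Fin 2, MemLp (fun x => G x j) 2 (ballMeasure r) := fun j =>
    (hG j).mono_measure (ballMeasure_mono hr.le)
  have hfm : ∀ (j : Fin 2) n, MemLp (partialDeriv j (f n)) 2 (ballMeasure r) := fun j n =>
    memLp_ball (contDiff_partialDeriv (hf n) j).continuous r 2
  have hφm : ∀ j : Fin 2, MemLp (fun x => lam x * partialDeriv j φ x) 2 (ballMeasure r) := fun j =>
    MemLp.mul_of_bound hm hb (memLp_ball (contDiff_partialDeriv hφ.smooth j).continuous r 2)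
  have hz : ∀ g : Plane → ℝ, Tendsto (fun _ : ℕ => eLpNorm (g - g) 2 (ballMeasure r)) atTop (𝓝 0) :=
    fun g => by simp
  have s1 : ∀ i j : Fin 2, Tendsto (fun n => ∫ x, partialDeriv i (f n) x *
      (lam x * partialDeriv j φ x) ∂ballMeasure r) atTop
      (𝓝 (∫ x, G x i * (lam x * partialDeriv j φ x) ∂ballMeasure r)) := fun i j =>
    tendsto_integral_mul_of_L2 (hfm i) (hGr i) (fun _ => hφm j) (hφm j) (hfg i) (hz _)
  have s2 : ∀ i : Fin 2, Tendsto (fun n => ∫ x, partialDeriv i (f n) x * partialDeriv i (f n) x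
      ∂ballMeasure r) atTop (𝓝 (∫ x, G x i * G x i ∂ballMeasure r)) := fun i =>
    tendsto_integral_mul_of_L2 (hfm i) (hGr i) (hfm i) (hGr i) (hfg i) (hfg i)
  have i1 : ∀ {u v : Plane → ℝ}, MemLp u 2 (ballMeasure r) → MemLp v 2 (ballMeasure r) →
      Integrable (fun x => u x * v x) (ballMeasure r) := fun hu hv => hu.integrable_mul hv
  have e1 : ∀ n, ∫ x, lam x * jac (f n) φ x ∂ballMeasure r =
      ∫ x, partialDeriv 0 (f n) x * (lam x * partialDeriv 1 φ x) ∂ballMeasure r -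
      ∫ x, partialDeriv 1 (f n) x * (lam x * partialDeriv 0 φ x) ∂ballMeasure r := fun n => by
    rw [← integral_sub (i1 (hfm 0 n) (hφm 1)) (i1 (hfm 1 n) (hφm 0))]
    congr 1; ext x; rw [jac]; ring
  have e2 : ∫ x, lam x * (G x 0 * partialDeriv 1 φ x - G x 1 * partialDeriv 0 φ x) ∂ballMeasure r =
      ∫ x, G x 0 * (lam x * partialDeriv 1 φ x) ∂ballMeasure r -
      ∫ x, G x 1 * (lam x * partialDeriv 0 φ x) ∂ballMeasure r := by
    rw [← integral_sub (i1 (hGr 0) (hφm 1)) (i1 (hGr 1) (hφm 0))]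
    congr 1; ext x; ring
  have e3 : ∀ n, dirichlet r (f n) =
      ∫ x, partialDeriv 0 (f n) x * partialDeriv 0 (f n) x ∂ballMeasure r +
      ∫ x, partialDeriv 1 (f n) x * partialDeriv 1 (f n) x ∂ballMeasure r := fun n => by
    rw [← integral_add (i1 (hfm 0 n) (hfm 0 n)) (i1 (hfm 1 n) (hfm 1 n)), dirichlet]
    congr 1; ext x; ring
  have e4 : ∫ x, (G x 0 ^ 2 + G x 1 ^ 2) ∂ballMeasure r =
      ∫ x, G x 0 * G x 0 ∂ballMeasure r + ∫ x, G x 1 * G x 1 ∂ballMeasure r := by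
    rw [← integral_add (i1 (hGr 0) (hGr 0)) (i1 (hGr 1) (hGr 1))]
    congr 1; ext x; ring
  rw [e2, e4]
  refine le_of_tendsto_of_tendsto ((s1 0 1).sub (s1 1 0)).abs
    (((((s2 0).add (s2 1)).sqrt).mul_const (√(dirichlet r φ))).const_mul ν)
    (Eventually.of_forall fun n => ?_)
  have := h.abs_le hν (hf n) hφ
  rwa [e1, e3] at this

lemma norm_fderiv_le (f : Plane → ℝ) (x : Plane) :
    ‖fderiv ℝ f x‖ ≤ |partialDeriv 0 f x| + |partialDeriv 1 f x| := by
  refine ContinuousLinearMap.opNorm_le_bound _ (by positivity) fun y => ?_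
  have h0 : |y 0| ≤ ‖y‖ := PiLp.norm_apply_le y 0
  have h1 : |y 1| ≤ ‖y‖ := PiLp.norm_apply_le y 1
  rw [fderiv_apply_eq, Real.norm_eq_abs, add_mul]
  refine (abs_add_le _ _).trans ?_
  rw [abs_mul, abs_mul]
  nlinarith [mul_le_mul_of_nonneg_left h0 (abs_nonneg (partialDeriv 0 f x)),
    mul_le_mul_of_nonneg_left h1 (abs_nonneg (partialDeriv 1 f x))]

/-- The Gagliardo–Nirenberg–Sobolev inequality in the interior of a disk. -/
lemma exists_eLpNorm_two_le {r s : ℝ} (hr : 0 < r) (hrs : r < s) :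
    ∃ C : ℝ≥0∞, C ≠ ⊤ ∧ ∀ f : Plane → ℝ, ContDiff ℝ ∞ f → eLpNorm f 2 (ballMeasure r) ≤
      C * (eLpNorm f 1 (ballMeasure s) + (eLpNorm (partialDeriv 0 f) 1 (ballMeasure s) +
        eLpNorm (partialDeriv 1 f) 1 (ballMeasure s))) := by
  -- A cutoff equal to one on the smaller disk and supported in the larger; the inequality for
  -- compactly supported functions is applied to ζf.
  let ζ : ContDiffBump (0 : Plane) := ⟨r, (r + s) / 2, hr, by linarith⟩
  have hζ : IsTest s ζ := ⟨ζ.contDiff, ζ.hasCompactSupport, by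
    rw [ζ.tsupport_eq]; exact Metric.closedBall_subset_ball (by show (r + s) / 2 < s; linarith)⟩
  obtain ⟨B0, hB0⟩ := exists_bound_on_ball (contDiff_partialDeriv hζ.smooth 0).continuous s
  obtain ⟨B1, hB1⟩ := exists_bound_on_ball (contDiff_partialDeriv hζ.smooth 1).continuous s
  -- The Sobolev exponent n/(n − 1) is 2 in dimension n = 2.
  have hfin : NNReal.HolderConjugate (Module.finrank ℝ Plane) 2 := by
    simp only [finrank_euclideanSpace, Fintype.card_fin]
    rw [NNReal.holderConjugate_iff]
    norm_num
  set D := |B0| + |B1| + 1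
  refine ⟨eLpNormLESNormFDerivOneConst (volume : Measure Plane) 2 * ENNReal.ofReal D,
    ENNReal.mul_ne_top ENNReal.coe_ne_top ENNReal.ofReal_ne_top, fun f hf => ?_⟩
  have hg : IsTest s (fun x => ζ x * f x) := hζ.mul_right hf
  have h1 : eLpNorm f 2 (ballMeasure r) ≤ eLpNorm (fun x => ζ x * f x) 2 volume := by
    refine (eLpNorm_congr_ae ?_).trans_le (eLpNorm_mono_measure _ Measure.restrict_le_self)
    filter_upwards [ae_norm_lt r] with x hx
    rw [ζ.one_of_mem_closedBall (mem_closedBall_zero_iff.2 hx.le), one_mul]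
  have h2 := eLpNorm_le_eLpNorm_fderiv_one (volume : Measure Plane)
    (hg.smooth.of_le (by simp)) hg.compact hfin
  rw [ENNReal.coe_ofNat] at h2
  have h3 : eLpNorm (fderiv ℝ fun x => ζ x * f x) 1 volume =
      eLpNorm (fderiv ℝ fun x => ζ x * f x) 1 (ballMeasure s) := by
    have hs : Function.support (fun y => ‖fderiv ℝ (fun x => ζ x * f x) y‖) ⊆ Metric.ball 0 s :=
      fun y hy => hg.support (support_fderiv_subset ℝ fun h0 => hy (by simp only [h0, norm_zero]))
    rw [← eLpNorm_norm, ballMeasure, ← eLpNorm_norm (fderiv ℝ _),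
      eLpNorm_restrict_eq_of_support_subset hs]
  have h4 : eLpNorm (fderiv ℝ fun x => ζ x * f x) 1 (ballMeasure s) ≤ ENNReal.ofReal D *
      eLpNorm (fun x => |f x| + (|partialDeriv 0 f x| + |partialDeriv 1 f x|)) 1
        (ballMeasure s) := by
    refine eLpNorm_le_mul_eLpNorm_of_ae_le_mul ?_ 1
    filter_upwards [ae_norm_lt s] with x hx
    refine (norm_fderiv_le _ x).trans ?_
    rw [partialDeriv_mul ζ.contDiff hf, partialDeriv_mul ζ.contDiff hf,
      Real.norm_of_nonneg (by positivity)]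
    have b0 := (hB0.2 x hx.le).trans (le_abs_self _)
    have b1 := (hB1.2 x hx.le).trans (le_abs_self _)
    have z1 : |ζ x| ≤ 1 := by rw [abs_of_nonneg ζ.nonneg]; exact ζ.le_one
    have a0 := abs_add_le (ζ x * partialDeriv 0 f x) (partialDeriv 0 ζ x * f x)
    have a1 := abs_add_le (ζ x * partialDeriv 1 f x) (partialDeriv 1 ζ x * f x)
    simp only [abs_mul] at a0 a1
    have m0 := mul_le_mul_of_nonneg_right b0 (abs_nonneg (f x))
    have m1 := mul_le_mul_of_nonneg_right b1 (abs_nonneg (f x))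
    have m2 := mul_le_mul_of_nonneg_right z1 (abs_nonneg (partialDeriv 0 f x))
    have m3 := mul_le_mul_of_nonneg_right z1 (abs_nonneg (partialDeriv 1 f x))
    have p0 : 0 ≤ (|B0| + |B1|) * (|partialDeriv 0 f x| + |partialDeriv 1 f x|) := by positivity
    have p1 := abs_nonneg (f x)
    show _ ≤ (|B0| + |B1| + 1) * _
    linarith
  have h5 : eLpNorm (fun x => |f x| + (|partialDeriv 0 f x| + |partialDeriv 1 f x|)) 1
      (ballMeasure s) ≤ eLpNorm f 1 (ballMeasure s) + (eLpNorm (partialDeriv 0 f) 1 (ballMeasure s) +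
        eLpNorm (partialDeriv 1 f) 1 (ballMeasure s)) := by
    have c := hf.continuous
    have c0 := (contDiff_partialDeriv hf 0).continuous
    have c1 := (contDiff_partialDeriv hf 1).continuous
    have e : ∀ g : Plane → ℝ, eLpNorm (fun x => |g x|) 1 (ballMeasure s) =
      eLpNorm g 1 (ballMeasure s) := fun g => eLpNorm_norm g
    rw [← e f, ← e (partialDeriv 0 f), ← e (partialDeriv 1 f)]
    refine (eLpNorm_add_le c.abs.aestronglyMeasurable (c0.abs.add c1.abs).aestronglyMeasurable
      le_rfl).trans (add_le_add le_rfl ?_)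
    exact eLpNorm_add_le c0.abs.aestronglyMeasurable c1.abs.aestronglyMeasurable le_rfl
  rw [h3] at h2
  have h6 := mul_le_mul_right (h4.trans (mul_le_mul_right h5 (ENNReal.ofReal D)))
    (eLpNormLESNormFDerivOneConst (volume : Measure Plane) 2 : ℝ≥0∞)
  rw [← mul_assoc] at h6
  exact (h1.trans h2).trans h6

/-- The Sobolev embedding `W^{1,1} ⊂ L²_loc` in the plane. -/
theorem HasGradOn.memLp_two {w : Plane → ℝ} {G : Plane → Plane} (h : HasGradOn 1 w G) {r : ℝ}
    (hr0 : 0 < r) (hr : r < 1) : MemLp w 2 (ballMeasure r) := by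
  set s := (1 + r) / 2
  have hrs : r < s := by simp only [s]; linarith
  have hs : s < 1 := by simp only [s]; linarith
  obtain ⟨C, hC, hb⟩ := exists_eLpNorm_two_le hr0 hrs
  have hG1 : ∀ j, Integrable (fun x => G x j) (ballMeasure s) := fun j =>
    (integrable_coord h.integrable_grad j).mono_measure (ballMeasure_mono hs.le)
  have hw1 := h.integrable.mono_measure (ballMeasure_mono hs.le)
  obtain ⟨f, hf, hfl, hfg⟩ := h.exists_smooth_approx le_rfl ENNReal.one_ne_top
    (memLp_one_iff_integrable.2 h.integrable)
    (fun j => memLp_one_iff_integrable.2 (integrable_coord h.integrable_grad j)) hs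
  have hfl' : Tendsto (fun n => eLpNorm (f n - w) 1 (ballMeasure r)) atTop (𝓝 0) :=
    tendsto_of_tendsto_of_tendsto_of_le_of_le tendsto_const_nhds hfl (fun _ => zero_le)
      fun n => eLpNorm_mono_measure _ (ballMeasure_mono hrs.le)
  have hm : AEStronglyMeasurable w (ballMeasure r) :=
    h.integrable.1.mono_measure (ballMeasure_mono hr.le)
  obtain ⟨ns, hns, hae⟩ := (tendstoInMeasure_of_tendsto_eLpNorm one_ne_zero
    (fun n => (hf n).continuous.aestronglyMeasurable) hm hfl').exists_seq_tendsto_ae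
  -- Fatou's lemma: the L² norms of the approximations are eventually bounded, because their W^{1,1}
  -- norms are.
  refine ⟨hm, (Lp.eLpNorm_lim_le_liminf_eLpNorm
    (fun n => (hf (ns n)).continuous.aestronglyMeasurable) w hae).trans_lt ?_⟩
  have bd : ∀ {g : ℕ → Plane → ℝ} {g₀ : Plane → ℝ}, (∀ n, Continuous (g n)) →
      Integrable g₀ (ballMeasure s) →
      Tendsto (fun n => eLpNorm (g n - g₀) 1 (ballMeasure s)) atTop (𝓝 0) →
      ∀ᶠ n in atTop, eLpNorm (g n) 1 (ballMeasure s) ≤ 1 + eLpNorm g₀ 1 (ballMeasure s) :=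
    fun {g g₀} hg hg₀ ht => by
      filter_upwards [ht.eventually_le_const (zero_lt_one)] with n hn
      calc _ = eLpNorm ((g n - g₀) + g₀) 1 (ballMeasure s) := by rw [sub_add_cancel]
        _ ≤ _ := eLpNorm_add_le ((hg n).aestronglyMeasurable.sub hg₀.1) hg₀.1 le_rfl
        _ ≤ _ := by gcongr
  have key := ((bd (fun n => (hf n).continuous) hw1 hfl).and
    ((bd (fun n => (contDiff_partialDeriv (hf n) 0).continuous) (hG1 0) (hfg 0)).and
    (bd (fun n => (contDiff_partialDeriv (hf n) 1).continuous) (hG1 1) (hfg 1))))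
  have fin : ∀ {g : Plane → ℝ}, Integrable g (ballMeasure s) →
    1 + eLpNorm g 1 (ballMeasure s) ≠ ⊤ := fun hg =>
      ENNReal.add_ne_top.2 ⟨ENNReal.one_ne_top, (memLp_one_iff_integrable.2 hg).2.ne⟩
  refine lt_of_le_of_lt (b := C * ((1 + eLpNorm w 1 (ballMeasure s)) +
    ((1 + eLpNorm (fun x => G x 0) 1 (ballMeasure s)) +
      (1 + eLpNorm (fun x => G x 1) 1 (ballMeasure s))))) ?_
    (ENNReal.mul_ne_top hC (ENNReal.add_ne_top.2 ⟨fin hw1,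
      ENNReal.add_ne_top.2 ⟨fin (hG1 0), fin (hG1 1)⟩⟩)).lt_top
  refine liminf_le_of_frequently_le' (Eventually.frequently ?_)
  filter_upwards [hns.tendsto_atTop.eventually key] with n hn
  refine (hb _ (hf _)).trans ?_
  gcongr
  exacts [hn.1, hn.2.1, hn.2.2]

/-! ### Truncated multipliers. -/

/-- A smooth bounded truncation. -/
def truncate (k s : ℝ) : ℝ := k * Real.arctan (s / k)

lemma contDiff_truncate (k : ℝ) : ContDiff ℝ ∞ (truncate k) :=
  contDiff_const.mul (Real.contDiff_arctan.comp (contDiff_id.div_const k))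

lemma deriv_truncate {k : ℝ} (hk : 0 < k) (s : ℝ) : deriv (truncate k) s = 1 / (1 + (s / k) ^ 2) := by
  have h := ((Real.hasDerivAt_arctan (s / k)).comp s ((hasDerivAt_id s).div_const k)).const_mul k
  have : deriv (truncate k) s = _ := h.deriv
  rw [this]; field_simp

lemma abs_deriv_truncate_le {k : ℝ} (hk : 0 < k) (s : ℝ) : |deriv (truncate k) s| ≤ 1 := by
  rw [deriv_truncate hk, abs_of_nonneg (by positivity), div_le_one (by positivity)]
  nlinarith [sq_nonneg (s / k)]

lemma abs_truncate_le {k : ℝ} (hk : 0 < k) (s : ℝ) : |truncate k s| ≤ k * (Real.pi / 2) := by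
  rw [truncate, abs_mul, abs_of_pos hk]
  exact mul_le_mul_of_nonneg_left (abs_le.2 ⟨(Real.neg_pi_div_two_lt_arctan _).le,
    (Real.arctan_lt_pi_div_two _).le⟩) hk.le

lemma abs_truncate_le_abs {k : ℝ} (hk : 0 < k) (s : ℝ) : |truncate k s| ≤ |s| := by
  have := convex_univ.norm_image_sub_le_of_norm_deriv_le (f := truncate k) (C := 1) (x := 0) (y := s)
      (fun x _ => (contDiff_truncate k).differentiable (by simp) x)
      (fun x _ => abs_deriv_truncate_le hk x) trivial trivial
  simpa [truncate] using this

/-- The truncation at level k is the difference quotient of t ↦ arctan(ts) at 0 with step 1/k;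
levels start at 1 so that the step is defined. -/
lemma tendsto_truncate (s : ℝ) : Tendsto (fun n : ℕ => truncate (n + 1) s) atTop (𝓝 s) := by
  have h := (Real.hasDerivAt_arctan (0 : ℝ))
  have h2 : HasDerivAt (fun t : ℝ => Real.arctan (t * s)) s 0 := by
    have h := (Real.hasDerivAt_arctan (0 * s)).comp (0 : ℝ) ((hasDerivAt_id (0 : ℝ)).mul_const s)
    simpa [Function.comp_def] using h
  have h3 := h2.tendsto_slope_zero
  have h4 : Tendsto (fun n : ℕ => 1 / ((n : ℝ) + 1)) atTop (𝓝[≠] 0) :=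
    tendsto_nhdsWithin_iff.2 ⟨tendsto_one_div_add_atTop_nhds_zero_nat,
      Eventually.of_forall fun n => by simp; positivity⟩
  refine (h3.comp h4).congr fun n => ?_
  simp [truncate, div_eq_mul_inv, mul_comm]

lemma HasGradOn.restrict {w : Plane → ℝ} {G : Plane → Plane} {r s : ℝ} (h : HasGradOn s w G)
    (hrs : r ≤ s) : HasGradOn r w G :=
  ⟨h.integrable.mono_measure (ballMeasure_mono hrs),
    h.integrable_grad.mono_measure (ballMeasure_mono hrs), fun φ hφ j => by
      rw [← (hφ.isTest_partialDeriv j).integral_eq hrs, ← hφ.integral_eq hrs]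
      exact h.integral_eq φ (hφ.mono hrs) j⟩

/-- Truncation multiplies the gradient by a factor of modulus at most one and preserves dependence
on a single polar variable, so the constant ν survives at every level. -/
theorem HasGradOn.jacBound_truncate {ν r k : ℝ} (hν : 0 ≤ ν) (hk : 0 < k) (hr : r ≤ 1)
    {lam : Plane → ℝ} {G : Plane → Plane} (h : HasGradOn 1 lam G)
    (hR : ∀ᵐ x ∂ballMeasure 1, |inner ℝ x (G x)| ≤ ν)
    (hT : ∀ᵐ x ∂ballMeasure 1, |inner ℝ (perp x) (G x)| ≤ ν)
    (hone : (∃ l : ℝ → ℝ, ∀ᵐ x ∂ballMeasure 1, lam x = l ‖x‖) ∨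
      ∃ l : ℝ → ℝ, ∀ᵐ x ∂ballMeasure 1, lam x = l (polarAngle x)) :
    JacBound ν r fun x => truncate k (lam x) := by
  have hc := (h.comp (contDiff_truncate k) (abs_deriv_truncate_le hk)).restrict hr
  have hb : ∀ {y : Plane → Plane}, (∀ᵐ x ∂ballMeasure 1, |inner ℝ (y x) (G x)| ≤ ν) →
      ∀ᵐ x ∂ballMeasure r, |inner ℝ (y x) (deriv (truncate k) (lam x) • G x)| ≤ ν := fun hy => by
    filter_upwards [ae_ball_mono hr hy] with x hx
    rw [inner_smul_right, abs_mul]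
    exact (mul_le_of_le_one_left (abs_nonneg _) (abs_deriv_truncate_le hk _)).trans hx
  refine hc.jacBound hν (hb hR) (hb hT) ?_
  rcases hone with ⟨l, hl⟩ | ⟨l, hl⟩
  · refine Or.inl ⟨fun t => truncate k (l t), ?_⟩
    filter_upwards [ae_ball_mono hr hl] with x hx
    rw [hx]
  · refine Or.inr ⟨fun t => truncate k (l t), ?_⟩
    filter_upwards [ae_ball_mono hr hl] with x hx
    rw [hx]

/-! ### Uniqueness of weak gradients and functions with equal traces. -/

lemma weakGradient_spec {w : Plane → ℝ} (h : ∃ g, HasWeakGradient w g) :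
    HasWeakGradient w (weakGradient w) := by
  rw [weakGradient, dif_pos h]
  exact h.choose_spec

lemma ae_disk_of_ae_ball {P : Plane → Prop}
    (h : ∀ r : ℝ, 0 < r → r < 1 → ∀ᵐ x ∂ballMeasure r, P x) : ∀ᵐ x ∂ballMeasure 1, P x := by
  have h1 : ∀ n : ℕ, ∀ᵐ x, x ∈ Metric.ball (0 : Plane) (1 - 1 / (n + 2)) → P x := fun n => by
    refine (ae_restrict_iff' Metric.isOpen_ball.measurableSet).1 (h _ ?_ ?_)
    · rw [sub_pos, div_lt_one (by positivity)]; linarith [(Nat.cast_nonneg n : (0 : ℝ) ≤ n)]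
    · linarith [show (0 : ℝ) < 1 / (n + 2) by positivity]
  refine (ae_restrict_iff' Metric.isOpen_ball.measurableSet).2 ?_
  filter_upwards [ae_all_iff.2 h1] with x hx hx1
  obtain ⟨n, hn⟩ := exists_nat_one_div_lt (sub_pos.2 (mem_ball_zero_iff.1 hx1))
  refine hx n (mem_ball_zero_iff.2 ?_)
  have : (1 : ℝ) / (n + 2) ≤ 1 / (n + 1) := one_div_le_one_div_of_le (by positivity) (by linarith)
  linarith

lemma integrable_of_locallyIntegrableOn {E : Type*} [NormedAddCommGroup E] {g : Plane → E}
    (h : LocallyIntegrableOn g disk) {r : ℝ} (hr : r < 1) : Integrable g (ballMeasure r) :=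
  (h.integrableOn_compact_subset (Metric.closedBall_subset_ball hr)
    (isCompact_closedBall 0 r)).mono_set Metric.ball_subset_closedBall

lemma HasWeakGradient.hasGradOn {w : Plane → ℝ} {g : Plane → Plane} (h : HasWeakGradient w g)
    {r : ℝ} (hr : r < 1) : HasGradOn r w g :=
  ⟨integrable_of_locallyIntegrableOn h.locallyIntegrable hr,
    integrable_of_locallyIntegrableOn h.locallyIntegrable_grad hr, fun φ hφ j => by
      rw [← (hφ.isTest_partialDeriv j).integral_eq hr.le, ← hφ.integral_eq hr.le]
      exact h.integral_eq φ (isTest_one.1 (hφ.mono hr.le)) j⟩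

lemma HasGradOn.ae_eq {r : ℝ} {w : Plane → ℝ} {G G' : Plane → Plane} (h : HasGradOn r w G)
    (h' : HasGradOn r w G') : ∀ᵐ x ∂ballMeasure r, G x = G' x := by
  have key : ∀ j : Fin 2, ∀ᵐ x ∂ballMeasure r, G x j - G' x j = 0 := fun j => by
    have i := integrable_coord h.integrable_grad j
    have i' := integrable_coord h'.integrable_grad j
    refine ae_eq_zero_of_forall_isTest (i.sub i') fun ψ hψ => ?_
    have e := h.integral_eq ψ hψ j
    rw [h'.integral_eq ψ hψ j, neg_inj] at e
    have c := hψ.smooth.continuous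
    calc _ = ∫ x, (G x j * ψ x - G' x j * ψ x) ∂ballMeasure r := by
          congr 1; ext x; ring
      _ = 0 := by
          rw [integral_sub (integrable_mul_continuous i c) (integrable_mul_continuous i' c), e,
            sub_self]
  filter_upwards [key 0, key 1] with x h0 h1
  ext j
  fin_cases j
  exacts [sub_eq_zero.1 h0, sub_eq_zero.1 h1]

lemma HasGradOn.sub {r : ℝ} {w w' : Plane → ℝ} {G G' : Plane → Plane} (h : HasGradOn r w G)
    (h' : HasGradOn r w' G') : HasGradOn r (fun x => w x - w' x) (fun x => G x - G' x) := by
  refine ⟨h.integrable.sub h'.integrable, h.integrable_grad.sub h'.integrable_grad,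
    fun φ hφ j => ?_⟩
  have c := hφ.smooth.continuous
  have cj := (contDiff_partialDeriv hφ.smooth j).continuous
  simp only [PiLp.sub_apply, sub_mul]
  rw [integral_sub (integrable_mul_continuous h.integrable cj)
    (integrable_mul_continuous h'.integrable cj),
    integral_sub (integrable_mul_continuous (integrable_coord h.integrable_grad j) c)
      (integrable_mul_continuous (integrable_coord h'.integrable_grad j) c),
    h.integral_eq φ hφ, h'.integral_eq φ hφ]
  ring

/-- The chosen weak gradient agrees almost everywhere with the one known to be in L^q, by uniqueness
on smaller disks and exhaustion. -/
lemma MemSobolev.memLp_weakGradient {q : ℝ≥0∞} {w : Plane → ℝ} (h : MemSobolev q w) :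
    MemLp (weakGradient w) q (ballMeasure 1) := by
  obtain ⟨-, g, hg, hgq⟩ := h
  refine (memLp_congr_ae (ae_disk_of_ae_ball fun r _ hr => ?_)).1 hgq
  exact (hg.hasGradOn hr).ae_eq ((weakGradient_spec ⟨g, hg⟩).hasGradOn hr)

lemma MemSobolev.memLp_coord {q : ℝ≥0∞} {w : Plane → ℝ} (h : MemSobolev q w) (j : Fin 2) :
    MemLp (fun x => weakGradient w x j) q (ballMeasure 1) :=
  h.memLp_weakGradient.continuousLinearMap_comp (EuclideanSpace.proj j : Plane →L[ℝ] ℝ)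

lemma MemSobolev.hasGradOn {q : ℝ≥0∞} (hq : 1 ≤ q) {w : Plane → ℝ} (h : MemSobolev q w) :
    HasGradOn 1 w (weakGradient w) := by
  have hg := weakGradient_spec (h.2.imp fun _ h => h.1)
  exact ⟨MemLp.integrable (μ := ballMeasure 1) hq h.1, h.memLp_weakGradient.integrable hq, fun φ hφ j =>
    hg.integral_eq φ (isTest_one.1 hφ) j⟩

/-- The difference of two Sobolev functions with the same trace is approximated in `W^{1,2}` by
test functions. -/
lemma exists_isTest_tendsto_sub {v u u₀ : Plane → ℝ} (hv : MemSobolev 2 v) (hu : MemSobolev 2 u)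
    (hu₀ : MemSobolev 2 u₀) (hvz : MemSobolevZero fun x => v x - u₀ x)
    (huz : MemSobolevZero fun x => u x - u₀ x) :
    ∃ ψ : ℕ → Plane → ℝ, (∀ n, IsTest 1 (ψ n)) ∧
      Tendsto (fun n => eLpNorm (ψ n - fun x => v x - u x) 2 (ballMeasure 1)) atTop (𝓝 0) ∧
      ∀ j : Fin 2, Tendsto (fun n => eLpNorm (partialDeriv j (ψ n) - fun x =>
        weakGradient v x j - weakGradient u x j) 2 (ballMeasure 1)) atTop (𝓝 0) := by
  have h2 : (1 : ℝ≥0∞) ≤ 2 := by norm_num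
  obtain ⟨hv1, φ, hφ, hφl, hφg⟩ := hvz
  obtain ⟨hu1, χ, hχ, hχl, hχg⟩ := huz
  have ev : ∀ᵐ x ∂ballMeasure 1, _ := (hv1.hasGradOn h2).ae_eq
    ((hv.hasGradOn h2).sub (hu₀.hasGradOn h2))
  have eu : ∀ᵐ x ∂ballMeasure 1, _ := (hu1.hasGradOn h2).ae_eq
    ((hu.hasGradOn h2).sub (hu₀.hasGradOn h2))
  have add0 : ∀ {a b : ℕ → ℝ≥0∞}, Tendsto a atTop (𝓝 0) → Tendsto b atTop (𝓝 0) →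
    Tendsto (fun n => a n + b n) atTop (𝓝 0) := fun ha hb => by simpa using ha.add hb
  have hφ' := fun n => isTest_one.2 (hφ n)
  have hχ' := fun n => isTest_one.2 (hχ n)
  refine ⟨fun n x => φ n x - χ n x, fun n => (hφ' n).sub (hχ' n), ?_, fun j => ?_⟩
  · refine tendsto_of_tendsto_of_tendsto_of_le_of_le tendsto_const_nhds (add0 hχl hφl)
      (fun _ => zero_le) fun n => ?_
    calc _ = eLpNorm ((fun x => u x - u₀ x - χ n x) - fun x => v x - u₀ x - φ n x) 2
          (ballMeasure 1) := by
          congr 1; ext x; simp only [Pi.sub_apply]; ring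
      _ ≤ _ := eLpNorm_sub_le ((hu.1.1.sub hu₀.1.1).sub (hχ' n).smooth.continuous.aestronglyMeasurable)
          ((hv.1.1.sub hu₀.1.1).sub (hφ' n).smooth.continuous.aestronglyMeasurable) h2
  · refine tendsto_of_tendsto_of_tendsto_of_le_of_le tendsto_const_nhds (add0 (hχg j) (hφg j))
      (fun _ => zero_le) fun n => ?_
    have cm : ∀ {f : Plane → ℝ}, IsTest 1 f → AEStronglyMeasurable (partialDeriv j f) diskMeasure :=
      fun hf => (contDiff_partialDeriv hf.smooth j).continuous.aestronglyMeasurable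
    calc _ = eLpNorm ((fun x => weakGradient (fun x => u x - u₀ x) x j - partialDeriv j (χ n) x) -
          fun x => weakGradient (fun x => v x - u₀ x) x j - partialDeriv j (φ n) x) 2
          (ballMeasure 1) := by
          refine eLpNorm_congr_ae ?_
          filter_upwards [ev, eu] with x h1 h3
          simp only [Pi.sub_apply]
          rw [h1, h3, partialDeriv_sub (hφ' n).smooth (hχ' n).smooth]
          simp only [PiLp.sub_apply]; ring
      _ ≤ _ := eLpNorm_sub_le ((hu1.memLp_coord j).1.sub (cm (hχ' n)))
          ((hv1.memLp_coord j).1.sub (cm (hφ' n))) h2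

/-! ### Extension of the bounds from test functions to W_0^{1,2}(B). -/

/-- The test functions `ψ n` converge to `η` in `W^{1,2}(B)`, and `h` is the gradient of `η`. -/
structure TestLimit (ψ : ℕ → Plane → ℝ) (η : Plane → ℝ) (h : Fin 2 → Plane → ℝ) : Prop where
  isTest : ∀ n, IsTest 1 (ψ n)
  memLp : MemLp η 2 (ballMeasure 1)
  memLp_grad : ∀ j, MemLp (h j) 2 (ballMeasure 1)
  tendsto : Tendsto (fun n => eLpNorm (ψ n - η) 2 (ballMeasure 1)) atTop (𝓝 0)
  tendsto_grad : ∀ j, Tendsto (fun n => eLpNorm (partialDeriv j (ψ n) - h j) 2 (ballMeasure 1))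
    atTop (𝓝 0)

namespace TestLimit

variable {ψ χ : ℕ → Plane → ℝ} {η ζ : Plane → ℝ} {h k : Fin 2 → Plane → ℝ}

lemma memLp_partialDeriv (H : TestLimit ψ η h) (j : Fin 2) (n : ℕ) :
    MemLp (partialDeriv j (ψ n)) 2 (ballMeasure 1) :=
  memLp_ball (contDiff_partialDeriv (H.isTest n).smooth j).continuous 1 2

lemma tendsto_integral_mul (H : TestLimit ψ η h) {c : Plane → ℝ} (hc : MemLp c 2 (ballMeasure 1)) :
    Tendsto (fun n => ∫ x, ψ n x * c x ∂ballMeasure 1) atTop (𝓝 (∫ x, η x * c x ∂ballMeasure 1)) :=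
  tendsto_integral_mul_of_L2 (fun n => memLp_ball (H.isTest n).smooth.continuous 1 2) H.memLp
    (fun _ => hc) hc H.tendsto (by simp)

lemma tendsto_integral_grad_mul (H : TestLimit ψ η h) {c : Plane → ℝ}
    (hc : MemLp c 2 (ballMeasure 1)) (j : Fin 2) :
    Tendsto (fun n => ∫ x, partialDeriv j (ψ n) x * c x ∂ballMeasure 1) atTop
      (𝓝 (∫ x, h j x * c x ∂ballMeasure 1)) :=
  tendsto_integral_mul_of_L2 (H.memLp_partialDeriv j) (H.memLp_grad j)
    (fun _ => hc) hc (H.tendsto_grad j) (by simp)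

lemma tendsto_dirichlet (H : TestLimit ψ η h) : Tendsto (fun n => dirichlet 1 (ψ n)) atTop
    (𝓝 (∫ x, (h 0 x ^ 2 + h 1 x ^ 2) ∂ballMeasure 1)) := by
  have t : ∀ j, _ := fun j => tendsto_integral_mul_of_L2 (H.memLp_partialDeriv j) (H.memLp_grad j)
    (H.memLp_partialDeriv j) (H.memLp_grad j) (H.tendsto_grad j) (H.tendsto_grad j)
  have i : ∀ {f : Plane → ℝ}, MemLp f 2 (ballMeasure 1) →
    Integrable (fun x => f x * f x) (ballMeasure 1) := fun hf => hf.integrable_mul hf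
  have e := (t 0).add (t 1)
  rw [← integral_add (i (H.memLp_grad 0)) (i (H.memLp_grad 1))] at e
  simp only [pow_two]
  refine e.congr fun n => ?_
  rw [dirichlet, ← integral_add (i (H.memLp_partialDeriv 0 n)) (i (H.memLp_partialDeriv 1 n))]
  simp only [pow_two]

lemma tendsto_jac (H : TestLimit ψ η h) (K : TestLimit χ ζ k) {lam : Plane → ℝ} {b : ℝ}
    (hm : AEStronglyMeasurable lam (ballMeasure 1)) (hb : ∀ᵐ x ∂ballMeasure 1, |lam x| ≤ b) :
    Tendsto (fun n => ∫ x, lam x * jac (ψ n) (χ n) x ∂ballMeasure 1) atTop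
      (𝓝 (∫ x, lam x * (h 0 x * k 1 x - h 1 x * k 0 x) ∂ballMeasure 1)) := by
  have hl : ∀ {f : Plane → ℝ}, MemLp f 2 (ballMeasure 1) →
    MemLp (fun x => lam x * f x) 2 (ballMeasure 1) := fun hf => MemLp.mul_of_bound hm hb hf
  have t : ∀ i j, _ := fun i j => tendsto_integral_mul_of_L2
    (fun n => hl (H.memLp_partialDeriv i n)) (hl (H.memLp_grad i))
    (K.memLp_partialDeriv j) (K.memLp_grad j)
    (tendsto_eLpNorm_mul_of_bound hb (H.tendsto_grad i)) (K.tendsto_grad j)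
  have i : ∀ {f g : Plane → ℝ}, MemLp f 2 (ballMeasure 1) → MemLp g 2 (ballMeasure 1) →
    Integrable (fun x => lam x * f x * g x) (ballMeasure 1) := fun hf hg => (hl hf).integrable_mul hg
  have e := (t 0 1).sub (t 1 0)
  rw [← integral_sub (i (H.memLp_grad 0) (K.memLp_grad 1)) (i (H.memLp_grad 1) (K.memLp_grad 0))] at e
  simp only [mul_sub, ← mul_assoc]
  refine e.congr fun n => ?_
  rw [← integral_sub (i (H.memLp_partialDeriv 0 n) (K.memLp_partialDeriv 1 n))
    (i (H.memLp_partialDeriv 1 n) (K.memLp_partialDeriv 0 n))]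
  congr 1; ext x; rw [jac]; ring

lemma hasGradOn (H : TestLimit ψ η h) : HasGradOn 1 η fun x => !₂[h 0 x, h 1 x] := by
  have hi : ∀ {f : Plane → ℝ}, MemLp f 2 (ballMeasure 1) → Integrable f (ballMeasure 1) :=
    fun hf => hf.integrable (by norm_num)
  have e : ∀ j x, ![h 0 x, h 1 x] j = h j x := fun j x => by fin_cases j <;> rfl
  refine ⟨hi H.memLp, ?_, fun φ hφ j => ?_⟩
  · have : (fun x => (!₂[h 0 x, h 1 x] : Plane)) = fun x =>
        h 0 x • (EuclideanSpace.single 0 1 : Plane) + h 1 x • (EuclideanSpace.single 1 1 : Plane) := by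
      ext x j; fin_cases j <;> simp
    rw [this]
    exact ((hi (H.memLp_grad 0)).smul_const _).add ((hi (H.memLp_grad 1)).smul_const _)
  · simp only [e]
    refine tendsto_nhds_unique (H.tendsto_integral_mul
      (memLp_ball (contDiff_partialDeriv hφ.smooth j).continuous 1 2))
      ((H.tendsto_integral_grad_mul (memLp_ball hφ.smooth.continuous 1 2) j).neg.congr fun n => ?_)
    rw [integral_partialDeriv_of_contDiff (H.isTest n).smooth hφ j]

lemma const_sub (H : TestLimit ψ η h) (n : ℕ) :
    TestLimit (fun m x => ψ n x - ψ m x) (fun x => ψ n x - η x)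
      fun j x => partialDeriv j (ψ n) x - h j x where
  isTest m := (H.isTest n).sub (H.isTest m)
  memLp := (memLp_ball (H.isTest n).smooth.continuous 1 2).sub H.memLp
  memLp_grad j := (H.memLp_partialDeriv j n).sub (H.memLp_grad j)
  tendsto := H.tendsto.congr fun m => by
    rw [← eLpNorm_neg]; congr 1; ext x; simp
  tendsto_grad j := (H.tendsto_grad j).congr fun m => by
    rw [← eLpNorm_neg]; congr 1; ext x
    simp only [Pi.neg_apply, Pi.sub_apply, partialDeriv_sub (H.isTest n).smooth (H.isTest m).smooth]
    ring

lemma tendsto_grad_sub (H : TestLimit ψ η h) : Tendsto (fun n => ∫ x, ((partialDeriv 0 (ψ n) x -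
    h 0 x) ^ 2 + (partialDeriv 1 (ψ n) x - h 1 x) ^ 2) ∂ballMeasure 1) atTop (𝓝 0) := by
  have m : ∀ j n, MemLp (fun x => partialDeriv j (ψ n) x - h j x) 2 (ballMeasure 1) := fun j n =>
    (H.memLp_partialDeriv j n).sub (H.memLp_grad j)
  have z : ∀ j, Tendsto (fun n => eLpNorm ((fun x => partialDeriv j (ψ n) x - h j x) - fun _ => 0) 2
      (ballMeasure 1)) atTop (𝓝 0) := fun j => (H.tendsto_grad j).congr fun n => by
    congr 1; ext x; simp
  have t : ∀ j, _ := fun j => tendsto_integral_mul_of_L2 (m j) (memLp_const 0) (m j) (memLp_const 0)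
    (z j) (z j)
  have i : ∀ {f : Plane → ℝ}, MemLp f 2 (ballMeasure 1) →
    Integrable (fun x => f x * f x) (ballMeasure 1) := fun hf => hf.integrable_mul hf
  have e := (t 0).add (t 1)
  simp only [mul_zero, integral_zero, add_zero] at e
  refine e.congr fun n => ?_
  rw [← integral_add (i (m 0 n)) (i (m 1 n))]
  simp only [pow_two]

/-- The Poincaré inequality in `W_0^{1,2}(B)`. -/
lemma integral_sq_le (H : TestLimit ψ η h) :
    ∫ x, η x ^ 2 ∂ballMeasure 1 ≤ ∫ x, (h 0 x ^ 2 + h 1 x ^ 2) ∂ballMeasure 1 := by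
  have m : ∀ n, MemLp (ψ n) 2 (ballMeasure 1) := fun n =>
    memLp_ball (H.isTest n).smooth.continuous 1 2
  have t := tendsto_integral_mul_of_L2 m H.memLp m H.memLp H.tendsto H.tendsto
  simp only [← pow_two] at t
  refine le_of_tendsto_of_tendsto' t H.tendsto_dirichlet fun n => ?_
  refine ((H.isTest n).integral_sq_le le_rfl).trans ?_
  rw [dirichlet_eq (H.isTest n).smooth]
  exact le_add_of_nonneg_right (hardyNorm_nonneg _ _)

/-- The energy bound in `W_0^{1,2}(B)`, with the gain coming from the angular derivatives. -/
theorem sq_integral_mul_angDeriv_le (H : TestLimit ψ η h) (K : TestLimit χ ζ k) {lam : Plane → ℝ}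
    {b ν : ℝ} (hν : 0 ≤ ν) (hm : AEStronglyMeasurable lam (ballMeasure 1))
    (hb : ∀ᵐ x ∂ballMeasure 1, |lam x| ≤ b) (hJ : JacBound ν 1 lam) {φ : Plane → ℝ}
    (hφ : IsTest 1 φ) :
    ν / 2 * ((∫ x, η x * angDeriv φ x ∂ballMeasure 1) ^ 2 +
      (∫ x, ζ x * angDeriv φ x ∂ballMeasure 1) ^ 2) ≤ (∫ x, angDeriv φ x ^ 2 ∂ballMeasure 1) *
      (ν * (∫ x, (h 0 x ^ 2 + h 1 x ^ 2) ∂ballMeasure 1 +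
        ∫ x, (k 0 x ^ 2 + k 1 x ^ 2) ∂ballMeasure 1) -
      2 * |∫ x, lam x * (h 0 x * k 1 x - h 1 x * k 0 x) ∂ballMeasure 1|) := by
  have ma : MemLp (angDeriv φ) 2 (ballMeasure 1) :=
    memLp_ball (contDiff_angDeriv hφ.smooth).continuous 1 2
  refine le_of_tendsto_of_tendsto'
    ((((H.tendsto_integral_mul ma).pow 2).add ((K.tendsto_integral_mul ma).pow 2)).const_mul _)
    ((((H.tendsto_dirichlet.add K.tendsto_dirichlet).const_mul ν).sub
      ((H.tendsto_jac K hm hb).abs.const_mul 2)).const_mul _) fun n => ?_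
  have h1 := (H.isTest n).sq_integral_mul_angDeriv_le le_rfl hφ
  have h2 := (K.isTest n).sq_integral_mul_angDeriv_le le_rfl hφ
  have h3 := hJ.le_sub_nonradial (H.isTest n) (K.isTest n)
  have h4 : 0 ≤ ∫ x, angDeriv φ x ^ 2 ∂ballMeasure 1 := integral_nonneg fun x => sq_nonneg _
  calc _ ≤ ν / 2 * (nonradialEnergy 1 (ψ n) * ∫ x, angDeriv φ x ^ 2 ∂ballMeasure 1 +
        nonradialEnergy 1 (χ n) * ∫ x, angDeriv φ x ^ 2 ∂ballMeasure 1) := by gcongr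
    _ = (∫ x, angDeriv φ x ^ 2 ∂ballMeasure 1) *
        (ν / 2 * (nonradialEnergy 1 (ψ n) + nonradialEnergy 1 (χ n))) := by ring
    _ ≤ _ := by gcongr; linarith

theorem abs_le_dirichlet (H : TestLimit ψ η h) (K : TestLimit χ ζ k) {lam : Plane → ℝ}
    {b ν : ℝ} (hν : 0 ≤ ν) (hm : AEStronglyMeasurable lam (ballMeasure 1))
    (hb : ∀ᵐ x ∂ballMeasure 1, |lam x| ≤ b) (hJ : JacBound ν 1 lam) :
    2 * |∫ x, lam x * (h 0 x * k 1 x - h 1 x * k 0 x) ∂ballMeasure 1| ≤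
      ν * (∫ x, (h 0 x ^ 2 + h 1 x ^ 2) ∂ballMeasure 1 +
        ∫ x, (k 0 x ^ 2 + k 1 x ^ 2) ∂ballMeasure 1) := by
  refine le_of_tendsto_of_tendsto' ((H.tendsto_jac K hm hb).abs.const_mul 2)
    ((H.tendsto_dirichlet.add K.tendsto_dirichlet).const_mul ν) fun n => ?_
  have h3 := hJ.le_sub_nonradial (H.isTest n) (K.isTest n)
  have h4 := nonradialEnergy_nonneg (r := 1) (H.isTest n).smooth
  have h5 := nonradialEnergy_nonneg (r := 1) (K.isTest n).smooth
  nlinarith [mul_nonneg hν h4, mul_nonneg hν h5]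

end TestLimit

/-- The Sobolev function w has smooth approximations only on smaller disks, so the bound is used on
a disk of radius r < 1 containing the support of φ. This is why `JacBound` is carried for all r ≤ 1.
-/
lemma JacBound.abs_le_of_isTest_one {ν b : ℝ} (hν : 0 ≤ ν) {lam w : Plane → ℝ}
    {G : Plane → Plane} (h : ∀ r ≤ 1, JacBound ν r lam)
    (hm : AEStronglyMeasurable lam (ballMeasure 1))
    (hb : ∀ᵐ x ∂ballMeasure 1, |lam x| ≤ b) (hw : HasGradOn 1 w G)
    (hw2 : MemLp w 2 (ballMeasure 1)) (hG : ∀ j : Fin 2, MemLp (fun x => G x j) 2 (ballMeasure 1))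
    {φ : Plane → ℝ} (hφ : IsTest 1 φ) :
    |∫ x, lam x * (G x 0 * partialDeriv 1 φ x - G x 1 * partialDeriv 0 φ x) ∂ballMeasure 1| ≤
      ν * (√(∫ x, (G x 0 ^ 2 + G x 1 ^ 2) ∂ballMeasure 1) * √(dirichlet 1 φ)) := by
  obtain ⟨r, hr0, hr, ht⟩ := hφ.exists_lt
  have hz : ∀ x, r ≤ ‖x‖ → ∀ j, partialDeriv j φ x = 0 := fun x hx j =>
    (ht.isTest_partialDeriv j).eq_zero hx
  have e : ∀ {f : Plane → ℝ}, (∀ x, r ≤ ‖x‖ → f x = 0) →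
      ∫ x, f x ∂ballMeasure 1 = ∫ x, f x ∂ballMeasure r := fun hf => by
    rw [integral_ball_eq fun x hx => hf x (hr.le.trans hx), integral_ball_eq hf]
  have e2 : dirichlet 1 φ = dirichlet r φ := e fun x hx => by simp [hz x hx]
  rw [e fun x hx => by simp [hz x hx], e2]
  refine (JacBound.abs_le_of_hasGradOn hν hr (h r hr.le) (hm.mono_measure (ballMeasure_mono hr.le))
    (ae_ball_mono hr.le hb) hw hw2 hG ht).trans ?_
  gcongr ν * (√?_ * _)
  refine integral_mono_measure (ballMeasure_mono hr.le) (Eventually.of_forall fun x => ?_)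
    (((hG 0).integrable_sq).add (hG 1).integrable_sq)
  exact add_nonneg (sq_nonneg _) (sq_nonneg _)

/-- The sup bound b serves only to pass to the limit and does not enter the estimate, which is
therefore uniform over the truncations. -/
theorem TestLimit.abs_integral_le {ψ : ℕ → Plane → ℝ} {η : Plane → ℝ} {h : Fin 2 → Plane → ℝ}
    (H : TestLimit ψ η h) {ν b : ℝ} (hν : 0 ≤ ν) {lam w : Plane → ℝ}
    {G : Plane → Plane} (hJ : ∀ r ≤ 1, JacBound ν r lam)
    (hm : AEStronglyMeasurable lam (ballMeasure 1))
    (hb : ∀ᵐ x ∂ballMeasure 1, |lam x| ≤ b) (hw : HasGradOn 1 w G)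
    (hw2 : MemLp w 2 (ballMeasure 1)) (hG : ∀ j : Fin 2, MemLp (fun x => G x j) 2 (ballMeasure 1)) :
    |∫ x, lam x * (G x 0 * h 1 x - G x 1 * h 0 x) ∂ballMeasure 1| ≤
      ν * (√(∫ x, (G x 0 ^ 2 + G x 1 ^ 2) ∂ballMeasure 1) *
        √(∫ x, (h 0 x ^ 2 + h 1 x ^ 2) ∂ballMeasure 1)) := by
  have hl : ∀ j, MemLp (fun x => lam x * G x j) 2 (ballMeasure 1) := fun j =>
    MemLp.mul_of_bound hm hb (hG j)
  have i : ∀ {f g : Plane → ℝ}, MemLp f 2 (ballMeasure 1) → MemLp g 2 (ballMeasure 1) →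
    Integrable (fun x => f x * g x) (ballMeasure 1) := fun hf hg => hf.integrable_mul hg
  have t := ((H.tendsto_integral_grad_mul (hl 0) 1).sub (H.tendsto_integral_grad_mul (hl 1) 0)).abs
  have e : ∀ {f g : Plane → ℝ}, MemLp f 2 (ballMeasure 1) → MemLp g 2 (ballMeasure 1) →
      ∫ x, g x * (lam x * G x 0) ∂ballMeasure 1 - ∫ x, f x * (lam x * G x 1) ∂ballMeasure 1 =
      ∫ x, lam x * (G x 0 * g x - G x 1 * f x) ∂ballMeasure 1 := fun hf hg => by
    rw [← integral_sub (i hg (hl 0)) (i hf (hl 1))]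
    congr 1; ext x; ring
  rw [e (H.memLp_grad 0) (H.memLp_grad 1)] at t
  refine le_of_tendsto_of_tendsto' t ((H.tendsto_dirichlet.sqrt.const_mul _).const_mul ν) fun n => ?_
  rw [e (H.memLp_partialDeriv 0 n) (H.memLp_partialDeriv 1 n)]
  exact JacBound.abs_le_of_isTest_one hν hJ hm hb hw hw2 hG (H.isTest n)

/-! ### Algebra and integrability of the quadratic integrand. -/

lemma integrand_add (M : Plane → Tensor4) (x : Plane) (A B : Matrix (Fin 2) (Fin 2) ℝ) :
    integrand M x (A + B) = integrand M x A +
      ∑ i, ∑ j, (∑ k, ∑ l, (M x i j k l + M x k l i j) * A k l) * B i j + integrand M x B := by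
  simp only [integrand, Fin.sum_univ_two, Matrix.add_apply]
  ring

lemma integrand_smul (M : Plane → Tensor4) (x : Plane) (t : ℝ) (B : Matrix (Fin 2) (Fin 2) ℝ) :
    integrand M x (t • B) = t ^ 2 * integrand M x B := by
  simp only [integrand, Fin.sum_univ_two, Matrix.smul_apply, smul_eq_mul]
  ring

lemma deriv_quadratic_zero (a b c : ℝ) : deriv (fun t : ℝ => a + t * b + t ^ 2 * c) 0 = b := by
  have d : HasDerivAt (fun t : ℝ => a + t * b + t ^ 2 * c) _ 0 :=
    (((hasDerivAt_id (0 : ℝ)).mul_const b).const_add a).add ((hasDerivAt_pow 2 (0 : ℝ)).mul_const c)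
  rw [d.deriv]; simp

lemma gradXi_integrand {M : Plane → Tensor4} {x : Plane}
    (h : ∀ i j k l : Fin 2, M x i j k l = M x k l i j) (A : Matrix (Fin 2) (Fin 2) ℝ) (i j : Fin 2) :
    gradXi (integrand M) x A i j = 2 * ∑ k, ∑ l, M x i j k l * A k l := by
  have e : ∀ t : ℝ, integrand M x (A + t • Matrix.single i j 1) = integrand M x A +
      t * (2 * ∑ k, ∑ l, M x i j k l * A k l) + t ^ 2 * integrand M x (Matrix.single i j 1) := by
    intro t
    rw [integrand_add, integrand_smul]
    congr 2
    have : ∀ i' j', (∑ k, ∑ l, (M x i' j' k l + M x k l i' j') * A k l) *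
        (t • Matrix.single i j (1 : ℝ) : Matrix (Fin 2) (Fin 2) ℝ) i' j' =
        if i = i' ∧ j = j' then t * (2 * ∑ k, ∑ l, M x i j k l * A k l) else 0 := fun i' j' => by
      rw [Matrix.smul_apply, Matrix.single_apply, smul_eq_mul]
      split_ifs with hij
      · obtain ⟨rfl, rfl⟩ := hij
        simp only [Finset.mul_sum, Finset.sum_mul]
        refine Finset.sum_congr rfl fun k _ => Finset.sum_congr rfl fun l _ => ?_
        rw [← h i j k l]; ring
      · simp
    simp only [this]
    rw [Finset.sum_eq_single i, Finset.sum_eq_single j] <;> simp +contextual [eq_comm]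
  rw [gradXi, Matrix.of_apply]
  simp only [e]
  exact deriv_quadratic_zero _ _ _

lemma integrand_add_of_symm {M : Plane → Tensor4} {x : Plane}
    (h : ∀ i j k l : Fin 2, M x i j k l = M x k l i j) (A B : Matrix (Fin 2) (Fin 2) ℝ) :
    integrand M x (A + B) = integrand M x A +
      ∑ i, ∑ j, gradXi (integrand M) x A i j * B i j + integrand M x B := by
  rw [integrand_add]
  congr 2
  refine Finset.sum_congr rfl fun i _ => Finset.sum_congr rfl fun j _ => ?_
  rw [gradXi_integrand h]
  congr 1
  simp only [Finset.mul_sum]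
  refine Finset.sum_congr rfl fun k _ => Finset.sum_congr rfl fun l _ => ?_
  rw [← h i j k l]; ring

section Integrability

variable {M : Plane → Tensor4} {ν : ℝ} {A : Plane → Matrix (Fin 2) (Fin 2) ℝ}

lemma IsEllipticTensor.memLp_apply (hM : IsEllipticTensor M ν)
    (hA : ∀ i j, MemLp (fun x => A x i j) 2 (ballMeasure 1)) (i j : Fin 2) :
    MemLp (fun x => ∑ k, ∑ l, M x i j k l * A x k l) 2 (ballMeasure 1) :=
  memLp_finsetSum _ fun k _ => memLp_finsetSum _ fun l _ => (hA k l).mul (hM.bounded i j k l)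

lemma IsEllipticTensor.memLp_gradXi (hM : IsEllipticTensor M ν)
    (hA : ∀ i j, MemLp (fun x => A x i j) 2 (ballMeasure 1)) (i j : Fin 2) :
    MemLp (fun x => gradXi (integrand M) x (A x) i j) 2 (ballMeasure 1) := by
  refine (memLp_congr_ae ?_).1 ((hM.memLp_apply hA i j).const_mul 2)
  have hs : ∀ᵐ x ∂ballMeasure 1, _ := hM.symmetric
  filter_upwards [hs] with x hx
  rw [gradXi_integrand hx]

lemma IsEllipticTensor.integrable_integrand (hM : IsEllipticTensor M ν)
    (hA : ∀ i j, MemLp (fun x => A x i j) 2 (ballMeasure 1)) :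
    Integrable (fun x => integrand M x (A x)) (ballMeasure 1) := by
  simp only [integrand]
  refine integrable_finsetSum _ fun i _ => integrable_finsetSum _ fun j _ => ?_
  simp only [← Finset.sum_mul]
  exact (hM.memLp_apply hA i j).integrable_mul (hA i j)

end Integrability

/-! ### The pressure equation and the first variation. -/

lemma integrable_mul_of_isTest {lam g φ : Plane → ℝ} {G : Plane → Plane} (hl : HasGradOn 1 lam G)
    (hg : MemLp g 2 (ballMeasure 1)) (hφ : IsTest 1 φ) :
    Integrable (fun x => lam x * (g x * φ x)) (ballMeasure 1) := by
  obtain ⟨r, hr0, hr, ht⟩ := hφ.exists_lt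
  have h1 : Integrable (fun x => lam x * g x) (ballMeasure r) :=
    (hl.memLp_two hr0 hr).integrable_mul (hg.mono_measure (ballMeasure_mono hr.le))
  have h2 : IntegrableOn (fun x => lam x * (g x * φ x)) (Metric.ball 0 r) volume := by
    refine (integrable_mul_continuous h1 ht.smooth.continuous).congr (Eventually.of_forall fun x => ?_)
    simp only; ring
  have h3 : Function.support (fun x => lam x * (g x * φ x)) ⊆ Metric.ball 0 r := fun x hx => by
    by_contra hn
    exact hx (by
      show lam x * (g x * φ x) = 0
      rw [ht.eq_zero (not_lt.1 fun h => hn (mem_ball_zero_iff.2 h)), mul_zero, mul_zero])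
  exact ((integrableOn_iff_integrable_of_support_subset h3).1 h2).restrict

lemma tendsto_integral_truncate_mul {lam g : Plane → ℝ} {r : ℝ}
    (hm : AEStronglyMeasurable lam (ballMeasure r)) (hg : AEStronglyMeasurable g (ballMeasure r))
    (h : Integrable (fun x => lam x * g x) (ballMeasure r)) :
    Tendsto (fun n : ℕ => ∫ x, truncate (n + 1) (lam x) * g x ∂ballMeasure r) atTop
      (𝓝 (∫ x, lam x * g x ∂ballMeasure r)) := by
  refine tendsto_integral_of_dominated_convergence (fun x => |lam x * g x|)
    (fun n => ((contDiff_truncate _).continuous.comp_aestronglyMeasurable hm).mul hg) h.abs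
    (fun n => Eventually.of_forall fun x => ?_)
    (Eventually.of_forall fun x => (tendsto_truncate _).mul_const _)
  rw [norm_mul, abs_mul]
  exact mul_le_mul_of_nonneg_right (abs_truncate_le_abs (by positivity) _) (abs_nonneg _)

/-- The pressure equation tested row by row. -/
lemma IsPressure.integral_eq {M : Plane → Tensor4} {ν : ℝ} (hM : IsEllipticTensor M ν)
    {u : Plane → Plane} (hu : MemSobolevMap u) {lam : Plane → ℝ}
    (h : IsPressure (integrand M) u lam) {φ : Plane → ℝ} (hφ : IsTest 1 φ) (i : Fin 2) :
    ∫ x, ∑ j, gradXi (integrand M) x (weakJacobian u x) i j * partialDeriv j φ x ∂ballMeasure 1 =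
      -2 * ∫ x, lam x * ∑ j, cof (weakJacobian u x) i j * partialDeriv j φ x ∂ballMeasure 1 := by
  have hl : HasGradOn 1 lam (weakGradient lam) := h.1.hasGradOn le_rfl
  have hA : ∀ i j, MemLp (fun x => weakJacobian u x i j) 2 (ballMeasure 1) := fun i j =>
    (hu i).memLp_coord j
  have hc : ∀ j, MemLp (fun x => cof (weakJacobian u x) i j) 2 (ballMeasure 1) := fun j => by
    fin_cases i <;> fin_cases j
    exacts [hA 1 1, (hA 1 0).neg, (hA 0 1).neg, hA 0 0]
  have i1 : Integrable (fun x => ∑ j, gradXi (integrand M) x (weakJacobian u x) i j *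
      partialDeriv j φ x) (ballMeasure 1) := integrable_finsetSum _ fun j _ =>
    (hM.memLp_gradXi hA i j).integrable_mul
      (memLp_ball (contDiff_partialDeriv hφ.smooth j).continuous 1 2)
  have i2 : Integrable (fun x => lam x * ∑ j, cof (weakJacobian u x) i j * partialDeriv j φ x)
      (ballMeasure 1) := by
    simp only [Finset.mul_sum]
    exact integrable_finsetSum _ fun j _ =>
      integrable_mul_of_isTest hl (hc j) (hφ.isTest_partialDeriv j)
  have e : ∫ x, (∑ j, gradXi (integrand M) x (weakJacobian u x) i j * partialDeriv j φ x +
      2 * (lam x * ∑ j, cof (weakJacobian u x) i j * partialDeriv j φ x)) ∂ballMeasure 1 = 0 := by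
    rw [← h.2 i φ (isTest_one.1 hφ)]
    congr 1; ext x
    simp only [Fin.sum_univ_two, Matrix.add_apply, Matrix.smul_apply, smul_eq_mul]
    ring
  rw [integral_add i1 (i2.const_mul 2), integral_const_mul] at e
  linarith

lemma integrable_bound_mul_sub {lam : Plane → ℝ} {b : ℝ} {g h k l : Plane → ℝ}
    (hm : AEStronglyMeasurable lam (ballMeasure 1)) (hb : ∀ᵐ x ∂ballMeasure 1, |lam x| ≤ b)
    (hg : MemLp g 2 (ballMeasure 1)) (hh : MemLp h 2 (ballMeasure 1))
    (hk : MemLp k 2 (ballMeasure 1)) (hl : MemLp l 2 (ballMeasure 1)) :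
    Integrable (fun x => lam x * (g x * h x - k x * l x)) (ballMeasure 1) :=
  ((hg.integrable_mul hh).sub (hk.integrable_mul hl)).bdd_mul hm hb

lemma TestLimit.abs_integral_sub_le {ψ : ℕ → Plane → ℝ} {η : Plane → ℝ} {h : Fin 2 → Plane → ℝ}
    (H : TestLimit ψ η h) {ν b : ℝ} (hν : 0 ≤ ν) {lam w : Plane → ℝ}
    {G : Plane → Plane} (hJ : ∀ r ≤ 1, JacBound ν r lam)
    (hm : AEStronglyMeasurable lam (ballMeasure 1))
    (hb : ∀ᵐ x ∂ballMeasure 1, |lam x| ≤ b) (hw : HasGradOn 1 w G)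
    (hw2 : MemLp w 2 (ballMeasure 1)) (hG : ∀ j : Fin 2, MemLp (fun x => G x j) 2 (ballMeasure 1))
    (n : ℕ) :
    |∫ x, lam x * (G x 0 * partialDeriv 1 (ψ n) x - G x 1 * partialDeriv 0 (ψ n) x) ∂ballMeasure 1 -
      ∫ x, lam x * (G x 0 * h 1 x - G x 1 * h 0 x) ∂ballMeasure 1| ≤
      ν * (√(∫ x, (G x 0 ^ 2 + G x 1 ^ 2) ∂ballMeasure 1) *
        √(∫ x, ((partialDeriv 0 (ψ n) x - h 0 x) ^ 2 + (partialDeriv 1 (ψ n) x - h 1 x) ^ 2)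
          ∂ballMeasure 1)) := by
  have := (H.const_sub n).abs_integral_le hν hJ hm hb hw hw2 hG
  rw [← integral_sub (integrable_bound_mul_sub hm hb (hG 0) (H.memLp_partialDeriv 1 n) (hG 1)
    (H.memLp_partialDeriv 0 n)) (integrable_bound_mul_sub hm hb (hG 0) (H.memLp_grad 1) (hG 1)
    (H.memLp_grad 0))]
  refine le_trans (le_of_eq ?_) this
  congr 2; ext x; ring

/-- The difference `∂ⱼ(vᵢ - uᵢ)`. -/
def jacDiff (v u : Plane → Plane) (i j : Fin 2) (x : Plane) : ℝ :=
  weakJacobian v x i j - weakJacobian u x i j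

/-- The Dirichlet energy of `v - u`. -/
def dirichletDiff (v u : Plane → Plane) : ℝ :=
  ∫ x, (jacDiff v u 0 0 x ^ 2 + jacDiff v u 0 1 x ^ 2) ∂ballMeasure 1 +
    ∫ x, (jacDiff v u 1 0 x ^ 2 + jacDiff v u 1 1 x ^ 2) ∂ballMeasure 1

/-- The determinant of `∇(v - u)`. -/
def detDiff (v u : Plane → Plane) (x : Plane) : ℝ :=
  jacDiff v u 0 0 x * jacDiff v u 1 1 x - jacDiff v u 0 1 x * jacDiff v u 1 0 x

section Gap

variable {M : Plane → Tensor4} {ν : ℝ} {u v : Plane → Plane} {lam : Plane → ℝ}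
  {ψ : Fin 2 → ℕ → Plane → ℝ} {η : Fin 2 → Plane → ℝ}

lemma memLp_weakJacobian (hu : MemSobolevMap u) (i j : Fin 2) :
    MemLp (fun x => weakJacobian u x i j) 2 (ballMeasure 1) := (hu i).memLp_coord j

lemma memLp_jacDiff (hv : MemSobolevMap v) (hu : MemSobolevMap u) (i j : Fin 2) :
    MemLp (jacDiff v u i j) 2 (ballMeasure 1) :=
  (memLp_weakJacobian hv i j).sub (memLp_weakJacobian hu i j)

/-- Expansion of the energy around `u`. -/
lemma energy_ge (hM : IsEllipticTensor M ν) (hv : MemSobolevMap v) (hu : MemSobolevMap u) :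
    energy (integrand M) u + ∫ x, ∑ i, ∑ j, gradXi (integrand M) x (weakJacobian u x) i j *
      jacDiff v u i j x ∂ballMeasure 1 + ν * dirichletDiff v u ≤ energy (integrand M) v := by
  have hA := memLp_weakJacobian hu
  have hH := memLp_jacDiff hv hu
  have i1 := hM.integrable_integrand hA
  have i2 : Integrable (fun x => ∑ i, ∑ j, gradXi (integrand M) x (weakJacobian u x) i j *
      jacDiff v u i j x) (ballMeasure 1) := integrable_finsetSum _ fun i _ =>
    integrable_finsetSum _ fun j _ => (hM.memLp_gradXi hA i j).integrable_mul (hH i j)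
  have s : ∀ i, Integrable (fun x => jacDiff v u i 0 x ^ 2 + jacDiff v u i 1 x ^ 2)
      (ballMeasure 1) := fun i => (hH i 0).integrable_sq.add (hH i 1).integrable_sq
  have i3 : Integrable (fun x => integrand M x (weakJacobian u x) + ∑ i, ∑ j,
      gradXi (integrand M) x (weakJacobian u x) i j * jacDiff v u i j x) (ballMeasure 1) := i1.add i2
  have i4 : Integrable (fun x => ν * (jacDiff v u 0 0 x ^ 2 + jacDiff v u 0 1 x ^ 2 +
      (jacDiff v u 1 0 x ^ 2 + jacDiff v u 1 1 x ^ 2))) (ballMeasure 1) :=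
    ((s 0).add (s 1)).const_mul ν
  have hs : ∀ᵐ x ∂ballMeasure 1, _ := hM.symmetric
  have hc : ∀ᵐ x ∂ballMeasure 1, _ := hM.coercive
  rw [dirichletDiff, ← integral_add (s 0) (s 1), ← integral_const_mul, energy, energy,
    ← ballMeasure_one, ← integral_add i1 i2, ← integral_add i3 i4]
  refine integral_mono_ae (i3.add i4) (hM.integrable_integrand (memLp_weakJacobian hv)) ?_
  filter_upwards [hs, hc] with x h1 h2
  have e : weakJacobian v x = weakJacobian u x + Matrix.of fun i j => jacDiff v u i j x := by
    ext i j; simp [jacDiff]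
  have h3 := h2 (Matrix.of fun i j => jacDiff v u i j x)
  simp only [Fin.sum_univ_two, Matrix.of_apply] at h3
  rw [e, integrand_add_of_symm h1]
  simp only [Matrix.of_apply, Fin.sum_univ_two]
  linarith

/-- The first variation of the energy is controlled by the determinant of `∇(v - u)`. -/
theorem le_first_variation (hν : 0 ≤ ν) (hM : IsEllipticTensor M ν) (hv : MemSobolevMap v)
    (hu : MemSobolevMap u) (hdv : ∀ᵐ x ∂diskMeasure, (weakJacobian v x).det = 1)
    (hdu : ∀ᵐ x ∂diskMeasure, (weakJacobian u x).det = 1) (hp : IsPressure (integrand M) u lam)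
    (hJ : ∀ k : ℕ, ∀ r ≤ 1, JacBound ν r fun x => truncate (k + 1) (lam x))
    (H : ∀ i, TestLimit (ψ i) (η i) (jacDiff v u i)) {q : ℝ}
    (hq : ∀ k : ℕ, q ≤ -(2 * |∫ x, truncate (k + 1) (lam x) * detDiff v u x ∂ballMeasure 1|)) :
    q ≤ ∫ x, ∑ i, ∑ j, gradXi (integrand M) x (weakJacobian u x) i j *
      jacDiff v u i j x ∂ballMeasure 1 := by
  have hl : HasGradOn 1 lam (weakGradient lam) := hp.1.hasGradOn le_rfl
  have hA := memLp_weakJacobian hu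
  have hH := memLp_jacDiff hv hu
  have hw : ∀ i, HasGradOn 1 (fun x => u x i) (weakGradient fun x => u x i) := fun i =>
    (hu i).hasGradOn (by norm_num)
  have hw2 : ∀ i, MemLp (fun x => u x i) 2 (ballMeasure 1) := fun i => (hu i).1
  have hkm : ∀ k : ℕ, AEStronglyMeasurable (fun x => truncate (k + 1) (lam x)) (ballMeasure 1) :=
    fun k => (contDiff_truncate _).continuous.comp_aestronglyMeasurable hl.integrable.1
  have hkb : ∀ k : ℕ, ∀ᵐ x ∂ballMeasure 1,
      |truncate (k + 1) (lam x)| ≤ ((k : ℝ) + 1) * (Real.pi / 2) :=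
    fun k => Eventually.of_forall fun x => abs_truncate_le (by positivity) _
  -- The integral of l times the Jacobian of the i-th component of u and a function with gradient h;
  -- the two rows of the cofactor term are of this form, with opposite signs.
  set P : (Plane → ℝ) → Fin 2 → (Fin 2 → Plane → ℝ) → ℝ := fun l i h =>
    ∫ x, l x * (weakJacobian u x i 0 * h 1 x - weakJacobian u x i 1 * h 0 x) ∂ballMeasure 1 with hP
  set d : Fin 2 → ℕ → Fin 2 → Plane → ℝ := fun i n j => partialDeriv j (ψ i n) with hd
  set S : Fin 2 → ℕ → ℝ := fun i n => ∫ x, ∑ j, gradXi (integrand M) x (weakJacobian u x) i j *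
    d i n j x ∂ballMeasure 1 with hS
  have hS0 : ∀ n, S 0 n = 2 * P lam 1 (d 0 n) := fun n => by
    rw [hS, hP]
    simp only [hd]
    rw [hp.integral_eq hM hu ((H 0).isTest n), neg_mul, ← mul_neg, ← integral_neg]
    congr 2; ext x
    simp only [Fin.sum_univ_two, cof, Matrix.of_apply, Matrix.cons_val', Matrix.cons_val_zero,
      Matrix.cons_val_one, Matrix.cons_val_fin_one]
    ring
  have hS1 : ∀ n, S 1 n = -(2 * P lam 0 (d 1 n)) := fun n => by
    rw [hS, hP]
    simp only [hd]
    rw [hp.integral_eq hM hu ((H 1).isTest n), neg_mul]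
    congr 3; ext x
    simp only [Fin.sum_univ_two, cof, Matrix.of_apply, Matrix.cons_val', Matrix.cons_val_zero,
      Matrix.cons_val_one, Matrix.cons_val_fin_one]
    ring
  have hPk : ∀ i i' n, Tendsto (fun k : ℕ => P (fun x => truncate (k + 1) (lam x)) i (d i' n)) atTop
      (𝓝 (P lam i (d i' n))) := fun i i' n => by
    have hT := (H i').isTest n
    have i0 := integrable_mul_of_isTest hl (hA i 0) (hT.isTest_partialDeriv 1)
    have i1 := integrable_mul_of_isTest hl (hA i 1) (hT.isTest_partialDeriv 0)
    refine tendsto_integral_truncate_mul hl.integrable.1 ?_ ((i0.sub i1).congr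
      (Eventually.of_forall fun x => ?_))
    · exact ((hA i 0).1.mul (contDiff_partialDeriv hT.smooth 1).continuous.aestronglyMeasurable).sub
        ((hA i 1).1.mul (contDiff_partialDeriv hT.smooth 0).continuous.aestronglyMeasurable)
    · simp only [Pi.sub_apply, hd]; ring
  set c : Fin 2 → ℝ := fun i =>
    √(∫ x, (weakJacobian u x i 0 ^ 2 + weakJacobian u x i 1 ^ 2) ∂ballMeasure 1) with hc
  set ε : Fin 2 → ℕ → ℝ := fun i n => √(∫ x, ((d i n 0 x - jacDiff v u i 0 x) ^ 2 +
    (d i n 1 x - jacDiff v u i 1 x) ^ 2) ∂ballMeasure 1) with hε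
  have hε0 : ∀ i, Tendsto (ε i) atTop (𝓝 0) := fun i => by
    simpa using (H i).tendsto_grad_sub.sqrt
  -- Incompressibility enters here: expanding det(∇u + ∇η) = det∇u = 1 gives cof∇u·∇η = −det∇η.
  have hdet : ∀ k : ℕ, P (fun x => truncate (k + 1) (lam x)) 1 (jacDiff v u 0) -
      P (fun x => truncate (k + 1) (lam x)) 0 (jacDiff v u 1) =
      ∫ x, truncate (k + 1) (lam x) * detDiff v u x ∂ballMeasure 1 := fun k => by
    rw [hP]
    simp only
    rw [← integral_sub
      (integrable_bound_mul_sub (hkm k) (hkb k) (hA 1 0) (hH 0 1) (hA 1 1) (hH 0 0))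
      (integrable_bound_mul_sub (hkm k) (hkb k) (hA 0 0) (hH 1 1) (hA 0 1) (hH 1 0))]
    have hdv' : ∀ᵐ x ∂ballMeasure 1, _ := hdv
    have hdu' : ∀ᵐ x ∂ballMeasure 1, _ := hdu
    refine integral_congr_ae ?_
    filter_upwards [hdv', hdu'] with x h1 h2
    rw [Matrix.det_fin_two] at h1 h2
    rw [← mul_sub]
    congr 1
    simp only [detDiff, jacDiff]
    linarith
  have hPb : ∀ (k : ℕ) (i i' : Fin 2) n, |P (fun x => truncate (k + 1) (lam x)) i (d i' n) -
      P (fun x => truncate (k + 1) (lam x)) i (jacDiff v u i')| ≤ ν * (c i * ε i' n) :=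
    fun k i i' n => (H i').abs_integral_sub_le hν (hJ k) (hkm k) (hkb k) (hw i) (hw2 i) (hA i) n
  -- Order of limits: first k → ∞ with the test functions fixed, where λ∇u∇ψₙ is integrable, and
  -- then n → ∞. This is possible because the error terms do not depend on k.
  have hlow : ∀ n, q - 2 * (ν * (c 1 * ε 0 n) + ν * (c 0 * ε 1 n)) ≤ S 0 n + S 1 n := fun n => by
    have t := ((hPk 1 0 n).const_mul 2).sub ((hPk 0 1 n).const_mul 2)
    rw [hS0, hS1, ← sub_eq_add_neg]
    refine ge_of_tendsto' t fun k => ?_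
    have b0 := (abs_le.1 (hPb k 1 0 n)).1
    have b1 := (abs_le.1 (hPb k 0 1 n)).2
    have b2 := hdet k
    have b3 := hq k
    have b4 := neg_abs_le (∫ x, truncate (k + 1) (lam x) * detDiff v u x ∂ballMeasure 1)
    linarith
  have hlim : ∀ i, Tendsto (S i) atTop (𝓝 (∫ x, ∑ j, gradXi (integrand M) x (weakJacobian u x) i j *
      jacDiff v u i j x ∂ballMeasure 1)) := fun i => by
    have e : ∀ {h : Fin 2 → Plane → ℝ}, (∀ j, MemLp (h j) 2 (ballMeasure 1)) →
        ∑ j, ∫ x, h j x * gradXi (integrand M) x (weakJacobian u x) i j ∂ballMeasure 1 =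
        ∫ x, ∑ j, gradXi (integrand M) x (weakJacobian u x) i j * h j x ∂ballMeasure 1 := fun {h} hh => by
      have ih : ∀ j, Integrable (fun x => gradXi (integrand M) x (weakJacobian u x) i j * h j x)
        (ballMeasure 1) := fun j => (hM.memLp_gradXi hA i j).integrable_mul (hh j)
      rw [integral_finsetSum _ fun j _ => ih j]
      refine Finset.sum_congr rfl fun j _ => ?_
      congr 1; ext x; rw [mul_comm]
    rw [← e (hH i)]
    refine (tendsto_finsetSum _ fun j _ =>
      (H i).tendsto_integral_grad_mul (hM.memLp_gradXi hA i j) j).congr fun n => ?_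
    exact e fun j => (H i).memLp_partialDeriv j n
  have hsum : ∫ x, ∑ i, ∑ j, gradXi (integrand M) x (weakJacobian u x) i j *
      jacDiff v u i j x ∂ballMeasure 1 = ∑ i, ∫ x, ∑ j, gradXi (integrand M) x
      (weakJacobian u x) i j * jacDiff v u i j x ∂ballMeasure 1 :=
    integral_finsetSum _ fun i _ => integrable_finsetSum _ fun j _ =>
      (hM.memLp_gradXi hA i j).integrable_mul (hH i j)
  rw [hsum, Fin.sum_univ_two]
  have t0 : Tendsto (fun n => q - 2 * (ν * (c 1 * ε 0 n) + ν * (c 0 * ε 1 n))) atTop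
      (𝓝 (q - 2 * (ν * (c 1 * 0) + ν * (c 0 * 0)))) :=
    ((((hε0 0).const_mul _).const_mul _).add (((hε0 1).const_mul _).const_mul _)).const_mul _
      |>.const_sub _
  simp only [mul_zero, add_zero, sub_zero] at t0
  exact le_of_tendsto_of_tendsto' t0 ((hlim 0).add (hlim 1)) hlow

end Gap

/-! ### Minimality and uniqueness. -/

section Minimality

variable {M : Plane → Tensor4} {ν : ℝ} {u v : Plane → Plane} {lam : Plane → ℝ}
  {ψ : Fin 2 → ℕ → Plane → ℝ} {η : Fin 2 → Plane → ℝ}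

theorem energy_add_le (hν : 0 ≤ ν) (hM : IsEllipticTensor M ν) (hv : MemSobolevMap v)
    (hu : MemSobolevMap u) (hdv : ∀ᵐ x ∂diskMeasure, (weakJacobian v x).det = 1)
    (hdu : ∀ᵐ x ∂diskMeasure, (weakJacobian u x).det = 1) (hp : IsPressure (integrand M) u lam)
    (hJ : ∀ k : ℕ, ∀ r ≤ 1, JacBound ν r fun x => truncate (k + 1) (lam x))
    (H : ∀ i, TestLimit (ψ i) (η i) (jacDiff v u i)) {q : ℝ}
    (hq : ∀ k : ℕ, q ≤ ν * dirichletDiff v u -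
      2 * |∫ x, truncate (k + 1) (lam x) * detDiff v u x ∂ballMeasure 1|) :
    energy (integrand M) u + q ≤ energy (integrand M) v := by
  have h1 := le_first_variation (q := q - ν * dirichletDiff v u) hν hM hv hu hdv hdu hp hJ H
    fun k => by linarith [hq k]
  linarith [energy_ge hM hv hu]

/-- Orthogonality to all angular derivatives of test functions says that the weak angular derivative
vanishes, so the gradient is parallel to x. -/
lemma ae_inner_perp_eq_zero {φ : ℕ → Plane → ℝ} {w : Plane → ℝ} {h : Fin 2 → Plane → ℝ}
    (H : TestLimit φ w h)
    (h0 : ∀ χ, IsTest 1 χ → ∫ x, w x * angDeriv χ x ∂ballMeasure 1 = 0) :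
    ∀ᵐ x ∂ballMeasure 1, x 0 * h 1 x = x 1 * h 0 x := by
  have hg := H.hasGradOn
  have := ae_eq_zero_of_forall_isTest (integrable_inner_perp hg.integrable_grad) fun χ hχ => by
    rw [hg.integral_inner_perp hχ, h0 χ hχ, neg_zero]
  filter_upwards [this] with x hx
  rw [inner_perp_eq] at hx
  simp at hx
  linarith

theorem ae_eq_of_energy_le (hν : 0 < ν) (hM : IsEllipticTensor M ν) (hv : MemSobolevMap v)
    (hu : MemSobolevMap u) (hdv : ∀ᵐ x ∂diskMeasure, (weakJacobian v x).det = 1)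
    (hdu : ∀ᵐ x ∂diskMeasure, (weakJacobian u x).det = 1) (hp : IsPressure (integrand M) u lam)
    (hJ : ∀ k : ℕ, ∀ r ≤ 1, JacBound ν r fun x => truncate (k + 1) (lam x))
    (H : ∀ i, TestLimit (ψ i) (η i) (jacDiff v u i))
    (hle : energy (integrand M) v ≤ energy (integrand M) u) (i : Fin 2) :
    ∀ᵐ x ∂ballMeasure 1, η i x = 0 := by
  -- Any lower bound for the energy gap that is uniform in k is nonpositive. It is used twice: with
  -- the surplus of the non-radial modes, and then with the full Dirichlet energy.
  have gap : ∀ {q : ℝ}, (∀ k : ℕ, q ≤ ν * dirichletDiff v u -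
      2 * |∫ x, truncate (k + 1) (lam x) * detDiff v u x ∂ballMeasure 1|) → q ≤ 0 := fun hq => by
    linarith [energy_add_le hν.le hM hv hu hdv hdu hp hJ H hq]
  have hm : ∀ k : ℕ, AEStronglyMeasurable (fun x => truncate (k + 1) (lam x)) (ballMeasure 1) :=
    fun k => (contDiff_truncate _).continuous.comp_aestronglyMeasurable
      (MemLp.aestronglyMeasurable (μ := ballMeasure 1) hp.1.1)
  have hb : ∀ k : ℕ, ∀ᵐ x ∂ballMeasure 1,
      |truncate (k + 1) (lam x)| ≤ ((k : ℝ) + 1) * (Real.pi / 2) :=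
    fun k => Eventually.of_forall fun x => abs_truncate_le (by positivity) _
  have hang : ∀ χ, IsTest 1 χ → ∫ x, η 0 x * angDeriv χ x ∂ballMeasure 1 = 0 ∧
      ∫ x, η 1 x * angDeriv χ x ∂ballMeasure 1 = 0 := fun χ hχ => by
    set a := ∫ x, η 0 x * angDeriv χ x ∂ballMeasure 1
    set b := ∫ x, η 1 x * angDeriv χ x ∂ballMeasure 1
    have key : ∀ k : ℕ, ν / 2 * (a ^ 2 + b ^ 2) ≤ (∫ x, angDeriv χ x ^ 2 ∂ballMeasure 1) *
        (ν * dirichletDiff v u -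
          2 * |∫ x, truncate (k + 1) (lam x) * detDiff v u x ∂ballMeasure 1|) := fun k =>
      (H 0).sq_integral_mul_angDeriv_le (H 1) hν.le (hm k) (hb k) (hJ k 1 le_rfl) hχ
    have hK : 0 ≤ ∫ x, angDeriv χ x ^ 2 ∂ballMeasure 1 := integral_nonneg fun x => sq_nonneg _
    have hs : ν / 2 * (a ^ 2 + b ^ 2) ≤ 0 := by
      rcases hK.eq_or_lt with h0 | h0
      · have := key 0
        rwa [← h0, zero_mul] at this
      · have := gap fun k => (div_le_iff₀' h0).2 (key k)
        rwa [div_le_iff₀ h0, zero_mul] at this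
    have hs' : a ^ 2 + b ^ 2 ≤ 0 := nonpos_of_mul_nonpos_right hs (by positivity)
    exact ⟨by nlinarith [sq_nonneg a, sq_nonneg b], by nlinarith [sq_nonneg a, sq_nonneg b]⟩
  -- Both rows of ∇η are parallel to the same nonzero vector x, so the determinant vanishes.
  have hdet : ∀ᵐ x ∂ballMeasure 1, detDiff v u x = 0 := by
    filter_upwards [ae_inner_perp_eq_zero (H 0) fun χ hχ => (hang χ hχ).1,
      ae_inner_perp_eq_zero (H 1) fun χ hχ => (hang χ hχ).2, ae_ne_zero 1] with x h0 h1 hx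
    have e0 : x 0 * detDiff v u x = 0 := by
      rw [detDiff]; linear_combination jacDiff v u 0 0 x * h1 - jacDiff v u 1 0 x * h0
    have e1 : x 1 * detDiff v u x = 0 := by
      rw [detDiff]; linear_combination jacDiff v u 0 1 x * h1 - jacDiff v u 1 1 x * h0
    by_contra hne
    refine hx ?_
    ext j
    fin_cases j
    exacts [(mul_eq_zero.1 e0).resolve_right hne, (mul_eq_zero.1 e1).resolve_right hne]
  -- With the determinant gone, the whole coercive term is a lower bound for the gap; the Poincaré
  -- inequality below then gives η = 0.
  have hD : ν * dirichletDiff v u ≤ 0 := gap fun k => by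
    have : ∫ x, truncate (k + 1) (lam x) * detDiff v u x ∂ballMeasure 1 = 0 := by
      refine integral_eq_zero_of_ae ?_
      filter_upwards [hdet] with x hx
      simp [hx]
    rw [this]; simp
  have hD' : dirichletDiff v u ≤ 0 := nonpos_of_mul_nonpos_right hD hν
  have n : ∀ j : Fin 2, 0 ≤ ∫ x, (jacDiff v u j 0 x ^ 2 + jacDiff v u j 1 x ^ 2) ∂ballMeasure 1 :=
    fun j => integral_nonneg fun x => by positivity
  rw [dirichletDiff] at hD'
  have hi : ∀ i : Fin 2,
      ∫ x, (jacDiff v u i 0 x ^ 2 + jacDiff v u i 1 x ^ 2) ∂ballMeasure 1 ≤ 0 :=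
    Fin.forall_fin_two.2 ⟨by linarith [n 1], by linarith [n 0]⟩
  have hz : ∫ x, η i x ^ 2 ∂ballMeasure 1 = 0 :=
    le_antisymm ((H i).integral_sq_le.trans (hi i)) (integral_nonneg fun x => sq_nonneg _)
  rw [integral_eq_zero_iff_of_nonneg (fun x => sq_nonneg _) (H i).memLp.integrable_sq] at hz
  filter_upwards [hz] with x hx
  exact pow_eq_zero_iff two_ne_zero |>.1 hx

end Minimality

lemma exists_testLimit {u₀ u v : Plane → Plane} (hu₀ : MemSobolevMap u₀) (hu : u ∈ admissible u₀)
    (hv : v ∈ admissible u₀) (i : Fin 2) :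
    ∃ ψ : ℕ → Plane → ℝ, TestLimit ψ (fun x => v x i - u x i) (jacDiff v u i) := by
  obtain ⟨ψ, h1, h2, h3⟩ := exists_isTest_tendsto_sub (hv.1.1 i) (hu.1.1 i) (hu₀ i) (hv.2 i) (hu.2 i)
  exact ⟨ψ, h1, MemLp.sub (μ := ballMeasure 1) (hv.1.1 i).1 (hu.1.1 i).1,
    memLp_jacDiff hv.1.1 hu.1.1 i, h2, h3⟩

end Incompressible

end

theorem mainTheorem2
    (M : Incompressible.Plane → Incompressible.Tensor4) (ν : ℝ) (hν : 0 < ν)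
    (hM : Incompressible.IsEllipticTensor M ν)
    (u₀ : Incompressible.Plane → Incompressible.Plane)
    (hu₀ : Incompressible.IsIncompressible u₀)
    (u : Incompressible.Plane → Incompressible.Plane)
    (hu : u ∈ Incompressible.admissible u₀)
    (lam : Incompressible.Plane → ℝ)
    (hlam : Incompressible.IsPressure (Incompressible.integrand M) u lam)
    (hone : Incompressible.DependsOnRadius lam ∨ Incompressible.DependsOnAngle lam)
    (hsmall : Incompressible.polarSupNorm
      (fun x => ‖x‖ • Incompressible.weakGradient lam x) ≤ ENNReal.ofReal ν) :
    Incompressible.IsGlobalMinimizer (Incompressible.energy (Incompressible.integrand M))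
        (Incompressible.admissible u₀) u ∧
      ((∃ U : Set Incompressible.Plane, MeasurableSet U ∧ U ⊆ Incompressible.disk ∧
          0 < volume U ∧
          ∀ᵐ x ∂(volume.restrict U), ‖‖x‖ • Incompressible.weakGradient lam x‖ < ν) →
        ∀ v : Incompressible.Plane → Incompressible.Plane,
          Incompressible.IsGlobalMinimizer (Incompressible.energy (Incompressible.integrand M))
            (Incompressible.admissible u₀) v →
          v =ᵐ[Incompressible.diskMeasure] u) := by
  obtain ⟨hR, hT⟩ := Incompressible.ae_inner_le_of_polarSupNorm_le hν.le hsmall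
  have hl : Incompressible.HasGradOn 1 lam (Incompressible.weakGradient lam) :=
    hlam.1.hasGradOn le_rfl
  have hJ : ∀ k : ℕ, ∀ r ≤ 1, Incompressible.JacBound ν r
      fun x => Incompressible.truncate (k + 1) (lam x) :=
    fun k r hr => hl.jacBound_truncate hν.le (by positivity) hr hR hT hone
  refine ⟨⟨hu, fun v hv => ?_⟩, fun _ v hv => ?_⟩
  · choose ψ H using Incompressible.exists_testLimit hu₀.1 hu hv
    have hlm : MeasureTheory.AEStronglyMeasurable lam (Incompressible.ballMeasure 1) := hl.integrable.1
    have := Incompressible.energy_add_le (q := 0) hν.le hM hv.1.1 hu.1.1 hv.1.2 hu.1.2 hlam hJ H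
      fun k => sub_nonneg.2 ((H 0).abs_le_dirichlet (H 1) hν.le
        ((Incompressible.contDiff_truncate _).continuous.comp_aestronglyMeasurable hlm)
        (Filter.Eventually.of_forall fun x => Incompressible.abs_truncate_le (by positivity) _)
        (hJ k 1 le_rfl))
    rwa [add_zero] at this
  · choose ψ H using Incompressible.exists_testLimit hu₀.1 hu hv.1
    have key := Incompressible.ae_eq_of_energy_le hν hM hv.1.1.1 hu.1.1 hv.1.1.2 hu.1.2 hlam hJ H
      (hv.2 u hu)
    have h0 : ∀ᵐ x ∂Incompressible.diskMeasure, v x 0 - u x 0 = 0 := key 0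
    have h1 : ∀ᵐ x ∂Incompressible.diskMeasure, v x 1 - u x 1 = 0 := key 1
    filter_upwards [h0, h1] with x e0 e1
    ext j
    fin_cases j
    exacts [sub_eq_zero.1 e0, sub_eq_zero.1 e1]
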